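/- Let $d\in\{1,2,3\}$, let $\Omega\subset\mathbb R^d$ be a bounded convex polytopal domain (the nonempty interior of the convex hull of finitely many points), and let $A=-\Delta$ with homogeneous Dirichlet boundary condition, $D(A)=H_0^1(\Omega)\cap H^2(\Omega)$. Let $\mu\in C[0,1]$ with $\mu\ge 0$ and $\mu(0)\mu(1)>0$, and put $$D_t^{[\mu]}\varphi(t)=\int_0^1 D_t^\alpha\varphi(t)\,\mu(\alpha)\,d\alpha,\qquad D_t^\alpha\varphi(t)=\frac1{\Gamma(1-\alpha)}\int_0^t(t-s)^{-\alpha}\varphi'(s)\,ds .$$ For a finite conforming triangulation of $\overline\Omega$ into $d$-simplices, let $X_h$ be the space of continuous functions on $\overline\Omega$ that are affine on each simplex and vanish on $\partial\Omega$. Let $A_h:X_h\to X_h$ be defined by $(A_h\varphi,\chi)=(\nabla\varphi,\nabla\chi)$ for all $\chi\in X_h$, and the Ritz projection $R_h v\in X_h$ by $(\nabla R_hv,\nabla\chi)=(\nabla v,\nabla\chi)$ for all $\chi\in X_h$, where $(\cdot,\cdot)$ is the $L^2(\Omega)$ inner product. Then there is a constant $c>0$, depending only on $d$, $\Omega$ and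 $\mu$ (not on the triangulation, $v$, $T$, $N$, $\tau$ or $n$), such that the following holds for every such triangulation, every $v\in D(A)$, every $T>0$ and every integer $N\ge1$. Let $\tau=T/N$, $t_n=n\tau$, $v_h=R_hv$. Let $u_h$ be the solution of the semidiscrete problem $$D_t^{[\mu]}u_h(t)+A_hu_h(t)=0,\quad 0<t\le T,\qquad u_h(0)=v_h,$$ in the class $u_h\in C([0,T];X_h)\cap C^1((0,T];X_h)$ with $u_h'\in L^1(0,T;X_h)$. Let $(U_h^n)_{n=0}^N\subset X_h$ be the solution of the backward Euler convolution quadrature scheme $$\sum_{j=1}^n b_{n-j}U_h^j+A_hU_h^n=\Big(\sum_{j=1}^n b_{n-j}\Big)v_h,\quad n=1,\dots,N,\qquad U_h^0=v_h,$$ where the weights $b_j$ are given by the power series expansion $\sum_{j\ge0}b_j\xi^j=\int_0^1\big(\tfrac{1-\xi}\tau\big)^\alpha\mu(\alpha)\,d\alpha$ at $\xi=0$. Then, for $n=1,\dots,N$, $$\|u_h(t_n)-U_h^n\|_{L^2(\Omega)}\le c\,\tau\,\log\!\big(\max(t_n^{-1},2)\big)\,\|Av\|_{L^2(\Omega)}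 .$$ -/

import Mathlib

open MeasureTheory Set
open scoped ENNReal ContDiff

noncomputable section

namespace DistrOrder

/-- The Euclidean space `ℝᵈ`. -/
abbrev Euc (d : ℕ) : Type := EuclideanSpace ℝ (Fin d)

variable {d : ℕ}

/-! ### Domain, `L²`, Sobolev spaces and the Dirichlet Laplacian -/

/-- A bounded convex polytopal domain (an interval for `d = 1`, a polygon for `d = 2`, a polyhedron
for `d = 3`): the nonempty interior of the convex hull of finitely many points. -/
def IsConvexPolytopeDomain (Ω : Set (Euc d)) : Prop :=
  Ω.Nonempty ∧ ∃ S : Finset (Euc d), Ω = interior (convexHull ℝ (S : Set (Euc d)))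

/-- The `L²(Ω)` inner product of real functions. -/
def l2Inner (Ω : Set (Euc d)) (f g : Euc d → ℝ) : ℝ := ∫ x in Ω, f x * g x

/-- The `L²(Ω)` norm (used only for square integrable functions). -/
def l2Norm (Ω : Set (Euc d)) (f : Euc d → ℝ) : ℝ :=
  (eLpNorm f 2 (volume.restrict Ω)).toReal

/-- Test functions: `C^∞` functions with compact support contained in `Ω`. -/
def IsTestFunction (Ω : Set (Euc d)) (φ : Euc d → ℝ) : Prop :=
  ContDiff ℝ ∞ φ ∧ HasCompactSupport φ ∧ tsupport φ ⊆ Ω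

/-- The classical `i`-th partial derivative. -/
def partialDeriv (i : Fin d) (φ : Euc d → ℝ) (x : Euc d) : ℝ :=
  fderiv ℝ φ x (EuclideanSpace.single i 1)

/-- `g ∈ L²(Ω)` is a weak `i`-th partial derivative of `u` on `Ω`. -/
def IsWeakPartial (Ω : Set (Euc d)) (i : Fin d) (u g : Euc d → ℝ) : Prop :=
  MemLp g 2 (volume.restrict Ω) ∧
    ∀ φ : Euc d → ℝ, IsTestFunction Ω φ →
      ∫ x in Ω, u x * partialDeriv i φ x = -∫ x in Ω, g x * φ x

open Classical in
/-- The weak `i`-th partial derivative `∂ᵢu ∈ L²(Ω)`, which is unique almost everywhere on `Ω`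
(and zero, by convention, if there is none). -/
def weakPartial (Ω : Set (Euc d)) (i : Fin d) (u : Euc d → ℝ) : Euc d → ℝ :=
  if h : ∃ g, IsWeakPartial Ω i u g then h.choose else 0

/-- `u ∈ H¹(Ω)`. -/
def MemH1 (Ω : Set (Euc d)) (u : Euc d → ℝ) : Prop :=
  MemLp u 2 (volume.restrict Ω) ∧ ∀ i, ∃ g, IsWeakPartial Ω i u g

/-- `u ∈ H²(Ω)`. -/
def MemH2 (Ω : Set (Euc d)) (u : Euc d → ℝ) : Prop :=
  MemH1 Ω u ∧ ∀ i, MemH1 Ω (weakPartial Ω i u)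

/-- `u ∈ H¹₀(Ω)`: `u` lies in the closure of the test functions in `H¹(Ω)`. -/
def MemH10 (Ω : Set (Euc d)) (u : Euc d → ℝ) : Prop :=
  MemH1 Ω u ∧ ∀ ε : ℝ≥0∞, 0 < ε → ∃ φ : Euc d → ℝ, IsTestFunction Ω φ ∧
    eLpNorm (fun x => u x - φ x) 2 (volume.restrict Ω) < ε ∧
    ∀ i, eLpNorm (fun x => weakPartial Ω i u x - partialDeriv i φ x) 2 (volume.restrict Ω) < ε

/-- The domain `D(A) = H¹₀(Ω) ∩ H²(Ω)` of the Dirichlet Laplacian `A = -Δ`. -/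
def MemDomA (Ω : Set (Euc d)) (v : Euc d → ℝ) : Prop := MemH10 Ω v ∧ MemH2 Ω v

/-- `A v = -Δ v = -∑ᵢ ∂ᵢ∂ᵢ v`. -/
def opA (Ω : Set (Euc d)) (v : Euc d → ℝ) : Euc d → ℝ :=
  fun x => -∑ i, weakPartial Ω i (weakPartial Ω i v) x

/-- The Dirichlet form `a(u, w) = (∇u, ∇w)`. -/
def dirichletForm (Ω : Set (Euc d)) (u w : Euc d → ℝ) : ℝ :=
  ∑ i, l2Inner Ω (weakPartial Ω i u) (weakPartial Ω i w)

/-! ### Finite elements -/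

/-- `K` is a (conforming, finite) triangulation of `Ω`. Since `K` is finite and its underlying space
is the closure of the convex open set `Ω`, every face of `K` lies in a `d`-simplex of `K`. -/
def IsTriangulation (Ω : Set (Euc d)) (K : Geometry.SimplicialComplex ℝ (Euc d)) : Prop :=
  K.faces.Finite ∧ K.space = closure Ω

/-- `χ` belongs to the finite element space `X_h` of the triangulation `K`: it is continuous, affine
on each simplex of `K`, and vanishes on `∂Ω`. Elements of `X_h` are extended by zero outside `Ω`,
so that continuity on the whole space includes the boundary condition. -/
def MemFEM (Ω : Set (Euc d)) (K : Geometry.SimplicialComplex ℝ (Euc d)) (χ : Euc d → ℝ) : Prop :=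
  Continuous χ ∧ (∀ x, x ∉ Ω → χ x = 0) ∧
    ∀ s ∈ K.faces, ∃ ℓ : Euc d →ᵃ[ℝ] ℝ, EqOn χ ℓ (convexHull ℝ (s : Set (Euc d)))

/-- `vh = R_h v`, the Ritz projection of `v` onto `X_h`. -/
def IsRitzProjection (Ω : Set (Euc d)) (K : Geometry.SimplicialComplex ℝ (Euc d))
    (v vh : Euc d → ℝ) : Prop :=
  MemFEM Ω K vh ∧ ∀ χ, MemFEM Ω K χ → dirichletForm Ω vh χ = dirichletForm Ω v χ

/-! ### The distributed order derivative and the semidiscrete problem -/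

/-- The Caputo derivative `1/Γ(1-α) ∫₀ᵗ (t-s)^(-α) f'(s) ds`. -/
def caputo (α : ℝ) (f : ℝ → ℝ) (t : ℝ) : ℝ :=
  1 / Real.Gamma (1 - α) * ∫ s in (0 : ℝ)..t, (t - s) ^ (-α) * deriv f s

/-- The distributed order derivative `∫₀¹ (D^α f)(t) μ(α) dα`. -/
def distrDeriv (μ : ℝ → ℝ) (f : ℝ → ℝ) (t : ℝ) : ℝ :=
  ∫ α in (0 : ℝ)..1, caputo α f t * μ α

/-- `u` solves, on `[0, T]`, the semidiscrete problem `D^μ u + A_h u = 0` in `X_h`, `u(0) = vh`,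
where `A_h : X_h → X_h` is given by `(A_h φ, χ) = a(φ, χ)` for all `χ ∈ X_h`; the equation is tested
with all `χ ∈ X_h`. The function `u` is of class `C([0, T]; X_h) ∩ C¹((0, T]; X_h)` with
`u' ∈ L¹(0, T; X_h)`; as `X_h` is finite dimensional, this regularity is expressed pointwise in
space. For such `u` all integrals in `D^μ u(t)`, `0 < t ≤ T`, converge absolutely. -/
structure IsSemidiscreteSolution (Ω : Set (Euc d)) (K : Geometry.SimplicialComplex ℝ (Euc d))
    (μ : ℝ → ℝ) (T : ℝ) (vh : Euc d → ℝ) (u : ℝ → Euc d → ℝ) : Prop where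
  mem : ∀ t ∈ Icc 0 T, MemFEM Ω K (u t)
  init : u 0 = vh
  cont : ∀ x, ContinuousOn (fun t => u t x) (Icc 0 T)
  contDiff : ∀ x, ContDiffOn ℝ 1 (fun t => u t x) (Ioc 0 T)
  integrable : ∀ x, IntervalIntegrable (deriv fun t => u t x) volume 0 T
  eqn : ∀ t ∈ Ioc 0 T, ∀ χ, MemFEM Ω K χ →
    l2Inner Ω (fun x => distrDeriv μ (fun s => u s x) t) χ + dirichletForm Ω (u t) χ = 0

/-! ### Convolution quadrature generated by the backward Euler method -/

/-- The generating function `ω(ξ) = ∫₀¹ ((1-ξ)/τ)^α μ(α) dα`. -/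
def cqSymbol (μ : ℝ → ℝ) (τ ξ : ℝ) : ℝ :=
  ∫ α in (0 : ℝ)..1, ((1 - ξ) / τ) ^ α * μ α

/-- The weights `b_j`: the coefficients of the power series expansion `ω(ξ) = ∑ⱼ b_j ξ^j`. -/
def cqWeight (μ : ℝ → ℝ) (τ : ℝ) (j : ℕ) : ℝ :=
  iteratedDeriv j (cqSymbol μ τ) 0 / (j.factorial : ℝ)

/-- `Q_n(φ) = ∑_{j=1}^n b_{n-j} φ^j`. -/
def cqSum (μ : ℝ → ℝ) (τ : ℝ) (n : ℕ) (φ : ℕ → ℝ) : ℝ :=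
  ∑ j ∈ Finset.Icc 1 n, cqWeight μ τ (n - j) * φ j

/-- `U = (Uⁿ)` solves the fully discrete scheme `Q_n(U) + A_h Uⁿ = Q_n(1) vh`, `n = 1, …, N`, in
`X_h`, with `U⁰ = vh` and step size `τ`; the equation is tested with all `χ ∈ X_h`. -/
structure IsFullyDiscreteSolution (Ω : Set (Euc d)) (K : Geometry.SimplicialComplex ℝ (Euc d))
    (μ : ℝ → ℝ) (τ : ℝ) (N : ℕ) (vh : Euc d → ℝ) (U : ℕ → Euc d → ℝ) : Prop where
  mem : ∀ n ≤ N, MemFEM Ω K (U n)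
  init : U 0 = vh
  eqn : ∀ n, 1 ≤ n → n ≤ N → ∀ χ, MemFEM Ω K χ →
    l2Inner Ω (fun x => cqSum μ τ n fun j => U j x) χ + dirichletForm Ω (U n) χ =
      l2Inner Ω (fun x => cqSum μ τ n (fun _ => 1) * vh x) χ

/-- The logarithmic factor `ℓ₂(t) = log (max (t⁻¹, 2))`. -/
def logFactor (t : ℝ) : ℝ := Real.log (max t⁻¹ 2)

end DistrOrder

end

/-! Expanding in an L²-orthonormal eigenbasis e_i of A_h reduces the claim to the scalar relaxation
equation D^[μ] f + λ f = 0 and its scalar quadrature scheme, provided the scalar error is at most C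
τ log(max(1/t_n, 2)) · λ |f(0)| with C independent of λ. Indeed λ_i (v_h, e_i) = (∇v_h, ∇e_i) = (∇v,
∇e_i) = (Av, e_i) by the Ritz property and Green's formula, and Bessel's inequality sums the modes.

The scalar bound rests on one representation. Let w(z) = ∫ z^α μ(α) dα. Because 0 < α < 1, w has
positive imaginary part in the upper half-plane, and w/(w+λ) inherits a nonnegative one. Cauchy's
theorem in the plane cut along the negative axis then yields a probability measure ν on (0, ∞) with
∫ (z+r)⁻¹ dν(r) = w(z) / (z (w(z)+λ)) (`exists_spectral_measure`). The same ν describes both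
solutions: f(t) = f(0) ∫ e^(-rt) dν, by Laplace transforms (`relaxation_solution_eq`), and U^n =
f(0) ∫ (1+τr)^(-n) dν, by generating functions (`discrete_solution_eq`). So the quadrature amounts
to backward Euler applied to each exponential e^(-rt).

For one exponential the error is at most 8 τ r / (1 + t_n r) (`abs_backwardEuler_sub_exp_le`), and ν
integrates this bound exactly: with z = 1/t_n the result is 8 τ λ z/(w(z)+λ) ≤ 8 τ λ z/w(z). As μ is
bounded below near 1, w(z) is at least a multiple of z / log z for large z, which is the source of
the logarithm (`exists_div_symbol_le`).

The reduction to modes needs Green's formula for finite element functions. These are Lipschitz, so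
their weak derivatives are almost everywhere classical, and the definition of weak derivatives
extends to them by mollification and soft thresholding (`IsWeakPartial.integral_lipPartial`). -/

namespace DistrOrder

/-! ### The symbol w in the logarithmic variable: positivity, zeros and limits. -/

section Symbol
open ProbabilityTheory Filter Topology Complex

variable {m : Measure ℝ}

/-- The symbol `w(z) = ∫ z^α dm(α)` of the distributed order derivative of weight `m`. -/
noncomputable def symbol (m : Measure ℝ) (z : ℝ) : ℝ := ∫ α, z ^ α ∂m

/-- The substitution z = e^x makes the complex extension entire and turns the cut plane into the
strip |Im| ≤ π, whose two edges are the two sides of the cut; no branch of z^α has to be handled. -/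
lemma symbol_eq_mgf {z : ℝ} (hz : 0 < z) : symbol m z = mgf id m (Real.log z) := by
  simp only [symbol, mgf, id]
  congr 1 with α
  rw [Real.rpow_def_of_pos hz]

lemma integrable_exp_mul_of_Ioo [IsFiniteMeasure m] (hm : ∀ᵐ α ∂m, α ∈ Ioo (0 : ℝ) 1) (x : ℝ) :
    Integrable (fun α => Real.exp (x * α)) m := by
  refine Integrable.of_bound (by fun_prop) (Real.exp |x|) ?_
  filter_upwards [hm] with α hα
  rw [Real.norm_eq_abs, Real.abs_exp]
  apply Real.exp_le_exp.2
  calc x * α ≤ |x| * α := by gcongr; exacts [hα.1.le, le_abs_self x]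
    _ ≤ |x| * 1 := by gcongr; exact hα.2.le
    _ = |x| := mul_one _

lemma integrableExpSet_eq_univ [IsFiniteMeasure m] (hm : ∀ᵐ α ∂m, α ∈ Ioo (0 : ℝ) 1) :
    integrableExpSet id m = univ :=
  eq_univ_of_forall fun x => integrable_exp_mul_of_Ioo hm x

lemma differentiable_complexMGF_id [IsFiniteMeasure m] (hm : ∀ᵐ α ∂m, α ∈ Ioo (0 : ℝ) 1) :
    Differentiable ℂ (complexMGF id m) := fun z =>
  (hasDerivAt_complexMGF (by simp [integrableExpSet_eq_univ hm])).differentiableAt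

lemma integrable_cexp_mul [IsFiniteMeasure m] (hm : ∀ᵐ α ∂m, α ∈ Ioo (0 : ℝ) 1) (z : ℂ) :
    Integrable (fun α : ℝ => cexp (z * α)) m := by
  refine (integrable_exp_mul_of_Ioo hm z.re).mono' (by fun_prop) (ae_of_all _ fun α => ?_)
  simp [Complex.norm_exp]

lemma complexMGF_id_im [IsFiniteMeasure m] (hm : ∀ᵐ α ∂m, α ∈ Ioo (0 : ℝ) 1) (z : ℂ) :
    (complexMGF id m z).im = ∫ α, Real.exp (z.re * α) * Real.sin (z.im * α) ∂m := by
  have h := integral_im (integrable_cexp_mul hm z)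
  simp only [complexMGF, id]
  rw [show (∫ x : ℝ, cexp (z * x) ∂m).im = RCLike.im (∫ x : ℝ, cexp (z * x) ∂m) from rfl, ← h]
  congr 1 with α
  simp [Complex.exp_im]

lemma complexMGF_id_re [IsFiniteMeasure m] (hm : ∀ᵐ α ∂m, α ∈ Ioo (0 : ℝ) 1) (z : ℂ) :
    (complexMGF id m z).re = ∫ α, Real.exp (z.re * α) * Real.cos (z.im * α) ∂m := by
  have h := integral_re (integrable_cexp_mul hm z)
  simp only [complexMGF, id]
  rw [show (∫ x : ℝ, cexp (z * x) ∂m).re = RCLike.re (∫ x : ℝ, cexp (z * x) ∂m) from rfl, ← h]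
  congr 1 with α
  simp [Complex.exp_re]

lemma complexMGF_id_conj (z : ℂ) :
    complexMGF id m (starRingEnd ℂ z) = starRingEnd ℂ (complexMGF id m z) := by
  simp only [complexMGF, ← integral_conj]
  congr 1 with α
  simp [← Complex.exp_conj]

/-- Concavity of the sine on [0, π]: yα is the convex combination of 0 and πα with weight y/π. It
compares every angle with the extreme angle π. -/
lemma sin_mul_lower {y α : ℝ} (hy : 0 ≤ y) (hyπ : y ≤ Real.pi) (hα : α ∈ Ioo (0 : ℝ) 1) :
    y / Real.pi * Real.sin (Real.pi * α) ≤ Real.sin (y * α) := by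
  have hπ := Real.pi_pos
  have h := strictConcaveOn_sin_Icc.concaveOn.2 (show (0 : ℝ) ∈ Icc 0 Real.pi from ⟨le_rfl, hπ.le⟩)
    (show Real.pi * α ∈ Icc 0 Real.pi from ⟨by nlinarith [hα.1], by nlinarith [hα.2]⟩)
    (show 0 ≤ 1 - y / Real.pi by rw [sub_nonneg, div_le_one hπ]; exact hyπ)
    (show 0 ≤ y / Real.pi by positivity) (by ring)
  simp only [smul_eq_mul, mul_zero, Real.sin_zero, zero_add] at h
  rwa [show y / Real.pi * (Real.pi * α) = y * α by field_simp] at h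

lemma integral_pos_of_ae_pos [IsFiniteMeasure m] (hm0 : m ≠ 0) {f : ℝ → ℝ} (hf : Integrable f m)
    (hpos : ∀ᵐ α ∂m, 0 < f α) : 0 < ∫ α, f α ∂m := by
  rw [integral_pos_iff_support_of_nonneg_ae (hpos.mono fun _ h => h.le) hf]
  have : Function.support f =ᵐ[m] univ := by
    filter_upwards [hpos] with α hα
    simp only [eq_iff_iff]
    exact ⟨fun _ => trivial, fun _ => hα.ne'⟩
  rw [measure_congr this]
  exact Measure.measure_univ_pos.2 hm0

lemma integrable_exp_mul_sin [IsFiniteMeasure m] (hm : ∀ᵐ α ∂m, α ∈ Ioo (0 : ℝ) 1) (x y : ℝ) :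
    Integrable (fun α => Real.exp (x * α) * Real.sin (y * α)) m := by
  refine (integrable_exp_mul_of_Ioo hm x).mono' (by fun_prop) (ae_of_all _ fun α => ?_)
  rw [norm_mul, Real.norm_eq_abs, Real.abs_exp]
  exact mul_le_of_le_one_right (Real.exp_pos _).le (Real.abs_sin_le_one _)

lemma sin_pi_mul_pos {α : ℝ} (hα : α ∈ Ioo (0 : ℝ) 1) : 0 < Real.sin (Real.pi * α) :=
  Real.sin_pos_of_pos_of_lt_pi (mul_pos Real.pi_pos hα.1)
    (by nlinarith [hα.2, Real.pi_pos])

lemma complexMGF_id_im_pos [IsFiniteMeasure m] (hm : ∀ᵐ α ∂m, α ∈ Ioo (0 : ℝ) 1) (hm0 : m ≠ 0)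
    {z : ℂ} (h0 : 0 < z.im) (hπ : z.im ≤ Real.pi) : 0 < (complexMGF id m z).im := by
  rw [complexMGF_id_im hm]
  refine integral_pos_of_ae_pos hm0 (integrable_exp_mul_sin hm _ _) ?_
  filter_upwards [hm] with α hα
  refine mul_pos (Real.exp_pos _) ((mul_pos (div_pos h0 Real.pi_pos) (sin_pi_mul_pos hα)).trans_le
    (sin_mul_lower h0.le hπ hα))

lemma complexMGF_id_re_nonneg [IsFiniteMeasure m] (hm : ∀ᵐ α ∂m, α ∈ Ioo (0 : ℝ) 1)
    {z : ℂ} (hπ : |z.im| ≤ Real.pi / 2) : 0 ≤ (complexMGF id m z).re := by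
  rw [complexMGF_id_re hm]
  refine integral_nonneg_of_ae ?_
  filter_upwards [hm] with α hα
  refine mul_nonneg (Real.exp_pos _).le (Real.cos_nonneg_of_mem_Icc ?_)
  rw [abs_le] at hπ
  have := Real.pi_pos
  constructor
  · nlinarith [hα.1, hα.2]
  · nlinarith [hα.1, hα.2]

/-- In the right half of the strip `|Im z| ≤ π`, the function `W + lam` is bounded below. -/
lemma exists_norm_complexMGF_add_ge [IsFiniteMeasure m] (hm : ∀ᵐ α ∂m, α ∈ Ioo (0 : ℝ) 1)
    (hm0 : m ≠ 0) {lam : ℝ} (hl : 0 < lam) :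
    ∃ c : ℝ, 0 < c ∧ ∀ z : ℂ, 0 ≤ z.re → |z.im| ≤ Real.pi → c ≤ ‖complexMGF id m z + lam‖ := by
  set c0 := ∫ α, Real.exp (0 * α) * Real.sin (Real.pi * α) ∂m with hc0
  have hc0p : 0 < c0 := by
    refine integral_pos_of_ae_pos hm0 (integrable_exp_mul_sin hm _ _) ?_
    filter_upwards [hm] with α hα
    exact mul_pos (Real.exp_pos _) (sin_pi_mul_pos hα)
  have key : ∀ z : ℂ, 0 ≤ z.re → 0 ≤ z.im → z.im ≤ Real.pi →
      min lam (c0 / 2) ≤ ‖complexMGF id m z + lam‖ := by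
    intro z hre him hπ
    -- For angles up to π/2 the real part of W is nonnegative, so λ survives. For larger angles the
    -- imaginary part is at least half its value at z = iπ, since Im z / π ≥ 1/2 and e^(α Re z) ≥ 1.
    by_cases h : z.im ≤ Real.pi / 2
    · have h1 := complexMGF_id_re_nonneg hm (z := z) (by rwa [abs_of_nonneg him])
      refine (min_le_left _ _).trans (le_trans ?_ (Complex.re_le_norm _))
      simpa using h1
    · push Not at h
      refine (min_le_right _ _).trans (le_trans ?_ (Complex.abs_im_le_norm _))
      refine le_trans ?_ (le_abs_self _)
      simp only [add_im, ofReal_im, add_zero]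
      rw [complexMGF_id_im hm, hc0, ← integral_div]
      refine integral_mono_ae ((integrable_exp_mul_sin hm _ _).div_const _)
        (integrable_exp_mul_sin hm _ _) ?_
      filter_upwards [hm] with α hα
      have h1 := sin_mul_lower him hπ hα
      have h2 : 1 / 2 ≤ z.im / Real.pi := by
        rw [div_le_div_iff₀ two_pos Real.pi_pos]; linarith
      have h3 := sin_pi_mul_pos hα
      have h4 : 1 ≤ Real.exp (z.re * α) := Real.one_le_exp (mul_nonneg hre hα.1.le)
      have h5 : Real.sin (Real.pi * α) / 2 ≤ Real.sin (z.im * α) := by nlinarith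
      simp only [zero_mul, Real.exp_zero, one_mul]
      nlinarith
  refine ⟨min lam (c0 / 2), lt_min hl (half_pos hc0p), fun z hre him => ?_⟩
  rcases le_total 0 z.im with h | h
  · exact key z hre h (le_trans (le_abs_self _) him)
  · have := key (starRingEnd ℂ z) (by simpa using hre) (by simpa using h)
      (by simpa using (neg_le_abs _).trans him)
    rw [complexMGF_id_conj, ← Complex.conj_ofReal lam, ← map_add, Complex.norm_conj] at this
    simpa using this

/-- Off the real axis the imaginary part is nonzero; on it the real part is at least λ. -/
lemma complexMGF_add_ne_zero [IsFiniteMeasure m] (hm : ∀ᵐ α ∂m, α ∈ Ioo (0 : ℝ) 1)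
    (hm0 : m ≠ 0) {lam : ℝ} (hl : 0 < lam) {z : ℂ} (hz : |z.im| ≤ Real.pi) :
    complexMGF id m z + lam ≠ 0 := by
  intro h0
  have him := congrArg Complex.im h0
  have hre := congrArg Complex.re h0
  simp only [add_im, ofReal_im, add_zero, zero_im, add_re, ofReal_re, zero_re] at him hre
  rcases lt_trichotomy z.im 0 with h | h | h
  · have := complexMGF_id_im_pos hm hm0 (z := starRingEnd ℂ z) (by simpa using h)
      (by simpa using (neg_le_abs _).trans hz)
    rw [complexMGF_id_conj] at this
    simp at this
    linarith
  · have := complexMGF_id_re_nonneg hm (z := z) (by rw [h]; simp; positivity)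
    linarith
  · have := complexMGF_id_im_pos hm hm0 (z := z) h ((le_abs_self _).trans hz)
    linarith

lemma mgf_id_pos [IsFiniteMeasure m] (hm : ∀ᵐ α ∂m, α ∈ Ioo (0 : ℝ) 1) (hm0 : m ≠ 0) (x : ℝ) :
    0 < mgf id m x :=
  integral_pos_of_ae_pos hm0 (integrable_exp_mul_of_Ioo hm x) (ae_of_all _ fun _ => Real.exp_pos _)

lemma tendsto_mgf_id_atBot [IsFiniteMeasure m] (hm : ∀ᵐ α ∂m, α ∈ Ioo (0 : ℝ) 1) :
    Tendsto (fun x => mgf id m x) atBot (𝓝 0) := by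
  have : Tendsto (fun x => ∫ α, Real.exp (x * id α) ∂m) atBot (𝓝 (∫ _, 0 ∂m)) := by
    refine tendsto_integral_filter_of_dominated_convergence (fun _ => 1) ?_ ?_
      (integrable_const _) ?_
    · exact Eventually.of_forall fun x => by fun_prop
    · filter_upwards [eventually_le_atBot (0 : ℝ)] with x hx
      filter_upwards [hm] with α hα
      rw [Real.norm_eq_abs, Real.abs_exp, Real.exp_le_one_iff]
      exact mul_nonpos_of_nonpos_of_nonneg hx hα.1.le
    · filter_upwards [hm] with α hα
      exact Real.tendsto_exp_atBot.comp (tendsto_id.atBot_mul_const hα.1)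
  simpa [mgf] using this

lemma tendsto_mgf_id_atTop [IsFiniteMeasure m] (hm : ∀ᵐ α ∂m, α ∈ Ioo (0 : ℝ) 1) (hm0 : m ≠ 0) :
    Tendsto (fun x => mgf id m x) atTop atTop := by
  have hint : Integrable (fun α : ℝ => α) m := by
    refine Integrable.of_bound (by fun_prop) 1 ?_
    filter_upwards [hm] with α hα
    rw [Real.norm_eq_abs, abs_of_pos hα.1]; exact hα.2.le
  have hp : 0 < ∫ α, α ∂m := integral_pos_of_ae_pos hm0 hint (hm.mono fun α h => h.1)
  refine tendsto_atTop_mono (fun x => ?_) (tendsto_id.atTop_mul_const hp)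
  simp only [id, mgf]
  rw [← integral_const_mul]
  refine integral_mono (hint.const_mul _) (integrable_exp_mul_of_Ioo hm x) fun α => ?_
  have := Real.add_one_le_exp (x * α)
  simp only; linarith

end Symbol

/-! ### The spectral measure, from Cauchy's theorem in the strip. -/

section Spectral
open ProbabilityTheory Filter Topology Complex

variable {m : Measure ℝ}

/-- The closed strip `|Im z| ≤ π`. -/
def strip : Set ℂ := {z | |z.im| ≤ Real.pi}

lemma strip_mem_nhds (x : ℝ) : strip ∈ 𝓝 (x : ℂ) := by
  have : Continuous fun z : ℂ => |z.im| := by fun_prop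
  have h := this.continuousAt (x := (x : ℂ)) |>.eventually
    (p := fun t => t < Real.pi) (by simpa using gt_mem_nhds Real.pi_pos)
  exact h.mono fun z hz => le_of_lt hz

/-- The function `w / (w + lam)` in the logarithmic variable. -/
noncomputable def resolventSymbol (m : Measure ℝ) (lam : ℝ) (z : ℂ) : ℂ :=
  complexMGF id m z / (complexMGF id m z + lam)

lemma differentiableOn_resolventSymbol [IsFiniteMeasure m] (hm : ∀ᵐ α ∂m, α ∈ Ioo (0 : ℝ) 1)
    (hm0 : m ≠ 0) {lam : ℝ} (hl : 0 < lam) :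
    DifferentiableOn ℂ (resolventSymbol m lam) strip := by
  have h := differentiable_complexMGF_id hm
  exact h.differentiableOn.div (h.differentiableOn.add_const _)
    fun z hz => complexMGF_add_ne_zero hm hm0 hl hz

lemma resolventSymbol_conj (lam : ℝ) (z : ℂ) :
    resolventSymbol m lam (starRingEnd ℂ z) = starRingEnd ℂ (resolventSymbol m lam z) := by
  simp [resolventSymbol, complexMGF_id_conj]

/-- Im (W/(W+λ)) = λ Im W / |W+λ|². -/
lemma resolventSymbol_im_nonneg [IsFiniteMeasure m] (hm : ∀ᵐ α ∂m, α ∈ Ioo (0 : ℝ) 1)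
    (hm0 : m ≠ 0) {lam : ℝ} (hl : 0 < lam) {z : ℂ} (h0 : 0 < z.im) (hπ : z.im ≤ Real.pi) :
    0 ≤ (resolventSymbol m lam z).im := by
  have h1 := complexMGF_id_im_pos hm hm0 h0 hπ
  have h2 := complexMGF_add_ne_zero hm hm0 hl (z := z) (by rwa [abs_of_pos h0])
  have h3 : 0 < normSq (complexMGF id m z + lam) := normSq_pos.2 h2
  rw [resolventSymbol, Complex.div_im]
  have h4 : (complexMGF id m z).im * (complexMGF id m z + lam).re / normSq (complexMGF id m z + lam)
      - (complexMGF id m z).re * (complexMGF id m z + lam).im / normSq (complexMGF id m z + lam)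
      = lam * (complexMGF id m z).im / normSq (complexMGF id m z + lam) := by
    simp; ring
  rw [h4]; positivity

/-- The exponential identifies the two edges of the strip, but another point with the exponential of
a real x differs from x by a nonzero multiple of 2πi and so lies outside. -/
lemma cexp_ne_of_mem_strip {z : ℂ} (hz : z ∈ strip) {x : ℝ} (hne : z ≠ x) :
    cexp z ≠ cexp x := by
  intro h
  obtain ⟨n, hn⟩ := Complex.exp_eq_exp_iff_exists_int.1 h
  have him : z.im = n * (2 * Real.pi) := by rw [hn]; simp
  have hz' : |z.im| ≤ Real.pi := hz
  have hπ := Real.pi_pos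
  have hn0 : n = 0 := by
    rw [him, abs_mul, abs_of_pos (by positivity : 0 < 2 * Real.pi)] at hz'
    by_contra h0
    have : (1 : ℝ) ≤ |(n : ℝ)| := by exact_mod_cast Int.one_le_abs h0
    nlinarith
  exact hne (by simpa [hn0] using hn)

/-- The difference quotient of `w / (w + lam)` against the exponential; it is holomorphic in the
strip. -/
noncomputable def expQuotient (m : Measure ℝ) (lam x : ℝ) (z : ℂ) : ℂ :=
  dslope (resolventSymbol m lam) x z / dslope cexp x z

lemma expQuotient_of_ne {lam x : ℝ} {z : ℂ} (hne : z ≠ x) :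
    expQuotient m lam x z =
      (resolventSymbol m lam z - resolventSymbol m lam x) / (cexp z - cexp x) := by
  rw [expQuotient, dslope_of_ne _ hne, dslope_of_ne _ hne, slope_def_field, slope_def_field]
  have : z - x ≠ 0 := sub_ne_zero.2 hne
  field_simp

/-- Both slopes extend holomorphically through x. In the variable ζ = e^z, with F = w/(w+λ),
integrating the quotient means integrating (F(ζ) - F(ζ₀)) / (ζ (ζ - ζ₀)) dζ around the cut: the
subtraction removes the pole at ζ₀, and the left edge collects the contribution of ζ = 0. -/
lemma differentiableOn_expQuotient [IsFiniteMeasure m] (hm : ∀ᵐ α ∂m, α ∈ Ioo (0 : ℝ) 1)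
    (hm0 : m ≠ 0) {lam : ℝ} (hl : 0 < lam) (x : ℝ) :
    DifferentiableOn ℂ (expQuotient m lam x) strip := by
  refine DifferentiableOn.div
    ((Complex.differentiableOn_dslope (strip_mem_nhds x)).2
      (differentiableOn_resolventSymbol hm hm0 hl))
    ((Complex.differentiableOn_dslope (strip_mem_nhds x)).2
      Complex.differentiable_exp.differentiableOn) fun z hz => ?_
  by_cases hne : z = x
  · rw [hne, dslope_same, Complex.deriv_exp]; exact Complex.exp_ne_zero _
  · rw [dslope_of_ne _ hne, slope_def_field]
    exact div_ne_zero (sub_ne_zero.2 (cexp_ne_of_mem_strip hz hne)) (sub_ne_zero.2 hne)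

/-- The boundary density `Im (w / (w + lam))` on the negative half-axis. -/
noncomputable def boundaryDensity (m : Measure ℝ) (lam x : ℝ) : ℝ :=
  (resolventSymbol m lam (x + Real.pi * I)).im

lemma boundaryDensity_nonneg [IsFiniteMeasure m] (hm : ∀ᵐ α ∂m, α ∈ Ioo (0 : ℝ) 1)
    (hm0 : m ≠ 0) {lam : ℝ} (hl : 0 < lam) (x : ℝ) : 0 ≤ boundaryDensity m lam x :=
  resolventSymbol_im_nonneg hm hm0 hl (by simpa using Real.pi_pos) (by simp)

lemma continuous_boundaryDensity [IsFiniteMeasure m] (hm : ∀ᵐ α ∂m, α ∈ Ioo (0 : ℝ) 1)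
    (hm0 : m ≠ 0) {lam : ℝ} (hl : 0 < lam) : Continuous (boundaryDensity m lam) := by
  refine Complex.continuous_im.comp
    ((differentiableOn_resolventSymbol hm hm0 hl).continuousOn.comp_continuous (by fun_prop)
      fun x => ?_)
  simp [strip, abs_of_pos Real.pi_pos]

/-- On both edges the exponential equals -e^x, so the denominators agree, while the numerators
differ by a value of w/(w+λ) minus its conjugate. -/
lemma expQuotient_boundary {lam x0 : ℝ} (x : ℝ) :
    expQuotient m lam x0 (x + (-Real.pi : ℝ) * I) - expQuotient m lam x0 (x + (Real.pi : ℝ) * I) =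
      2 * I * ((boundaryDensity m lam x / (Real.exp x + Real.exp x0) : ℝ) : ℂ) := by
  have hne1 : (x + (-Real.pi : ℝ) * I : ℂ) ≠ x0 := fun h => by
    have := congrArg Complex.im h; simp [Real.pi_ne_zero] at this
  have hne2 : (x + (Real.pi : ℝ) * I : ℂ) ≠ x0 := fun h => by
    have := congrArg Complex.im h; simp [Real.pi_ne_zero] at this
  have he1 : cexp (x + (-Real.pi : ℝ) * I) = -cexp x := by
    rw [Complex.exp_add, ofReal_neg, neg_mul, Complex.exp_neg, Complex.exp_pi_mul_I]; norm_num
  have he2 : cexp (x + (Real.pi : ℝ) * I) = -cexp x := by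
    rw [Complex.exp_add, Complex.exp_pi_mul_I]; norm_num
  have hc : resolventSymbol m lam (x + (-Real.pi : ℝ) * I) =
      starRingEnd ℂ (resolventSymbol m lam (x + (Real.pi : ℝ) * I)) := by
    rw [← resolventSymbol_conj]; congr 1; simp
  have hs := Complex.sub_conj (resolventSymbol m lam (x + (Real.pi : ℝ) * I))
  have hd : cexp x + cexp x0 ≠ 0 := by
    rw [← ofReal_exp, ← ofReal_exp, ← ofReal_add, Ne, ofReal_eq_zero]; positivity
  have hd' : -cexp x - cexp x0 ≠ 0 := by rw [← neg_add']; exact neg_ne_zero.2 hd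
  rw [expQuotient_of_ne hne1, expQuotient_of_ne hne2, he1, he2, hc, ← sub_div, boundaryDensity,
    ofReal_div, ofReal_add, ofReal_exp, ofReal_exp, ← mul_div_assoc, div_eq_div_iff hd' hd]
  push_cast at hs ⊢
  linear_combination (-(cexp x + cexp x0)) * hs

lemma tendsto_integral_vertical [IsFiniteMeasure m] (hm : ∀ᵐ α ∂m, α ∈ Ioo (0 : ℝ) 1)
    (hm0 : m ≠ 0) {lam : ℝ} (hl : 0 < lam) (x0 : ℝ) {l : Filter ℝ} [l.IsCountablyGenerated]
    {c : ℂ} (h : Tendsto (expQuotient m lam x0) (comap Complex.re l ⊓ 𝓟 strip) (𝓝 c)) :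
    Tendsto (fun R : ℝ => ∫ y in (-Real.pi)..Real.pi, expQuotient m lam x0 (R + y * I)) l
      (𝓝 (2 * Real.pi * c)) := by
  have hmem : ∀ y ∈ Ioc (-Real.pi) Real.pi, ∀ R : ℝ, (R + y * I : ℂ) ∈ strip := by
    intro y hy R
    simp only [strip, mem_ofPred_eq, add_im, ofReal_im, mul_im, ofReal_re, I_im, I_re, mul_one,
      mul_zero, add_zero, zero_add]
    exact abs_le.2 ⟨hy.1.le, hy.2⟩
  have hle : -Real.pi ≤ Real.pi := by linarith [Real.pi_pos]
  have h2 : (2 * Real.pi * c : ℂ) = ∫ _ in (-Real.pi)..Real.pi, c := by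
    rw [intervalIntegral.integral_const]; push_cast [Complex.real_smul]; ring
  rw [h2]
  have hbd := h.norm.eventually (gt_mem_nhds (lt_add_one ‖c‖))
  rw [eventually_inf_principal, eventually_comap] at hbd
  refine intervalIntegral.tendsto_integral_filter_of_dominated_convergence (fun _ => ‖c‖ + 1)
    ?_ ?_ intervalIntegrable_const ?_
  · refine Eventually.of_forall fun R => ?_
    rw [uIoc_of_le hle]
    refine ContinuousOn.aestronglyMeasurable ?_ measurableSet_Ioc
    exact (differentiableOn_expQuotient hm hm0 hl x0).continuousOn.comp (by fun_prop)
      fun y hy => hmem y hy R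
  · filter_upwards [hbd] with R hR
    refine ae_of_all _ fun y hy => ?_
    rw [uIoc_of_le hle] at hy
    exact (hR (R + y * I) (by simp) (hmem y hy R)).le
  · refine ae_of_all _ fun y hy => ?_
    rw [uIoc_of_le hle] at hy
    refine h.comp (tendsto_inf.2 ⟨tendsto_comap_iff.2 ?_, tendsto_principal.2 ?_⟩)
    · have : (Complex.re ∘ fun R : ℝ => (R + y * I : ℂ)) = id := by ext; simp
      rw [this]; exact tendsto_id
    · exact Eventually.of_forall fun R => hmem y hy R

lemma tendsto_resolventSymbol_left [IsFiniteMeasure m] (hm : ∀ᵐ α ∂m, α ∈ Ioo (0 : ℝ) 1)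
    {lam : ℝ} (hl : 0 < lam) :
    Tendsto (resolventSymbol m lam) (comap Complex.re atBot) (𝓝 0) := by
  have hW : Tendsto (complexMGF id m) (comap Complex.re atBot) (𝓝 0) :=
    squeeze_zero_norm (fun z => norm_complexMGF_le_mgf)
      ((tendsto_mgf_id_atBot hm).comp tendsto_comap)
  have := hW.div (hW.add_const (lam : ℂ)) (by simpa using hl.ne')
  rw [zero_div] at this
  exact this

lemma tendsto_expQuotient_left [IsFiniteMeasure m] (hm : ∀ᵐ α ∂m, α ∈ Ioo (0 : ℝ) 1)
    {lam : ℝ} (hl : 0 < lam) (x0 : ℝ) :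
    Tendsto (expQuotient m lam x0) (comap Complex.re atBot)
      (𝓝 (resolventSymbol m lam x0 / cexp x0)) := by
  have h1 := ((tendsto_resolventSymbol_left hm hl).sub_const (resolventSymbol m lam x0)).div
    (Complex.tendsto_exp_comap_re_atBot.sub_const (cexp x0)) (by simp)
  rw [zero_sub, zero_sub, neg_div_neg_eq] at h1
  refine h1.congr' ?_
  rw [EventuallyEq, eventually_comap]
  filter_upwards [eventually_lt_atBot x0] with R hR z hz
  refine (expQuotient_of_ne fun h => ?_).symm
  rw [h] at hz; simp at hz; linarith

/-- The lower bound on |W+λ| keeps w/(w+λ) bounded, and the denominator e^z - e^(x₀) tends to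
infinity. -/
lemma tendsto_expQuotient_right [IsFiniteMeasure m] (hm : ∀ᵐ α ∂m, α ∈ Ioo (0 : ℝ) 1)
    (hm0 : m ≠ 0) {lam : ℝ} (hl : 0 < lam) (x0 : ℝ) :
    Tendsto (expQuotient m lam x0) (comap Complex.re atTop ⊓ 𝓟 strip) (𝓝 0) := by
  obtain ⟨c, hc, hcb⟩ := exists_norm_complexMGF_add_ge hm hm0 hl
  have h1 : Tendsto (fun z => (cexp z - cexp x0)⁻¹) (comap Complex.re atTop) (𝓝 0) :=
    tendsto_inv₀_cobounded.comp
      ((tendsto_sub_const_cobounded (cexp x0)).comp Complex.tendsto_exp_comap_re_atTop)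
  have h2 : IsBoundedUnder (· ≤ ·) (comap Complex.re atTop ⊓ 𝓟 strip)
      (norm ∘ fun z => resolventSymbol m lam z - resolventSymbol m lam x0) := by
    refine ⟨1 + lam / c + ‖resolventSymbol m lam x0‖, ?_⟩
    rw [eventually_map, eventually_inf_principal, eventually_comap]
    filter_upwards [eventually_ge_atTop 0] with R hR z hz hzs
    subst hz
    refine (norm_sub_le _ _).trans (add_le_add_left ?_ _)
    have hne := complexMGF_add_ne_zero hm hm0 hl hzs
    have : resolventSymbol m lam z = 1 - lam / (complexMGF id m z + lam) := by
      rw [resolventSymbol]; field_simp; ring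
    rw [this]
    refine (norm_sub_le _ _).trans ?_
    rw [norm_one, norm_div, Complex.norm_real, Real.norm_eq_abs, abs_of_pos hl]
    gcongr
    exact hcb z hR hzs
  have h3 := (h1.mono_left (inf_le_left (b := 𝓟 strip))).zero_mul_isBoundedUnder_le h2
  refine h3.congr' ?_
  rw [EventuallyEq, eventually_inf_principal, eventually_comap]
  filter_upwards [eventually_gt_atTop x0] with R hR z hz _
  rw [expQuotient_of_ne, div_eq_inv_mul]
  intro h
  rw [h] at hz; simp at hz; linarith

/-- Cauchy's theorem on the rectangle [-R, R] × [-π, π]; the horizontal edges combine into the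
boundary density and the vertical ones remain. -/
lemma integral_boundaryDensity_interval [IsFiniteMeasure m] (hm : ∀ᵐ α ∂m, α ∈ Ioo (0 : ℝ) 1)
    (hm0 : m ≠ 0) {lam : ℝ} (hl : 0 < lam) (x0 R : ℝ) :
    2 * I * ((∫ x in (-R)..R, boundaryDensity m lam x / (Real.exp x + Real.exp x0) : ℝ) : ℂ) =
      I * (∫ y in (-Real.pi)..Real.pi, expQuotient m lam x0 ((-R : ℝ) + y * I)) -
      I * ∫ y in (-Real.pi)..Real.pi, expQuotient m lam x0 (R + y * I) := by
  have hF := differentiableOn_expQuotient hm hm0 hl x0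
  have hint : ∀ c : ℝ, |c| ≤ Real.pi →
      IntervalIntegrable (fun x : ℝ => expQuotient m lam x0 (x + c * I)) volume (-R) R := by
    intro c hc
    refine (hF.continuousOn.comp_continuous (by fun_prop) fun x => ?_).intervalIntegrable _ _
    simpa [strip] using hc
  have hle : -Real.pi ≤ Real.pi := by linarith [Real.pi_pos]
  have h := Complex.integral_boundary_rect_eq_zero_of_differentiableOn (expQuotient m lam x0)
    ((-R : ℝ) + (-Real.pi : ℝ) * I) (R + Real.pi * I) (hF.mono fun z hz => by
      have := hz.2
      simp only [add_im, ofReal_im, mul_im, ofReal_re, I_im, I_re, mul_one, mul_zero, add_zero,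
        zero_add, mem_preimage, uIcc_of_le hle] at this
      exact abs_le.2 ⟨this.1, this.2⟩)
  simp only [add_im, ofReal_im, mul_im, ofReal_re, I_im, I_re, mul_one, mul_zero, add_zero,
    zero_add, add_re, mul_re, smul_eq_mul, sub_self] at h
  rw [← intervalIntegral.integral_sub (hint _ (by simp [abs_of_pos Real.pi_pos]))
    (hint _ (by simp [abs_of_pos Real.pi_pos]))] at h
  simp_rw [expQuotient_boundary] at h
  rw [intervalIntegral.integral_const_mul, intervalIntegral.integral_ofReal] at h
  linear_combination h

lemma integral_boundaryDensity [IsFiniteMeasure m] (hm : ∀ᵐ α ∂m, α ∈ Ioo (0 : ℝ) 1)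
    (hm0 : m ≠ 0) {lam : ℝ} (hl : 0 < lam) (x0 : ℝ) :
    Integrable (fun x => boundaryDensity m lam x / (Real.exp x + Real.exp x0)) ∧
    ∫ x, boundaryDensity m lam x / (Real.exp x + Real.exp x0) =
      Real.pi * (mgf id m x0 / (mgf id m x0 + lam) / Real.exp x0) := by
  have hcont : Continuous fun x => boundaryDensity m lam x / (Real.exp x + Real.exp x0) :=
    (continuous_boundaryDensity hm hm0 hl).div (by fun_prop) fun x => by positivity
  have hnn : ∀ x, 0 ≤ boundaryDensity m lam x / (Real.exp x + Real.exp x0) := fun x =>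
    div_nonneg (boundaryDensity_nonneg hm hm0 hl x) (by positivity)
  have hlim : Tendsto (fun R : ℝ => ∫ x in (-R)..R, boundaryDensity m lam x /
      (Real.exp x + Real.exp x0)) atTop
      (𝓝 (Real.pi * (mgf id m x0 / (mgf id m x0 + lam) / Real.exp x0))) := by
    -- As R grows the left edge contributes the limit of the quotient at ζ = 0, the right edge
    -- nothing.
    have hL := (tendsto_integral_vertical hm hm0 hl x0
      ((tendsto_expQuotient_left hm hl x0).mono_left inf_le_left)).comp
      tendsto_neg_atTop_atBot
    have hR := tendsto_integral_vertical hm hm0 hl x0 (tendsto_expQuotient_right hm hm0 hl x0)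
    have h := ((hL.const_mul I).sub (hR.const_mul I)).congr fun R =>
      (integral_boundaryDensity_interval hm hm0 hl x0 R).symm
    have h2 := (h.const_mul (-I / 2))
    have h3 := (Complex.continuous_re.tendsto _).comp h2
    have e1 : (Complex.re ∘ fun R : ℝ => -I / 2 * (2 * I * ((∫ x in (-R)..R,
        boundaryDensity m lam x / (Real.exp x + Real.exp x0) : ℝ) : ℂ))) =
        fun R : ℝ => ∫ x in (-R)..R, boundaryDensity m lam x / (Real.exp x + Real.exp x0) := by
      ext R
      rw [Function.comp, show ∀ a : ℂ, -I / 2 * (2 * I * a) = -(I * I) * a by intro a; ring, I_mul_I,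
        neg_neg, one_mul, ofReal_re]
    have e2 : (-I / 2 * (I * (2 * Real.pi * (resolventSymbol m lam x0 / cexp x0)) -
        I * (2 * Real.pi * 0))).re =
        Real.pi * (mgf id m x0 / (mgf id m x0 + lam) / Real.exp x0) := by
      rw [show ∀ a : ℂ, -I / 2 * (I * (2 * Real.pi * a) - I * (2 * Real.pi * 0)) =
        -(I * I) * (Real.pi * a) by intro a; ring, I_mul_I, neg_neg, one_mul, resolventSymbol,
        complexMGF_ofReal, ← ofReal_exp]
      norm_cast
    rw [e1, e2] at h3
    exact h3
  -- The integrand is nonnegative, so convergence over the intervals [-R, R] already gives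
  -- integrability.
  have hI : Integrable (fun x => boundaryDensity m lam x / (Real.exp x + Real.exp x0)) := by
    refine integrable_of_intervalIntegral_norm_tendsto _ (fun R => ?_) tendsto_neg_atTop_atBot
      tendsto_id (hlim.congr fun R => ?_)
    · exact (hcont.integrableOn_Icc (a := -R) (b := R)).mono_set Ioc_subset_Icc_self
    · simp only [Real.norm_eq_abs, abs_of_nonneg (hnn _), id]
  exact ⟨hI, tendsto_nhds_unique
    (intervalIntegral_tendsto_integral hI tendsto_neg_atTop_atBot tendsto_id) hlim⟩

/-- The function `z ↦ w(z) / (z (w(z) + lam))` is the Stieltjes transform of a probability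
measure on the positive half-axis. -/
theorem exists_spectral_measure [IsFiniteMeasure m] (hm : ∀ᵐ α ∂m, α ∈ Ioo (0 : ℝ) 1)
    (hm0 : m ≠ 0) {lam : ℝ} (hl : 0 < lam) :
    ∃ ν : Measure ℝ, IsProbabilityMeasure ν ∧ (∀ᵐ r ∂ν, 0 < r) ∧
      ∀ z, 0 < z → ∫ r, (z + r)⁻¹ ∂ν = symbol m z / (z * (symbol m z + lam)) := by
  have hπ := Real.pi_pos
  -- This is the density of the spectral measure in the variable x = log r.
  set g : ℝ → ℝ := fun x => boundaryDensity m lam x / Real.pi with hg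
  have hgc : Continuous g := (continuous_boundaryDensity hm hm0 hl).div_const _
  have hgn : ∀ x, 0 ≤ g x := fun x => div_nonneg (boundaryDensity_nonneg hm hm0 hl x) hπ.le
  set ν₀ : Measure ℝ := volume.withDensity fun x => ENNReal.ofReal (g x) with hν₀
  have hgm : Measurable fun x => ENNReal.ofReal (g x) := hgc.measurable.ennreal_ofReal
  have hval : ∀ x0, ∫ x, g x * (Real.exp x0 / (Real.exp x + Real.exp x0)) =
      mgf id m x0 / (mgf id m x0 + lam) := by
    intro x0
    have h := (integral_boundaryDensity hm hm0 hl x0).2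
    have : ∀ x, g x * (Real.exp x0 / (Real.exp x + Real.exp x0)) = Real.exp x0 / Real.pi *
        (boundaryDensity m lam x / (Real.exp x + Real.exp x0)) := fun x => by
      simp only [hg]; ring
    simp_rw [this]
    rw [integral_const_mul, h]
    have := Real.exp_pos x0
    field_simp
  -- The total mass is the limit of `hval` along x₀ = n → ∞: the weights e^n/(e^x + e^n) increase to
  -- 1, while w/(w+λ) tends to 1 because w tends to infinity.
  have hmass : ∫⁻ x, ENNReal.ofReal (g x) = 1 := by
    have h1 : Tendsto (fun n : ℕ => ∫⁻ x, ENNReal.ofReal (g x * (Real.exp n /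
        (Real.exp x + Real.exp n)))) atTop (𝓝 (∫⁻ x, ENNReal.ofReal (g x))) := by
      refine lintegral_tendsto_of_tendsto_of_monotone (fun n => ?_) (ae_of_all _ fun x => ?_)
        (ae_of_all _ fun x => ?_)
      · exact (Measurable.ennreal_ofReal (by fun_prop)).aemeasurable
      · intro a b hab
        apply ENNReal.ofReal_le_ofReal
        refine mul_le_mul_of_nonneg_left ?_ (hgn x)
        rw [div_le_div_iff₀ (by positivity) (by positivity)]
        have : Real.exp a ≤ Real.exp b := Real.exp_le_exp.2 (by exact_mod_cast hab)
        nlinarith [Real.exp_pos x]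
      · refine (ENNReal.continuous_ofReal.tendsto _).comp ?_
        have h2 : Tendsto (fun n : ℕ => g x * (1 / (Real.exp x * Real.exp (-(n : ℝ)) + 1))) atTop
            (𝓝 (g x * (1 / (Real.exp x * 0 + 1)))) := by
          refine Tendsto.const_mul _ (Tendsto.div tendsto_const_nhds ?_ (by simp))
          exact ((Real.tendsto_exp_neg_atTop_nhds_zero.comp
            tendsto_natCast_atTop_atTop).const_mul _).add_const _
        simp only [mul_zero, zero_add, div_one, mul_one] at h2
        refine h2.congr fun n => ?_
        rw [Real.exp_neg]
        have := Real.exp_pos n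
        field_simp
    have h2 : Tendsto (fun n : ℕ => ∫⁻ x, ENNReal.ofReal (g x * (Real.exp n /
        (Real.exp x + Real.exp n)))) atTop (𝓝 (ENNReal.ofReal 1)) := by
      have h3 : Tendsto (fun n : ℕ => mgf id m n / (mgf id m n + lam)) atTop (𝓝 1) := by
        have h4 : Tendsto (fun n : ℕ => 1 - lam / (mgf id m n + lam)) atTop (𝓝 (1 - 0)) := by
          refine Tendsto.const_sub _ (Tendsto.const_div_atTop ?_ _)
          exact tendsto_atTop_add_const_right _ _
            ((tendsto_mgf_id_atTop hm hm0).comp tendsto_natCast_atTop_atTop)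
        rw [sub_zero] at h4
        refine h4.congr fun n => ?_
        have := mgf_id_pos hm hm0 n
        field_simp
        ring
      refine ((ENNReal.continuous_ofReal.tendsto _).comp h3).congr fun n => ?_
      rw [Function.comp, ← hval n, ofReal_integral_eq_lintegral_ofReal]
      · refine ((integral_boundaryDensity hm hm0 hl n).1.const_mul
          (Real.exp n / Real.pi)).congr (ae_of_all _ fun x => ?_)
        simp only [hg]; ring
      · exact ae_of_all _ fun x => mul_nonneg (hgn x) (by positivity)
    simpa using tendsto_nhds_unique h1 h2
  have hprob : IsProbabilityMeasure ν₀ := ⟨by rw [hν₀, withDensity_apply _ .univ]; simpa using hmass⟩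
  refine ⟨ν₀.map Real.exp, Measure.isProbabilityMeasure_map (by fun_prop), ?_, fun z hz => ?_⟩
  · rw [ae_map_iff (by fun_prop) measurableSet_Ioi]
    exact ae_of_all _ Real.exp_pos
  · rw [integral_map (by fun_prop) (by fun_prop), hν₀,
      integral_withDensity_eq_integral_toReal_smul hgm (by simp)]
    have h := hval (Real.log z)
    rw [Real.exp_log hz, ← symbol_eq_mgf hz] at h
    have h2 : ∀ x, (ENNReal.ofReal (g x)).toReal • (z + Real.exp x)⁻¹ =
        z⁻¹ * (g x * (z / (Real.exp x + z))) := fun x => by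
      rw [ENNReal.toReal_ofReal (hgn x), smul_eq_mul, add_comm z]
      field_simp
    simp_rw [h2]
    rw [integral_const_mul, h, inv_mul_eq_div, div_div, mul_comm z]

end Spectral

/-! ### The quadrature scheme through generating functions, and the backward Euler error. -/

section Discrete
open ProbabilityTheory Filter Topology

/-- The Taylor coefficients of `f` at `0`. -/
noncomputable def taylorCoeff (f : ℝ → ℝ) (n : ℕ) : ℝ := iteratedDeriv n f 0 / (n.factorial : ℝ)

lemma taylorCoeff_mul {f g : ℝ → ℝ} (hf : AnalyticAt ℝ f 0) (hg : AnalyticAt ℝ g 0) (n : ℕ) :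
    taylorCoeff (fun x => f x * g x) n =
      ∑ i ∈ Finset.range (n + 1), taylorCoeff f i * taylorCoeff g (n - i) := by
  simp only [taylorCoeff]
  rw [show (fun x => f x * g x) = f * g from rfl,
    iteratedDeriv_mul hf.contDiffAt hg.contDiffAt, Finset.sum_div]
  refine Finset.sum_congr rfl fun i hi => ?_
  have hi' : i ≤ n := Nat.lt_succ_iff.1 (Finset.mem_range.1 hi)
  have h := Nat.choose_mul_factorial_mul_factorial hi'
  have h' : (n.choose i : ℝ) * i.factorial * (n - i).factorial = n.factorial := by exact_mod_cast h
  have h1 : (i.factorial : ℝ) ≠ 0 := by positivity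
  have h2 : ((n - i).factorial : ℝ) ≠ 0 := by positivity
  have h3 : (n.factorial : ℝ) ≠ 0 := by positivity
  have h4 : (n.choose i : ℝ) ≠ 0 := by exact_mod_cast (Nat.choose_pos hi').ne'
  rw [← h'] at h3 ⊢
  field_simp

lemma taylorCoeff_of_hasSum {f : ℝ → ℝ} {A : ℕ → ℝ}
    (h : ∀ᶠ ξ in 𝓝 (0 : ℝ), HasSum (fun n => ξ ^ n * A n) (f ξ)) :
    AnalyticAt ℝ f 0 ∧ ∀ n, taylorCoeff f n = A n := by
  have hp : HasFPowerSeriesAt f (FormalMultilinearSeries.ofScalars ℝ A) 0 := by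
    rw [hasFPowerSeriesAt_iff]
    simpa [FormalMultilinearSeries.coeff_ofScalars] using h
  refine ⟨hp.analyticAt, fun n => ?_⟩
  have h1 := hp.analyticAt.hasFPowerSeriesAt.eq_formalMultilinearSeries hp
  have := congrArg (fun p => FormalMultilinearSeries.coeff p n) h1
  simpa [taylorCoeff, FormalMultilinearSeries.coeff_ofScalars] using this

lemma taylorCoeff_congr {f g : ℝ → ℝ} (h : f =ᶠ[𝓝 0] g) (n : ℕ) :
    taylorCoeff f n = taylorCoeff g n := by
  rw [taylorCoeff, taylorCoeff, h.iteratedDeriv_eq]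

lemma taylorCoeff_zero (f : ℝ → ℝ) : taylorCoeff f 0 = f 0 := by simp [taylorCoeff]

variable {m : Measure ℝ}

lemma symbol_pos [IsFiniteMeasure m] (hm : ∀ᵐ α ∂m, α ∈ Ioo (0 : ℝ) 1) (hm0 : m ≠ 0) {z : ℝ}
    (hz : 0 < z) : 0 < symbol m z := by
  rw [symbol_eq_mgf hz]; exact mgf_id_pos hm hm0 _

lemma analyticAt_symbol [IsFiniteMeasure m] (hm : ∀ᵐ α ∂m, α ∈ Ioo (0 : ℝ) 1) {τ : ℝ}
    (hτ : 0 < τ) : AnalyticAt ℝ (fun ξ => symbol m ((1 - ξ) / τ)) 0 := by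
  have h1 : AnalyticAt ℝ (fun ξ : ℝ => (1 - ξ) / τ) 0 := by fun_prop
  have h2 : AnalyticAt ℝ (fun ξ : ℝ => Real.log ((1 - ξ) / τ)) 0 := h1.log (by simpa using hτ)
  have h3 : AnalyticAt ℝ (mgf id m ∘ fun ξ : ℝ => Real.log ((1 - ξ) / τ)) 0 :=
    (analyticAt_mgf (by simp [integrableExpSet_eq_univ hm])).comp h2
  refine h3.congr ?_
  filter_upwards [gt_mem_nhds (zero_lt_one (α := ℝ))] with ξ hξ
  rw [symbol_eq_mgf (div_pos (by linarith) hτ)]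
  rfl

variable {ν : Measure ℝ}

lemma integrable_inv_pow [IsProbabilityMeasure ν] (hν : ∀ᵐ r ∂ν, 0 < r) {τ : ℝ} (hτ : 0 < τ)
    (n : ℕ) : Integrable (fun r => ((1 + τ * r) ^ n)⁻¹) ν := by
  refine Integrable.of_bound (by fun_prop) 1 ?_
  filter_upwards [hν] with r hr
  have : 1 ≤ (1 + τ * r) ^ n := one_le_pow₀ (by nlinarith)
  rw [Real.norm_eq_abs, abs_of_nonneg (by positivity)]
  exact inv_le_one_of_one_le₀ this

/-- A geometric series in ξ/(1+τr), summed under the integral. It makes the Stieltjes transform at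
(1-ξ)/τ the generating function of the backward Euler averages. -/
lemma hasSum_stieltjes [IsProbabilityMeasure ν] (hν : ∀ᵐ r ∂ν, 0 < r) {τ : ℝ} (hτ : 0 < τ) {ξ : ℝ}
    (hξ : |ξ| < 1) :
    HasSum (fun n => ξ ^ n * ∫ r, ((1 + τ * r) ^ (n + 1))⁻¹ ∂ν)
      (τ⁻¹ * ∫ r, ((1 - ξ) / τ + r)⁻¹ ∂ν) := by
  have hsum : Summable fun n : ℕ => ∫ r, ‖ξ ^ n * ((1 + τ * r) ^ (n + 1))⁻¹‖ ∂ν := by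
    refine Summable.of_nonneg_of_le (fun n => integral_nonneg fun r => norm_nonneg _) (fun n => ?_)
      (summable_geometric_of_abs_lt_one (r := |ξ|) (by rwa [abs_abs]))
    calc ∫ r, ‖ξ ^ n * ((1 + τ * r) ^ (n + 1))⁻¹‖ ∂ν ≤ ∫ _, |ξ| ^ n ∂ν := by
          refine integral_mono_ae ((integrable_inv_pow hν hτ (n + 1)).const_mul _).norm
            (integrable_const _) ?_
          filter_upwards [hν] with r hr
          have : 1 ≤ (1 + τ * r) ^ (n + 1) := one_le_pow₀ (by nlinarith [mul_pos hτ hr])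
          rw [norm_mul, norm_pow, Real.norm_eq_abs, Real.norm_eq_abs,
            abs_of_nonneg (a := ((1 + τ * r) ^ (n + 1))⁻¹) (by positivity)]
          exact mul_le_of_le_one_right (by positivity) (inv_le_one_of_one_le₀ this)
      _ = |ξ| ^ n := by simp
  have h := hasSum_integral_of_summable_integral_norm (μ := ν)
    (F := fun (n : ℕ) (r : ℝ) => ξ ^ n * ((1 + τ * r) ^ (n + 1))⁻¹)
    (fun n => (integrable_inv_pow hν hτ (n + 1)).const_mul _) hsum
  simp only [integral_const_mul] at h
  rw [← integral_const_mul]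
  refine (congrArg (HasSum _) (integral_congr_ae ?_)).mpr h
  filter_upwards [hν] with r hr
  have h1 : 0 < 1 + τ * r := by positivity
  have h2 : |ξ / (1 + τ * r)| < 1 := by
    rw [abs_div, abs_of_pos h1, div_lt_one h1]; nlinarith
  have h3 : ∀ n, ξ ^ n * ((1 + τ * r) ^ (n + 1))⁻¹ =
      (ξ / (1 + τ * r)) ^ n * (1 + τ * r)⁻¹ := fun n => by
    rw [div_pow, pow_succ]; field_simp
  simp_rw [h3]
  rw [tsum_mul_right, tsum_geometric_of_abs_lt_one h2]
  have h4 : 0 < 1 - ξ + τ * r := by have := (abs_lt.1 hξ).2; nlinarith [mul_pos hτ hr]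
  have h5 : (1 - ξ / (1 + τ * r)) * (1 + τ * r) = 1 - ξ + τ * r := by field_simp; ring
  rw [← mul_inv, ← mul_inv, h5]
  congr 1
  field_simp

/-- With a and b the generating functions of the averages and of the weights, `hS` at z = (1-ξ)/τ
reads a (b + λ) = b / (1-ξ); the identity compares coefficients of ξ^n. -/
lemma convolution_quadrature_identity [IsFiniteMeasure m] (hm : ∀ᵐ α ∂m, α ∈ Ioo (0 : ℝ) 1)
    (hm0 : m ≠ 0) {lam : ℝ} (hl : 0 < lam) [IsProbabilityMeasure ν] (hν : ∀ᵐ r ∂ν, 0 < r)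
    (hS : ∀ z, 0 < z → ∫ r, (z + r)⁻¹ ∂ν = symbol m z / (z * (symbol m z + lam)))
    {τ : ℝ} (hτ : 0 < τ) (n : ℕ) :
    ∑ i ∈ Finset.range (n + 1), taylorCoeff (fun ξ => symbol m ((1 - ξ) / τ)) (n - i) *
        ∫ r, ((1 + τ * r) ^ (i + 1))⁻¹ ∂ν + lam * ∫ r, ((1 + τ * r) ^ (n + 1))⁻¹ ∂ν =
      ∑ i ∈ Finset.range (n + 1), taylorCoeff (fun ξ => symbol m ((1 - ξ) / τ)) i := by
  set b : ℝ → ℝ := fun ξ => symbol m ((1 - ξ) / τ) with hb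
  set a : ℝ → ℝ := fun ξ => τ⁻¹ * ∫ r, ((1 - ξ) / τ + r)⁻¹ ∂ν with ha
  have hba : AnalyticAt ℝ b 0 := analyticAt_symbol hm hτ
  have hev : ∀ᶠ ξ : ℝ in 𝓝 0, |ξ| < 1 := by
    have : Continuous fun ξ : ℝ => |ξ| := by fun_prop
    exact this.continuousAt.eventually (gt_mem_nhds (by simp))
  obtain ⟨haa, hac⟩ := taylorCoeff_of_hasSum (f := a)
    (A := fun n => ∫ r, ((1 + τ * r) ^ (n + 1))⁻¹ ∂ν) (hev.mono fun ξ hξ => hasSum_stieltjes hν hτ hξ)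
  obtain ⟨hga, hgc⟩ := taylorCoeff_of_hasSum (f := fun ξ : ℝ => (1 - ξ)⁻¹) (A := fun _ => 1)
    (hev.mono fun ξ hξ => by simpa using hasSum_geometric_of_abs_lt_one hξ)
  obtain ⟨hka, hkc⟩ := taylorCoeff_of_hasSum (f := fun _ : ℝ => lam)
    (A := fun n => if n = 0 then lam else 0) (Eventually.of_forall fun ξ => by
      convert hasSum_ite_eq 0 lam using 2 with n
      split_ifs with h <;> simp [h])
  have hEq : (fun ξ => a ξ * (b ξ + lam)) =ᶠ[𝓝 0] fun ξ => b ξ * (1 - ξ)⁻¹ := by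
    filter_upwards [hev] with ξ hξ
    have h1 : 0 < 1 - ξ := by have := (abs_lt.1 hξ).2; linarith
    have h2 : 0 < symbol m ((1 - ξ) / τ) := symbol_pos hm hm0 (div_pos h1 hτ)
    simp only [ha, hb, hS _ (div_pos h1 hτ)]
    field_simp
  have h1 := taylorCoeff_congr hEq n
  have h2 : (fun ξ => a ξ * (b ξ + lam)) = (fun ξ => a ξ * b ξ) + fun ξ => lam * a ξ := by
    ext ξ; simp only [Pi.add_apply]; ring
  have h3 : taylorCoeff (fun ξ => a ξ * (b ξ + lam)) n =
      taylorCoeff (fun ξ => a ξ * b ξ) n + taylorCoeff (fun ξ => lam * a ξ) n := by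
    rw [h2, taylorCoeff]
    erw [iteratedDeriv_add (haa.mul hba).contDiffAt (hka.mul haa).contDiffAt]
    rw [add_div]
    rfl
  rw [h3, taylorCoeff_mul haa hba, taylorCoeff_mul hka haa, taylorCoeff_mul hba hga] at h1
  simp only [hac, hgc, hkc, mul_one] at h1
  rw [← h1]
  congr 1
  · exact Finset.sum_congr rfl fun i _ => mul_comm _ _
  · rw [Finset.sum_eq_single 0 (by intro i _ hi; simp [hi]) (by simp)]
    simp

/-- The scalar convolution quadrature scheme is solved by the average of the backward Euler
approximations of `exp (-r t)` against the spectral measure. -/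
lemma discrete_solution_eq [IsFiniteMeasure m] (hm : ∀ᵐ α ∂m, α ∈ Ioo (0 : ℝ) 1)
    (hm0 : m ≠ 0) {lam : ℝ} (hl : 0 < lam) [IsProbabilityMeasure ν] (hν : ∀ᵐ r ∂ν, 0 < r)
    (hS : ∀ z, 0 < z → ∫ r, (z + r)⁻¹ ∂ν = symbol m z / (z * (symbol m z + lam)))
    {τ : ℝ} (hτ : 0 < τ) {v : ℝ} {N : ℕ} {U : ℕ → ℝ}
    (hU : ∀ n, 1 ≤ n → n ≤ N →
      ∑ j ∈ Finset.Icc 1 n, taylorCoeff (fun ξ => symbol m ((1 - ξ) / τ)) (n - j) * U j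
        + lam * U n =
      (∑ j ∈ Finset.Icc 1 n, taylorCoeff (fun ξ => symbol m ((1 - ξ) / τ)) (n - j)) * v)
    {n : ℕ} (hn : 1 ≤ n) (hnN : n ≤ N) : U n = v * ∫ r, ((1 + τ * r) ^ n)⁻¹ ∂ν := by
  induction n using Nat.strong_induction_on with
  | _ n ih =>
    set b := taylorCoeff (fun ξ => symbol m ((1 - ξ) / τ)) with hb
    obtain ⟨k, rfl⟩ : ∃ k, n = k + 1 := ⟨n - 1, by omega⟩
    -- The scheme sums from j = 1, so U^(i+1) corresponds to the coefficient of ξ^i.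
    have hIcc : ∀ g : ℕ → ℝ, ∑ j ∈ Finset.Icc 1 (k + 1), g j =
        ∑ i ∈ Finset.range (k + 1), g (i + 1) := fun g => by
      rw [Finset.range_eq_Ico, Finset.sum_Ico_add' g 0 (k + 1) 1]
      rfl
    have h1 := hU (k + 1) hn hnN
    have h2 := convolution_quadrature_identity hm hm0 hl hν hS hτ k
    rw [← Finset.sum_range_reflect (fun i => taylorCoeff _ i)] at h2
    rw [hIcc, hIcc, Finset.sum_range_succ] at h1
    rw [Finset.sum_range_succ] at h2
    simp only [Nat.add_sub_add_right, add_tsub_cancel_right, Nat.sub_self, ← hb] at h1 h2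
    have h3 : ∑ i ∈ Finset.range k, b (k - i) * U (i + 1) =
        v * ∑ i ∈ Finset.range k, b (k - i) * ∫ r, ((1 + τ * r) ^ (i + 1))⁻¹ ∂ν := by
      rw [Finset.mul_sum]
      refine Finset.sum_congr rfl fun i hi => ?_
      have := Finset.mem_range.1 hi
      rw [ih (i + 1) (by omega) (by omega) (by omega)]
      ring
    -- The coefficient of the newest value is b₀ + λ > 0, so each step of the scheme determines it
    -- from the earlier ones.
    have hb0 : 0 < b 0 := by
      rw [hb, taylorCoeff_zero]
      exact symbol_pos hm hm0 (by simpa using hτ)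
    have hne : b 0 + lam ≠ 0 := by positivity
    rw [h3] at h1
    apply mul_left_cancel₀ hne
    linear_combination h1 - v * h2

/-- With a = 1/(1+y) and b = e^(-y), the local error satisfies 0 ≤ a - b ≤ 2(ya)², and a^n - b^n ≤ n
(a - b) a^(n-1). What remains is n y (1+ny) ≤ 4 (1+y)^(n+1). The shape y/(1+ny) is chosen because
for y = τr it is a combination of constants and (1/t_n + r)⁻¹, which ν integrates exactly. -/
lemma abs_backwardEuler_sub_exp_le {y : ℝ} (hy : 0 ≤ y) {n : ℕ} (hn : 1 ≤ n) :
    |Real.exp (-(n * y)) - ((1 + y) ^ n)⁻¹| ≤ 8 * (y / (1 + n * y)) := by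
  obtain ⟨k, rfl⟩ : ∃ k, n = k + 1 := ⟨n - 1, by omega⟩
  have h1y : 0 < 1 + y := by linarith
  set a := (1 + y)⁻¹ with ha
  set b := Real.exp (-y) with hb
  have ha0 : 0 < a := inv_pos.2 h1y
  have hb0 : 0 < b := Real.exp_pos _
  have hba : b ≤ a := by
    rw [ha, hb, Real.exp_neg]
    exact inv_anti₀ h1y (by linarith [Real.add_one_le_exp y])
  have hab : a - b ≤ 2 * (y * a) ^ 2 := by
    have e : a * (1 + y) = 1 := inv_mul_cancel₀ h1y.ne'
    -- For y ≤ 1, b ≥ 1 - y and a - (1 - y) = y² a with a ≥ 1/2. For y > 1 already a ≤ 2(ya)².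
    by_cases h : y ≤ 1
    · have h2 : 1 - y ≤ b := by have := Real.add_one_le_exp (-y); linarith
      have h3 : a - (1 - y) = y ^ 2 * a := by linear_combination (1 - y) * e
      have h4 : 1 ≤ 2 * a := by nlinarith
      nlinarith [mul_nonneg (mul_nonneg (sq_nonneg y) ha0.le) (sub_nonneg.2 h4)]
    · push Not at h
      have h4 : a ≤ 2 * (y * a) ^ 2 := by
        have : 1 ≤ 2 * (y * y) * a := by
          have : 1 + y ≤ 2 * (y * y) := by nlinarith
          calc 1 = a * (1 + y) := e.symm
            _ ≤ a * (2 * (y * y)) := by gcongr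
            _ = _ := by ring
        nlinarith
      linarith
  have e1 : Real.exp (-(((k + 1 : ℕ) : ℝ) * y)) = b ^ (k + 1) := by
    rw [hb, ← Real.exp_nat_mul]; congr 1; ring
  have e2 : ((1 + y) ^ (k + 1))⁻¹ = a ^ (k + 1) := by rw [ha, inv_pow]
  rw [e1, e2, abs_sub_comm, abs_of_nonneg (sub_nonneg.2 (pow_le_pow_left₀ hb0.le hba _))]
  have h5 : a ^ (k + 1) - b ^ (k + 1) ≤ (a - b) * ((k + 1) * a ^ k) := by
    rw [← (Commute.all a b).mul_geom_sum₂ (k + 1)]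
    refine mul_le_mul_of_nonneg_left ?_ (sub_nonneg.2 hba)
    calc ∑ i ∈ Finset.range (k + 1), a ^ i * b ^ (k + 1 - 1 - i)
        ≤ ∑ _i ∈ Finset.range (k + 1), a ^ k := by
          refine Finset.sum_le_sum fun i hi => ?_
          have hi' : i ≤ k := Nat.lt_succ_iff.1 (Finset.mem_range.1 hi)
          calc a ^ i * b ^ (k + 1 - 1 - i) ≤ a ^ i * a ^ (k + 1 - 1 - i) := by gcongr
            _ = a ^ k := by rw [← pow_add]; congr 1; omega
      _ = (k + 1) * a ^ k := by simp
  -- Bernoulli's inequality with the real exponent (k+2)/2 ≥ 1, then squared, bounds a quadratic by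
  -- the power k+2.
  have h6 : (1 + (k + 1) * y) ^ 2 ≤ 4 * (1 + y) ^ (k + 2) := by
    have hB := one_add_mul_self_le_rpow_one_add (s := y) (by linarith) (p := ((k + 2 : ℕ) : ℝ) / 2)
      (by rw [le_div_iff₀ two_pos]; push_cast; linarith [Nat.cast_nonneg (α := ℝ) k])
    have hB2 : ((1 + y) ^ (((k + 2 : ℕ) : ℝ) / 2)) ^ 2 = (1 + y) ^ (k + 2) := by
      rw [← Real.rpow_natCast, ← Real.rpow_mul h1y.le, ← Real.rpow_natCast]
      congr 1; push_cast; ring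
    have hk : (0 : ℝ) ≤ k := Nat.cast_nonneg k
    have h7 : 1 + (k + 1) * y ≤ 2 * (1 + y) ^ (((k + 2 : ℕ) : ℝ) / 2) := by
      push_cast at hB ⊢
      nlinarith [mul_nonneg hk hy]
    calc (1 + (k + 1) * y) ^ 2 ≤ (2 * (1 + y) ^ (((k + 2 : ℕ) : ℝ) / 2)) ^ 2 :=
          pow_le_pow_left₀ (by positivity) h7 2
      _ = 4 * (1 + y) ^ (k + 2) := by rw [mul_pow, hB2]; norm_num
  have hpos : 0 < 1 + ((k + 1 : ℕ) : ℝ) * y := by positivity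
  have h8 : (k + 1) * y * (1 + (k + 1) * y) * a ^ (k + 2) ≤ 4 := by
    have : a ^ (k + 2) = ((1 + y) ^ (k + 2))⁻¹ := by rw [ha, inv_pow]
    rw [this, ← div_eq_mul_inv, div_le_iff₀ (by positivity)]
    have : 0 ≤ ((k : ℝ) + 1) * y := by positivity
    nlinarith
  rw [← mul_div_assoc, le_div_iff₀ hpos]
  push_cast
  have h9 : a ^ (k + 1) - b ^ (k + 1) ≤ 2 * (y * a) ^ 2 * ((k + 1) * a ^ k) :=
    h5.trans (mul_le_mul_of_nonneg_right hab (by positivity))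
  push_cast at hpos
  calc (a ^ (k + 1) - b ^ (k + 1)) * (1 + (k + 1) * y)
      ≤ 2 * (y * a) ^ 2 * ((k + 1) * a ^ k) * (1 + (k + 1) * y) := by gcongr
    _ = 2 * y * ((k + 1) * y * (1 + (k + 1) * y) * a ^ (k + 2)) := by ring
    _ ≤ 2 * y * 4 := by gcongr
    _ = 8 * y := by ring

/-- The error of the backward Euler convolution quadrature for a scalar problem, in the spectral
representation. -/
lemma abs_integral_error_le [IsFiniteMeasure m] (hm : ∀ᵐ α ∂m, α ∈ Ioo (0 : ℝ) 1)
    (hm0 : m ≠ 0) {lam : ℝ} (hl : 0 < lam) [IsProbabilityMeasure ν] (hν : ∀ᵐ r ∂ν, 0 < r)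
    (hS : ∀ z, 0 < z → ∫ r, (z + r)⁻¹ ∂ν = symbol m z / (z * (symbol m z + lam)))
    {τ : ℝ} (hτ : 0 < τ) {n : ℕ} (hn : 1 ≤ n) :
    |∫ r, Real.exp (-(r * (n * τ))) ∂ν - ∫ r, ((1 + τ * r) ^ n)⁻¹ ∂ν| ≤
      8 * τ * lam * ((n * τ)⁻¹ / symbol m (n * τ)⁻¹) := by
  have hn0 : (0 : ℝ) < n := by exact_mod_cast hn
  set z : ℝ := (n * τ)⁻¹ with hz
  have hz0 : 0 < z := by positivity
  have hinv : Integrable (fun r => (z + r)⁻¹) ν := by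
    refine Integrable.of_bound (by fun_prop) z⁻¹ ?_
    filter_upwards [hν] with r hr
    rw [Real.norm_eq_abs, abs_of_nonneg (by positivity)]
    exact inv_anti₀ hz0 (by linarith)
  have hexp : Integrable (fun r => Real.exp (-(r * (n * τ)))) ν := by
    refine Integrable.of_bound (by fun_prop) 1 ?_
    filter_upwards [hν] with r hr
    rw [Real.norm_eq_abs, Real.abs_exp, Real.exp_le_one_iff, neg_nonpos]
    positivity
  rw [← integral_sub hexp (integrable_inv_pow hν hτ n)]
  have hw := symbol_pos hm hm0 hz0
  calc |∫ r, (Real.exp (-(r * (n * τ))) - ((1 + τ * r) ^ n)⁻¹) ∂ν|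
      ≤ ∫ r, 8 * τ * z * (1 - z * (z + r)⁻¹) ∂ν := by
        rw [← Real.norm_eq_abs]
        refine norm_integral_le_of_norm_le
          (((integrable_const 1).sub (hinv.const_mul z)).const_mul (8 * τ * z)) ?_
        filter_upwards [hν] with r hr
        have h := abs_backwardEuler_sub_exp_le (y := τ * r) (by positivity) hn
        rw [Real.norm_eq_abs, show r * (n * τ) = n * (τ * r) by ring]
        refine h.trans (le_of_eq ?_)
        rw [hz]
        field_simp
        ring
    -- The Stieltjes identity evaluates the bound; the bracket equals λ/(w+λ), which supplies the
    -- factor λ that later becomes A.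
    _ = 8 * τ * z * (1 - z * (symbol m z / (z * (symbol m z + lam)))) := by
        rw [integral_const_mul, integral_sub (integrable_const 1) (hinv.const_mul z),
          integral_const_mul, hS z hz0]
        simp
    _ = 8 * τ * lam * (z / (symbol m z + lam)) := by field_simp; ring
    _ ≤ 8 * τ * lam * (z / symbol m z) := by gcongr; linarith

end Discrete

/-! ### Laplace transforms of the Caputo kernel and of the spectral measure. -/

section Laplace
open ProbabilityTheory Filter Topology

/-- Both complex transforms are analytic for Re z < 1 and agree at the points -1/(n+1), which
accumulate at 0; hence they agree on the imaginary axis, where they are characteristic functions. -/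
lemma measure_ext_of_mgf_eqOn_Iio {μ₁ μ₂ : Measure ℝ} [IsFiniteMeasure μ₁] [IsFiniteMeasure μ₂]
    (h₁ : Iio 1 ⊆ integrableExpSet id μ₁) (h₂ : Iio 1 ⊆ integrableExpSet id μ₂)
    (h : ∀ s, s < 1 → mgf id μ₁ s = mgf id μ₂ s) : μ₁ = μ₂ := by
  have hA : ∀ {μ' : Measure ℝ}, Iio 1 ⊆ integrableExpSet id μ' →
      AnalyticOnNhd ℂ (complexMGF id μ') {z | z.re < 1} := fun hμ' z hz =>
    analyticAt_complexMGF (mem_interior.2 ⟨Iio 1, hμ', isOpen_Iio, hz⟩)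
  have hE : EqOn (complexMGF id μ₁) (complexMGF id μ₂) {z | z.re < 1} := by
    refine AnalyticOnNhd.eqOn_of_preconnected_of_frequently_eq (hA h₁) (hA h₂)
      (convex_halfSpace_re_lt 1).isPreconnected (z₀ := 0) (by simp) ?_
    have h3 : Tendsto (fun n : ℕ => ((-(1 / ((n : ℝ) + 1)) : ℝ) : ℂ)) atTop (𝓝[≠] 0) := by
      refine tendsto_nhdsWithin_iff.2 ⟨?_, Eventually.of_forall fun n => ?_⟩
      · have := (tendsto_one_div_add_atTop_nhds_zero_nat (𝕜 := ℝ)).neg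
        rw [neg_zero] at this
        exact_mod_cast (Complex.continuous_ofReal.tendsto 0).comp this
      · simp only [mem_compl_iff, mem_singleton_iff, Complex.ofReal_eq_zero]
        exact (neg_lt_zero.2 (by positivity)).ne
    refine h3.frequently (Frequently.of_forall fun n => ?_)
    rw [complexMGF_ofReal, complexMGF_ofReal, h]
    have : (0 : ℝ) < 1 / (n + 1) := by positivity
    linarith
  refine Measure.ext_of_charFun (funext fun t => ?_)
  rw [← complexMGF_id_mul_I, ← complexMGF_id_mul_I]
  exact hE (by simp)

/-- Uniqueness for the Laplace transform of densities. -/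
lemma ae_eq_of_laplace_eq {f g : ℝ → ℝ≥0∞} (hf : Measurable f) (hg : Measurable g)
    (hfin : ∀ z : ℝ, 0 < z → ∫⁻ x, ENNReal.ofReal (Real.exp (-(z * x))) * f x ≠ ⊤)
    (h : ∀ z : ℝ, 0 < z → ∫⁻ x, ENNReal.ofReal (Real.exp (-(z * x))) * f x =
      ∫⁻ x, ENNReal.ofReal (Real.exp (-(z * x))) * g x) : f =ᵐ[volume] g := by
  -- The weight e^(-x) turns f and g into densities of finite measures and shifts the range z > 0 to
  -- s = 1 - z < 1.
  set E : ℝ → ℝ≥0∞ := fun x => ENNReal.ofReal (Real.exp (-x)) with hE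
  have hEm : Measurable E := by fun_prop
  have hL : ∀ k : ℝ → ℝ≥0∞, Measurable k → ∀ s : ℝ,
      ∫⁻ x, ENNReal.ofReal (Real.exp (s * x)) ∂(volume.withDensity fun x => E x * k x) =
      ∫⁻ x, ENNReal.ofReal (Real.exp (-((1 - s) * x))) * k x := by
    intro k hk s
    rw [lintegral_withDensity_eq_lintegral_mul _ (f := fun x => E x * k x) (hEm.mul hk)
      (g := fun x => ENNReal.ofReal (Real.exp (s * x))) (by fun_prop)]
    refine lintegral_congr fun x => ?_
    simp only [Pi.mul_apply, hE]
    rw [mul_right_comm, ← ENNReal.ofReal_mul (Real.exp_pos _).le, ← Real.exp_add]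
    congr 3; ring
  have hmain : ∀ k : ℝ → ℝ≥0∞, Measurable k →
      (∀ z : ℝ, 0 < z → ∫⁻ x, ENNReal.ofReal (Real.exp (-(z * x))) * k x ≠ ⊤) →
      IsFiniteMeasure (volume.withDensity fun x => E x * k x) ∧
      Iio 1 ⊆ integrableExpSet id (volume.withDensity fun x => E x * k x) := by
    intro k hk hkf
    constructor
    · refine ⟨?_⟩
      have := hL k hk 0
      simp only [zero_mul, Real.exp_zero, ENNReal.ofReal_one, lintegral_one] at this
      rw [this]
      exact (hkf _ (by norm_num)).lt_top
    · intro s hs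
      refine ⟨by fun_prop, ?_⟩
      rw [hasFiniteIntegral_iff_ofReal (ae_of_all _ fun _ => (Real.exp_pos _).le)]
      simp only [id]
      rw [hL k hk s]
      exact (hkf _ (by simpa using hs)).lt_top
  obtain ⟨i1, j1⟩ := hmain f hf hfin
  obtain ⟨i2, j2⟩ := hmain g hg fun z hz => by rw [← h z hz]; exact hfin z hz
  have heq := measure_ext_of_mgf_eqOn_Iio j1 j2 fun s hs => by
    simp only [mgf, id]
    rw [integral_eq_lintegral_of_nonneg_ae (ae_of_all _ fun _ => (Real.exp_pos _).le) (by fun_prop),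
      integral_eq_lintegral_of_nonneg_ae (ae_of_all _ fun _ => (Real.exp_pos _).le) (by fun_prop),
      hL f hf, hL g hg, h _ (by linarith)]
  have h3 : (fun x => E x * f x) =ᵐ[volume] fun x => E x * g x := by
    refine (withDensity_eq_iff_of_sigmaFinite (hEm.mul hf).aemeasurable
      (hEm.mul hg).aemeasurable).1 heq
  filter_upwards [h3] with x hx
  have hEx : E x ≠ 0 := by simp [hE, Real.exp_pos]
  exact (ENNReal.mul_right_inj hEx ENNReal.ofReal_ne_top).1 hx

/-- The Laplace transform of a convolution. -/
lemma laplace_convolution {f g : ℝ → ℝ≥0∞} (hf : Measurable f) (hg : Measurable g) (z : ℝ) :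
    ∫⁻ x, ENNReal.ofReal (Real.exp (-(z * x))) * ∫⁻ y, f y * g (x - y) =
      (∫⁻ x, ENNReal.ofReal (Real.exp (-(z * x))) * f x) *
        ∫⁻ x, ENNReal.ofReal (Real.exp (-(z * x))) * g x := by
  calc ∫⁻ x, ENNReal.ofReal (Real.exp (-(z * x))) * ∫⁻ y, f y * g (x - y)
      = ∫⁻ x, ∫⁻ y, ENNReal.ofReal (Real.exp (-(z * x))) * (f y * g (x - y)) := by
        refine lintegral_congr fun x => (lintegral_const_mul _ (by fun_prop)).symm
    _ = ∫⁻ y, ∫⁻ x, ENNReal.ofReal (Real.exp (-(z * x))) * (f y * g (x - y)) :=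
        lintegral_lintegral_swap (by fun_prop)
    _ = ∫⁻ y, ENNReal.ofReal (Real.exp (-(z * y))) * f y *
          ∫⁻ x, ENNReal.ofReal (Real.exp (-(z * x))) * g x := by
        refine lintegral_congr fun y => ?_
        rw [← lintegral_const_mul _ (by fun_prop),
          ← lintegral_sub_right_eq_self (fun x => _ * (ENNReal.ofReal (Real.exp (-(z * x))) * g x)) y]
        refine lintegral_congr fun x => ?_
        rw [show ∀ a b c d : ℝ≥0∞, a * b * (c * d) = a * c * (b * d) by intros; ring,
          ← ENNReal.ofReal_mul (Real.exp_pos _).le, ← Real.exp_add]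
        congr 3; ring
    _ = _ := lintegral_mul_const _ (by fun_prop)

lemma lintegral_exp_neg_mul_Ioi {a : ℝ} (ha : 0 < a) :
    ∫⁻ t in Ioi 0, ENNReal.ofReal (Real.exp (-(a * t))) = ENNReal.ofReal a⁻¹ := by
  rw [← ofReal_integral_eq_lintegral_ofReal]
  · have := integral_exp_neg_mul_rpow zero_lt_one ha
    simp only [Real.rpow_one, div_one, neg_mul] at this
    rw [this, Real.rpow_neg_one, one_add_one_eq_two, Real.Gamma_two, mul_one]
  · have := integrableOn_exp_mul_Ioi (a := -a) (by linarith) 0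
    simpa [IntegrableOn] using this
  · exact ae_of_all _ fun _ => (Real.exp_pos _).le

/-- The reciprocal Gamma function is entire, hence continuous. -/
lemma measurable_one_div_Gamma_one_sub : Measurable fun α : ℝ => 1 / Real.Gamma (1 - α) := by
  have h : Continuous fun α : ℝ => ((Complex.Gamma ((1 - α : ℝ) : ℂ))⁻¹).re :=
    Complex.continuous_re.comp
      (Complex.differentiable_one_div_Gamma.continuous.comp (by fun_prop))
  have h2 : (fun α : ℝ => 1 / Real.Gamma (1 - α)) =
      fun α : ℝ => ((Complex.Gamma ((1 - α : ℝ) : ℂ))⁻¹).re := by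
    ext α
    rw [Complex.Gamma_ofReal, ← Complex.ofReal_inv, Complex.ofReal_re, one_div]
  rw [h2]
  exact h.measurable

variable {m ν : Measure ℝ}

/-- The kernel `∫ t^(-α) / Γ(1-α) dm(α)` of the distributed order derivative. -/
noncomputable def caputoKernel (m : Measure ℝ) (t : ℝ) : ℝ≥0∞ :=
  ∫⁻ α, ENNReal.ofReal (1 / Real.Gamma (1 - α) * t ^ (-α)) ∂m

/-- Minus the derivative of the Laplace transform of `ν`. -/
noncomputable def expKernel (ν : Measure ℝ) (t : ℝ) : ℝ≥0∞ :=
  ∫⁻ r, ENNReal.ofReal (r * Real.exp (-(r * t))) ∂ν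

lemma measurable_caputoKernel_integrand :
    Measurable fun p : ℝ × ℝ => ENNReal.ofReal (1 / Real.Gamma (1 - p.2) * p.1 ^ (-p.2)) :=
  ((measurable_one_div_Gamma_one_sub.comp measurable_snd).mul
    (measurable_fst.pow measurable_snd.neg)).ennreal_ofReal

lemma measurable_caputoKernel [SFinite m] : Measurable (caputoKernel m) :=
  measurable_caputoKernel_integrand.lintegral_prod_right'

lemma measurable_expKernel [SFinite ν] : Measurable (expKernel ν) := by
  have : Measurable fun p : ℝ × ℝ => ENNReal.ofReal (p.2 * Real.exp (-(p.2 * p.1))) := by fun_prop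
  exact this.lintegral_prod_right'

lemma lintegral_rpow_mul_exp_neg {z α : ℝ} (hz : 0 < z) (hα : α ∈ Ioo (0 : ℝ) 1) :
    ∫⁻ t in Ioi 0, ENNReal.ofReal (Real.exp (-(z * t))) *
      ENNReal.ofReal (1 / Real.Gamma (1 - α) * t ^ (-α)) = ENNReal.ofReal (z ^ α / z) := by
  have h1 : 0 < 1 - α := by linarith [hα.2]
  have hG := Real.Gamma_pos_of_pos h1
  have h := Real.integral_rpow_mul_exp_neg_mul_Ioi h1 hz
  have e : ∀ t : ℝ, ENNReal.ofReal (Real.exp (-(z * t))) *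
      ENNReal.ofReal (1 / Real.Gamma (1 - α) * t ^ (-α)) =
      ENNReal.ofReal (1 / Real.Gamma (1 - α) * (t ^ (1 - α - 1) * Real.exp (-(z * t)))) := by
    intro t
    rw [← ENNReal.ofReal_mul (Real.exp_pos _).le, show 1 - α - 1 = -α by ring]
    congr 1; ring
  simp_rw [e]
  -- Integrability is read off from the value: the integral of a nonintegrable function is 0 by
  -- convention, but this one is positive.
  have hI : IntegrableOn (fun t : ℝ => t ^ (1 - α - 1) * Real.exp (-(z * t))) (Ioi 0) := by
    by_contra hc
    rw [integral_undef hc] at h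
    have : 0 < (1 / z) ^ (1 - α) * Real.Gamma (1 - α) := by positivity
    linarith
  rw [← ofReal_integral_eq_lintegral_ofReal (hI.const_mul _)]
  · rw [integral_const_mul, h]
    congr 1
    rw [one_div z, Real.inv_rpow hz.le, Real.rpow_sub hz, Real.rpow_one]
    have := Real.rpow_pos_of_pos hz α
    field_simp
  · filter_upwards [self_mem_ae_restrict measurableSet_Ioi] with t ht
    have : 0 < t := ht
    positivity

lemma integrable_rpow [IsFiniteMeasure m] (hm : ∀ᵐ α ∂m, α ∈ Ioo (0 : ℝ) 1) {z : ℝ} (hz : 0 < z) :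
    Integrable (fun α => z ^ α) m := by
  refine (integrable_exp_mul_of_Ioo hm (Real.log z)).congr (ae_of_all _ fun α => ?_)
  simp only [Real.rpow_def_of_pos hz]

lemma laplace_caputoKernel [IsFiniteMeasure m] (hm : ∀ᵐ α ∂m, α ∈ Ioo (0 : ℝ) 1) {z : ℝ}
    (hz : 0 < z) :
    ∫⁻ t in Ioi 0, ENNReal.ofReal (Real.exp (-(z * t))) * caputoKernel m t =
      ENNReal.ofReal (symbol m z / z) := by
  have hM := measurable_caputoKernel_integrand
  calc ∫⁻ t in Ioi 0, ENNReal.ofReal (Real.exp (-(z * t))) * caputoKernel m t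
      = ∫⁻ t in Ioi 0, ∫⁻ α, ENNReal.ofReal (Real.exp (-(z * t))) *
          ENNReal.ofReal (1 / Real.Gamma (1 - α) * t ^ (-α)) ∂m := by
        refine lintegral_congr fun t => (lintegral_const_mul _ ?_).symm
        exact hM.comp measurable_prodMk_left
    _ = ∫⁻ α, (∫⁻ t in Ioi 0, ENNReal.ofReal (Real.exp (-(z * t))) *
          ENNReal.ofReal (1 / Real.Gamma (1 - α) * t ^ (-α))) ∂m := by
        refine lintegral_lintegral_swap (Measurable.aemeasurable ?_)
        exact Measurable.mul (by fun_prop) hM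
    _ = ∫⁻ α, ENNReal.ofReal (z ^ α / z) ∂m := by
        refine lintegral_congr_ae ?_
        filter_upwards [hm] with α hα using lintegral_rpow_mul_exp_neg hz hα
    _ = ENNReal.ofReal (symbol m z / z) := by
        rw [← ofReal_integral_eq_lintegral_ofReal ((integrable_rpow hm hz).div_const z)
          (ae_of_all _ fun α => by positivity), integral_div]
        rfl

lemma laplace_expKernel [IsProbabilityMeasure ν] (hν : ∀ᵐ r ∂ν, 0 < r) {z : ℝ} (hz : 0 < z) :
    ∫⁻ t in Ioi 0, ENNReal.ofReal (Real.exp (-(z * t))) * expKernel ν t =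
      ENNReal.ofReal (1 - z * ∫ r, (z + r)⁻¹ ∂ν) := by
  have hinv : Integrable (fun r => (z + r)⁻¹) ν := by
    refine Integrable.of_bound (by fun_prop) z⁻¹ ?_
    filter_upwards [hν] with r hr
    rw [Real.norm_eq_abs, abs_of_nonneg (by positivity)]
    exact inv_anti₀ hz (by linarith)
  calc ∫⁻ t in Ioi 0, ENNReal.ofReal (Real.exp (-(z * t))) * expKernel ν t
      = ∫⁻ t in Ioi 0, ∫⁻ r, ENNReal.ofReal (Real.exp (-(z * t))) *
          ENNReal.ofReal (r * Real.exp (-(r * t))) ∂ν :=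
        lintegral_congr fun t => (lintegral_const_mul _ (by fun_prop)).symm
    _ = ∫⁻ r, (∫⁻ t in Ioi 0, ENNReal.ofReal (Real.exp (-(z * t))) *
          ENNReal.ofReal (r * Real.exp (-(r * t)))) ∂ν :=
        lintegral_lintegral_swap (by fun_prop)
    _ = ∫⁻ r, ENNReal.ofReal (1 - z * (z + r)⁻¹) ∂ν := by
        refine lintegral_congr_ae ?_
        filter_upwards [hν] with r hr
        have e : ∀ t : ℝ, ENNReal.ofReal (Real.exp (-(z * t))) *
            ENNReal.ofReal (r * Real.exp (-(r * t))) =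
            ENNReal.ofReal r * ENNReal.ofReal (Real.exp (-((z + r) * t))) := by
          intro t
          rw [← ENNReal.ofReal_mul (Real.exp_pos _).le, ← ENNReal.ofReal_mul hr.le, mul_left_comm,
            ← Real.exp_add]
          congr 3; ring
        simp_rw [e]
        rw [lintegral_const_mul _ (by fun_prop), lintegral_exp_neg_mul_Ioi (by positivity),
          ← ENNReal.ofReal_mul hr.le]
        congr 1
        field_simp
        ring
    _ = ENNReal.ofReal (1 - z * ∫ r, (z + r)⁻¹ ∂ν) := by
        rw [← ofReal_integral_eq_lintegral_ofReal (f := fun r => 1 - z * (z + r)⁻¹)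
            ((integrable_const 1).sub (hinv.const_mul z)),
          integral_sub (integrable_const 1) (hinv.const_mul z), integral_const_mul]
        · simp
        · filter_upwards [hν] with r hr
          simp only [Pi.zero_apply, sub_nonneg]
          rw [← div_eq_mul_inv, div_le_one (by positivity)]
          linarith

/-- The convolution of `expKernel ν` and `caputoKernel m + lam` is the constant `lam` on the
positive half-axis. -/
lemma convolution_kernels_ae_eq [IsFiniteMeasure m] (hm : ∀ᵐ α ∂m, α ∈ Ioo (0 : ℝ) 1)
    (hm0 : m ≠ 0) {lam : ℝ} (hl : 0 < lam) [IsProbabilityMeasure ν] (hν : ∀ᵐ r ∂ν, 0 < r)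
    (hS : ∀ z, 0 < z → ∫ r, (z + r)⁻¹ ∂ν = symbol m z / (z * (symbol m z + lam))) :
    (fun x => ∫⁻ y, (Ioi 0).indicator (expKernel ν) y *
      (Ioi 0).indicator (fun t => caputoKernel m t + ENNReal.ofReal lam) (x - y)) =ᵐ[volume]
      (Ioi 0).indicator fun _ => ENNReal.ofReal lam := by
  have hP : Measurable ((Ioi 0).indicator (expKernel ν)) :=
    measurable_expKernel.indicator measurableSet_Ioi
  have hK : Measurable ((Ioi 0).indicator (fun t => caputoKernel m t + ENNReal.ofReal lam)) :=
    (measurable_caputoKernel.add_const _).indicator measurableSet_Ioi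
  have hind : ∀ (f : ℝ → ℝ≥0∞) (z : ℝ), ∫⁻ x, ENNReal.ofReal (Real.exp (-(z * x))) *
      (Ioi 0).indicator f x = ∫⁻ x in Ioi 0, ENNReal.ofReal (Real.exp (-(z * x))) * f x := by
    intro f z
    rw [← lintegral_indicator measurableSet_Ioi]
    refine lintegral_congr fun x => ?_
    by_cases hx : x ∈ Ioi (0 : ℝ) <;> simp [hx]
  -- The two transforms are λ/(w+λ) and (w+λ)/z, so their product λ/z is that of the constant λ.
  have hL : ∀ z : ℝ, 0 < z → ∫⁻ x, ENNReal.ofReal (Real.exp (-(z * x))) *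
      ∫⁻ y, (Ioi 0).indicator (expKernel ν) y *
      (Ioi 0).indicator (fun t => caputoKernel m t + ENNReal.ofReal lam) (x - y) =
      ENNReal.ofReal (lam * z⁻¹) := by
    intro z hz
    have hw := symbol_pos hm hm0 hz
    rw [laplace_convolution hP hK, hind, hind, laplace_expKernel hν hz]
    simp_rw [mul_add]
    rw [hS z hz, lintegral_add_right _ (by fun_prop), laplace_caputoKernel hm hz,
      lintegral_mul_const _ (by fun_prop), lintegral_exp_neg_mul_Ioi hz,
      ← ENNReal.ofReal_mul (by positivity), ← ENNReal.ofReal_add (by positivity) (by positivity),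
      ← ENNReal.ofReal_mul]
    · congr 1
      field_simp
      ring
    · have : 1 - z * (symbol m z / (z * (symbol m z + lam))) = lam / (symbol m z + lam) := by
        field_simp; ring
      rw [this]; positivity
  refine ae_eq_of_laplace_eq ?_ (measurable_const.indicator measurableSet_Ioi)
    (fun z hz => by rw [hL z hz]; exact ENNReal.ofReal_ne_top) fun z hz => ?_
  · exact Measurable.lintegral_prod_right' (f := fun p : ℝ × ℝ =>
      (Ioi 0).indicator (expKernel ν) p.2 *
      (Ioi 0).indicator (fun t => caputoKernel m t + ENNReal.ofReal lam) (p.1 - p.2))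
      ((hP.comp measurable_snd).mul (hK.comp (measurable_fst.sub measurable_snd)))
  · rw [hL z hz, hind, lintegral_mul_const _ (by fun_prop), lintegral_exp_neg_mul_Ioi hz,
      ← ENNReal.ofReal_mul (by positivity), mul_comm]

end Laplace

/-! ### Uniqueness and representation for the scalar relaxation equation. -/

section Continuous
open ProbabilityTheory Filter Topology

variable {m ν : Measure ℝ}

/-- Tonelli reduces this to the antiderivative -e^(-ry) for each r. -/
lemma integral_expKernel [IsProbabilityMeasure ν] (hν : ∀ᵐ r ∂ν, 0 < r) {t : ℝ} (ht : 0 ≤ t) :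
    ∫ y in Ioc 0 t, (expKernel ν y).toReal = 1 - ∫ r, Real.exp (-(r * t)) ∂ν := by
  have hexp : Integrable (fun r => Real.exp (-(r * t))) ν := by
    refine Integrable.of_bound (by fun_prop) 1 ?_
    filter_upwards [hν] with r hr
    rw [Real.norm_eq_abs, Real.abs_exp, Real.exp_le_one_iff, neg_nonpos]
    positivity
  have h : ∫⁻ y in Ioc 0 t, expKernel ν y = ENNReal.ofReal (1 - ∫ r, Real.exp (-(r * t)) ∂ν) := by
    calc ∫⁻ y in Ioc 0 t, expKernel ν y
        = ∫⁻ r, (∫⁻ y in Ioc 0 t, ENNReal.ofReal (r * Real.exp (-(r * y)))) ∂ν :=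
          lintegral_lintegral_swap (by fun_prop)
      _ = ∫⁻ r, ENNReal.ofReal (1 - Real.exp (-(r * t))) ∂ν := by
          refine lintegral_congr_ae ?_
          filter_upwards [hν] with r hr
          rw [← ofReal_integral_eq_lintegral_ofReal
            ((by fun_prop : Continuous fun y => r * Real.exp (-(r * y))).integrableOn_Ioc)
            (ae_of_all _ fun y => by positivity), ← intervalIntegral.integral_of_le ht]
          congr 1
          have hd : ∀ y ∈ uIcc 0 t, HasDerivAt (fun y => -Real.exp (-(r * y)))
              (r * Real.exp (-(r * y))) y := fun y _ => by
            have : HasDerivAt (fun y => -Real.exp (-(r * y))) (-(Real.exp (-(r * y)) * -(r * 1))) y :=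
              (((hasDerivAt_id' y).const_mul r).fun_neg.exp).fun_neg
            exact this.congr_deriv (by ring)
          rw [intervalIntegral.integral_eq_sub_of_hasDerivAt hd
            ((by fun_prop : Continuous fun y => r * Real.exp (-(r * y))).intervalIntegrable _ _)]
          simp; ring
      _ = _ := by
          rw [← ofReal_integral_eq_lintegral_ofReal (f := fun r => 1 - Real.exp (-(r * t)))
            ((integrable_const 1).sub hexp), integral_sub (integrable_const 1) hexp]
          · simp
          · filter_upwards [hν] with r hr
            simp only [Pi.zero_apply, sub_nonneg, Real.exp_le_one_iff, neg_nonpos]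
            positivity
  rw [integral_toReal measurable_expKernel.aemeasurable
    (ae_lt_top measurable_expKernel (by rw [h]; exact ENNReal.ofReal_ne_top)), h,
    ENNReal.toReal_ofReal]
  have : ∫ r, Real.exp (-(r * t)) ∂ν ≤ ∫ _, 1 ∂ν := by
    refine integral_mono_ae hexp (integrable_const 1) ?_
    filter_upwards [hν] with r hr
    simp only [Real.exp_le_one_iff, neg_nonpos]
    positivity
  simp at this
  linarith

/-- The solution of the scalar fractional relaxation equation is the Laplace transform of the
spectral measure. -/
theorem relaxation_solution_eq [IsFiniteMeasure m] (hm : ∀ᵐ α ∂m, α ∈ Ioo (0 : ℝ) 1)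
    (hm0 : m ≠ 0) {lam : ℝ} (hl : 0 < lam) [IsProbabilityMeasure ν] (hν : ∀ᵐ r ∂ν, 0 < r)
    (hS : ∀ z, 0 < z → ∫ r, (z + r)⁻¹ ∂ν = symbol m z / (z * (symbol m z + lam)))
    {T : ℝ} {f f' : ℝ → ℝ} (hc : ContinuousOn f (Icc 0 T))
    (hd : ∀ t ∈ Ioo 0 T, HasDerivAt f (f' t) t) (hi : IntervalIntegrable f' volume 0 T)
    (hki : ∀ t ∈ Ioo 0 T,
      IntervalIntegrable (fun s => (caputoKernel m (t - s)).toReal * f' s) volume 0 t)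
    (heq : ∀ t ∈ Ioo 0 T, ∫ s in (0 : ℝ)..t, (caputoKernel m (t - s)).toReal * f' s = -lam * f t)
    {t : ℝ} (ht : t ∈ Ioc 0 T) : f t = f 0 * ∫ r, Real.exp (-(r * t)) ∂ν := by
  have hFTC : ∀ y ∈ Icc 0 T, ∫ s in (0 : ℝ)..y, f' s = f y - f 0 := by
    intro y hy
    refine intervalIntegral.integral_eq_sub_of_hasDerivAt_of_le hy.1
      (hc.mono (Icc_subset_Icc le_rfl hy.2)) (fun s hs => hd s ⟨hs.1, hs.2.trans_le hy.2⟩)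
      (hi.mono_set ?_)
    rw [uIcc_of_le hy.1, uIcc_of_le (hy.1.trans hy.2)]
    exact Icc_subset_Icc le_rfl hy.2
  set P : ℝ → ℝ≥0∞ := (Ioi 0).indicator (expKernel ν) with hPdef
  set K : ℝ → ℝ≥0∞ := (Ioi 0).indicator (fun t => caputoKernel m t + ENNReal.ofReal lam) with hKdef
  have hP : Measurable P := measurable_expKernel.indicator measurableSet_Ioi
  have hK : Measurable K := (measurable_caputoKernel.add_const _).indicator measurableSet_Ioi
  set Q : ℝ → ℝ := (Ioc 0 t).indicator f' with hQdef
  have hiT : IntegrableOn f' (Ioc 0 t) :=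
    ((intervalIntegrable_iff_integrableOn_Ioc_of_le (ht.1.le.trans ht.2)).1 hi).mono_set
      (Ioc_subset_Ioc le_rfl ht.2)
  have hQ : Integrable Q := hiT.integrable_indicator measurableSet_Ioc
  have hconv := convolution_kernels_ae_eq hm hm0 hl hν hS
  -- the convolution, evaluated at `t - s`
  have hconv' : ∀ᵐ s : ℝ, ∫⁻ y, P y * K (t - s - y) = (Ioi 0).indicator (fun _ => ENNReal.ofReal lam) (t - s) :=
    (quasiMeasurePreserving_sub_left volume t).ae hconv
  have hshift : ∀ s : ℝ, ∫⁻ y, P (t - y) * K (y - s) = ∫⁻ y, P y * K (t - s - y) := by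
    intro s
    rw [← lintegral_sub_left_eq_self (fun y => P y * K (t - s - y)) t]
    refine lintegral_congr fun y => ?_
    congr 2; ring
  -- With k the Caputo kernel, p the kernel `expKernel ν` and E(t) = ∫ e^(-rt) dν, Fubini for H
  -- evaluates f' * (k+λ) * p at t in two ways. Joining the kernels first gives f' * λ = λ (f(t) -
  -- f(0)). Joining f' and k+λ first gives the constant -λ f(0), by the equation, and then -λ f(0)
  -- (1 - E(t)).
  set H : ℝ → ℝ → ℝ := fun s y => Q s * ((P (t - y)).toReal * (K (y - s)).toReal) with hH
  have hHm : AEStronglyMeasurable (Function.uncurry H) (volume.prod volume) := by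
    refine (hQ.aestronglyMeasurable.comp_fst).mul
      (Measurable.aestronglyMeasurable ?_)
    exact ((hP.comp (measurable_const.sub measurable_snd)).ennreal_toReal).mul
      (hK.comp (measurable_snd.sub measurable_fst)).ennreal_toReal
  -- The kernels are nonnegative with convolution at most λ almost everywhere, so f' in L¹ suffices
  -- for Fubini.
  have hHi : Integrable (Function.uncurry H) (volume.prod volume) := by
    refine ⟨hHm, ?_⟩
    rw [hasFiniteIntegral_iff_enorm, lintegral_prod _ hHm.enorm]
    calc ∫⁻ s, ∫⁻ y, ‖H s y‖ₑ ≤ ∫⁻ s, ‖Q s‖ₑ * ENNReal.ofReal lam := by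
          refine lintegral_mono_ae ?_
          filter_upwards [hconv'] with s hs
          calc ∫⁻ y, ‖H s y‖ₑ ≤ ∫⁻ y, ‖Q s‖ₑ * (P (t - y) * K (y - s)) := by
                refine lintegral_mono fun y => ?_
                simp only [hH, enorm_mul]
                have hle : ∀ a : ℝ≥0∞, ‖a.toReal‖ₑ ≤ a := fun a => by
                  rw [Real.enorm_of_nonneg ENNReal.toReal_nonneg]; exact ENNReal.ofReal_toReal_le
                gcongr <;> exact hle _
            _ = ‖Q s‖ₑ * ∫⁻ y, P (t - y) * K (y - s) := lintegral_const_mul _ (by fun_prop)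
            _ ≤ ‖Q s‖ₑ * ENNReal.ofReal lam := by
                gcongr
                rw [hshift, hs]
                exact indicator_le_self' (by simp) _
      _ = (∫⁻ s, ‖Q s‖ₑ) * ENNReal.ofReal lam :=
          lintegral_mul_const'' _ hQ.aestronglyMeasurable.enorm
      _ < ⊤ := ENNReal.mul_lt_top hQ.hasFiniteIntegral ENNReal.ofReal_lt_top
  have hswap := integral_integral_swap hHi
  have hleft : ∫ s, ∫ y, H s y = lam * (f t - f 0) := by
    rw [← hFTC t ⟨ht.1.le, ht.2⟩, intervalIntegral.integral_of_le ht.1.le,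
      ← integral_indicator measurableSet_Ioc, ← integral_const_mul]
    refine integral_congr_ae ?_
    have hne : ∀ᵐ s : ℝ, s ≠ t := by simp [ae_iff]
    filter_upwards [hconv', hne] with s hs hst
    simp only [hH, integral_const_mul]
    by_cases hsm : s ∈ Ioc 0 t
    · have hpos : t - s ∈ Ioi (0 : ℝ) := sub_pos.2 (lt_of_le_of_ne hsm.2 hst)
      have h1 : ∫⁻ y, P (t - y) * K (y - s) = ENNReal.ofReal lam := by
        rw [hshift, hs, indicator_of_mem hpos]
      have h2 : ∫ y, (P (t - y)).toReal * (K (y - s)).toReal = lam := by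
        simp_rw [← ENNReal.toReal_mul]
        have hmm : Measurable fun y => P (t - y) * K (y - s) := by fun_prop
        rw [integral_toReal hmm.aemeasurable
          (ae_lt_top hmm (by rw [h1]; exact ENNReal.ofReal_ne_top)), h1, ENNReal.toReal_ofReal hl.le]
      rw [h2, mul_comm]
    · simp [hQdef, hsm]
  have hright : ∫ y, ∫ s, H s y = -lam * f 0 * (1 - ∫ r, Real.exp (-(r * t)) ∂ν) := by
    have hu : ∫ y in Ioc 0 t, (expKernel ν y).toReal = ∫ y in Ioo 0 t, (expKernel ν (t - y)).toReal := by
      rw [← intervalIntegral.integral_of_le ht.1.le, ← integral_Ioc_eq_integral_Ioo,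
        ← intervalIntegral.integral_of_le ht.1.le,
        intervalIntegral.integral_comp_sub_left (fun y => (expKernel ν y).toReal)]
      simp
    rw [← integral_expKernel hν ht.1.le, hu, ← integral_const_mul, ← integral_indicator measurableSet_Ioo]
    congr 1 with y
    by_cases hy : y ∈ Ioo 0 t
    · have hyT : y ∈ Ioo 0 T := ⟨hy.1, hy.2.trans_le ht.2⟩
      rw [indicator_of_mem hy]
      have hPy : P (t - y) = expKernel ν (t - y) := indicator_of_mem (sub_pos.2 hy.2) _
      have h1 : ∫ s, Q s * (K (y - s)).toReal = -lam * f 0 := by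
        have h2 : (fun s => Q s * (K (y - s)).toReal) =ᵐ[volume] (Ioc 0 y).indicator
            fun s => (caputoKernel m (y - s)).toReal * f' s + lam * f' s := by
          -- A finite Laplace transform at z = 1 forces the kernel to be finite almost everywhere.
          have hKfin : ∀ᵐ s : ℝ, s < y → caputoKernel m (y - s) < ⊤ := by
            have h3 : ∀ᵐ x : ℝ, x ∈ Ioi (0 : ℝ) → caputoKernel m x < ⊤ := by
              rw [← ae_restrict_iff' measurableSet_Ioi]
              have h4 : ∀ᵐ x ∂(volume.restrict (Ioi (0 : ℝ))),
                  ENNReal.ofReal (Real.exp (-(1 * x))) * caputoKernel m x < ⊤ :=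
                ae_lt_top (Measurable.mul (by fun_prop) measurable_caputoKernel) (by
                  rw [laplace_caputoKernel hm one_pos]; exact ENNReal.ofReal_ne_top)
              filter_upwards [h4] with x hx
              exact lt_of_not_ge fun htop => by
                rw [top_le_iff.1 htop, ENNReal.mul_top (by simp [Real.exp_pos])] at hx
                exact lt_irrefl _ hx
            filter_upwards [(quasiMeasurePreserving_sub_left volume y).ae h3] with s hs hsy
              using hs (sub_pos.2 hsy)
          have hne : ∀ᵐ s : ℝ, s ≠ y := by simp [ae_iff]
          filter_upwards [hKfin, hne] with s hs hsy
          by_cases hsm : s ∈ Ioc 0 y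
          · have hlt : s < y := lt_of_le_of_ne hsm.2 hsy
            have hsub : y - s ∈ Ioi (0 : ℝ) := sub_pos.2 hlt
            rw [indicator_of_mem hsm, hQdef, indicator_of_mem
              (show s ∈ Ioc 0 t from ⟨hsm.1, hsm.2.trans hy.2.le⟩), hKdef, indicator_of_mem hsub,
              ENNReal.toReal_add (hs hlt).ne ENNReal.ofReal_ne_top, ENNReal.toReal_ofReal hl.le]
            ring
          · rw [indicator_of_notMem hsm]
            rcases not_and_or.1 hsm with h | h
            · have : s ∉ Ioc 0 t := fun h' => h h'.1
              simp [hQdef, this]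
            · have : y - s ∉ Ioi (0 : ℝ) := fun h' => h (sub_pos.1 h').le
              simp [hKdef, this]
        rw [integral_congr_ae h2, integral_indicator measurableSet_Ioc,
          ← intervalIntegral.integral_of_le hy.1.le, intervalIntegral.integral_add (hki y hyT),
          heq y hyT, intervalIntegral.integral_const_mul, hFTC y ⟨hy.1.le, hyT.2.le⟩]
        · ring
        · refine (hi.mono_set ?_).const_mul _
          rw [uIcc_of_le hy.1.le, uIcc_of_le (hy.1.trans hyT.2).le]
          exact Icc_subset_Icc le_rfl hyT.2.le
      simp only [hH, hPy]
      rw [← h1, mul_comm, ← integral_const_mul]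
      congr 1 with s
      ring
    · rw [indicator_of_notMem hy]
      refine integral_eq_zero_of_ae (ae_of_all _ fun s => ?_)
      simp only [hH, Pi.zero_apply]
      by_cases hyt : t ≤ y
      · have : t - y ∉ Ioi (0 : ℝ) := by simpa using hyt
        simp [hPdef, this]
      · have hy0 : y ≤ 0 := by
          by_contra h
          exact hy ⟨not_le.1 h, not_le.1 hyt⟩
        by_cases hs : s ∈ Ioc 0 t
        · have : y - s ∉ Ioi (0 : ℝ) := by have := hs.1; simp; linarith
          simp [hKdef, this]
        · simp [hQdef, hs]
  rw [hleft, hright] at hswap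
  apply mul_left_cancel₀ hl.ne'
  linarith

end Continuous

/-! ### The scalar error bound for the weight μ. -/

section Scalar
open ProbabilityTheory Filter Topology

/-- The measure `μ(α) dα` on `(0, 1)`. -/
noncomputable def weightMeasure (μ : ℝ → ℝ) : Measure ℝ :=
  (volume.restrict (Ioo 0 1)).withDensity fun α => ENNReal.ofReal (μ α)

variable {μ : ℝ → ℝ}

lemma aemeasurable_weight (hμ : ContinuousOn μ (Icc 0 1)) :
    AEMeasurable (fun α => ENNReal.ofReal (μ α)) (volume.restrict (Ioo 0 1)) :=
  ((hμ.mono Ioo_subset_Icc_self).aemeasurable measurableSet_Ioo).ennreal_ofReal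

lemma ae_weightMeasure (μ : ℝ → ℝ) : ∀ᵐ α ∂(weightMeasure μ), α ∈ Ioo (0 : ℝ) 1 :=
  (withDensity_absolutelyContinuous _ _).ae_le (ae_restrict_mem measurableSet_Ioo)

lemma integral_weightMeasure (hμ : ContinuousOn μ (Icc 0 1)) (hμ0 : ∀ α ∈ Icc (0 : ℝ) 1, 0 ≤ μ α)
    (g : ℝ → ℝ) : ∫ α, g α ∂(weightMeasure μ) = ∫ α in (0 : ℝ)..1, g α * μ α := by
  rw [weightMeasure, integral_withDensity_eq_integral_toReal_smul₀ (aemeasurable_weight hμ)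
    (by simp), intervalIntegral.integral_of_le zero_le_one, integral_Ioc_eq_integral_Ioo]
  refine setIntegral_congr_fun measurableSet_Ioo fun α hα => ?_
  simp only [smul_eq_mul]
  rw [ENNReal.toReal_ofReal (hμ0 α (Ioo_subset_Icc_self hα)), mul_comm]

lemma isFiniteMeasure_weightMeasure (hμ : ContinuousOn μ (Icc 0 1)) :
    IsFiniteMeasure (weightMeasure μ) := by
  obtain ⟨C, hC⟩ := isCompact_Icc.exists_bound_of_continuousOn hμ
  refine ⟨?_⟩
  rw [weightMeasure, withDensity_apply _ .univ, Measure.restrict_univ]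
  calc ∫⁻ α in Ioo 0 1, ENNReal.ofReal (μ α) ≤ ∫⁻ _ in Ioo (0 : ℝ) 1, ENNReal.ofReal C := by
        refine setLIntegral_mono measurable_const fun α hα => ENNReal.ofReal_le_ofReal ?_
        exact (le_abs_self _).trans (hC α (Ioo_subset_Icc_self hα))
    _ < ⊤ := by simp

/-- The measure `μ(α) dα` charges every left neighbourhood of `1` proportionally to its length. -/
lemma exists_weightMeasure_ge (hμ : ContinuousOn μ (Icc 0 1)) (hμ1 : 0 < μ 1) :
    ∃ c : ℝ, 0 < c ∧ ∀ η : ℝ, 0 < η → η ≤ 1 → c * η ≤ (weightMeasure μ).real (Ioo (1 - η) 1) := by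
  have := isFiniteMeasure_weightMeasure hμ
  have h1 : ∀ᶠ α in 𝓝[Icc 0 1] (1 : ℝ), μ 1 / 2 < μ α :=
    (hμ 1 (by simp)).eventually (lt_mem_nhds (by linarith))
  obtain ⟨δ, hδ, hδs⟩ := Metric.mem_nhdsWithin_iff.1 h1
  refine ⟨μ 1 / 2 * min δ 1, by positivity, fun η hη0 hη1 => ?_⟩
  -- The shorter interval has ρ ≤ δ, so μ exceeds μ(1)/2 on it, and its length is still proportional
  -- to η.
  set ρ := min δ 1 * η with hρ
  have hρ0 : 0 < ρ := by positivity
  have hρη : ρ ≤ η := mul_le_of_le_one_left hη0.le (min_le_right _ _)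
  have hρδ : ρ ≤ δ := (mul_le_of_le_one_right (by positivity) hη1).trans (min_le_left _ _)
  have hsub : Ioo (1 - ρ) 1 ⊆ Ioo (1 - η) 1 := Ioo_subset_Ioo (by linarith) le_rfl
  have h01 : Ioo (1 - ρ) 1 ⊆ Ioo 0 1 := Ioo_subset_Ioo (by linarith) le_rfl
  refine le_trans ?_ (measureReal_mono hsub)
  rw [Measure.real, weightMeasure, withDensity_apply _ measurableSet_Ioo,
    Measure.restrict_restrict measurableSet_Ioo, inter_eq_left.2 h01]
  have h2 : ENNReal.ofReal (μ 1 / 2 * ρ) ≤ ∫⁻ α in Ioo (1 - ρ) 1, ENNReal.ofReal (μ α) := by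
    calc ENNReal.ofReal (μ 1 / 2 * ρ) = ∫⁻ _ in Ioo (1 - ρ) 1, ENNReal.ofReal (μ 1 / 2) := by
          rw [setLIntegral_const, Real.volume_Ioo, ENNReal.ofReal_mul (by positivity)]
          congr 2; ring
      _ ≤ _ := by
          refine setLIntegral_mono' measurableSet_Ioo fun α hα => ENNReal.ofReal_le_ofReal ?_
          refine le_of_lt (hδs ⟨?_, Ioo_subset_Icc_self (h01 hα)⟩)
          rw [Metric.mem_ball, Real.dist_eq, abs_lt]
          constructor <;> linarith [hα.1, hα.2]
  have hfin : ∫⁻ α in Ioo (1 - ρ) 1, ENNReal.ofReal (μ α) ≠ ⊤ := by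
    have h3 := measure_ne_top (weightMeasure μ) (Ioo (1 - ρ) 1)
    rwa [weightMeasure, withDensity_apply _ measurableSet_Ioo,
      Measure.restrict_restrict measurableSet_Ioo, inter_eq_left.2 h01] at h3
  calc μ 1 / 2 * min δ 1 * η = μ 1 / 2 * ρ := by rw [hρ]; ring
    _ = (ENNReal.ofReal (μ 1 / 2 * ρ)).toReal := (ENNReal.toReal_ofReal (by positivity)).symm
    _ ≤ _ := ENNReal.toReal_mono hfin h2

/-- The symbol satisfies `z / w(z) ≤ C log (max z 2)`. -/
lemma exists_div_symbol_le {m : Measure ℝ} [IsFiniteMeasure m]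
    (hm : ∀ᵐ α ∂m, α ∈ Ioo (0 : ℝ) 1)
    (h : ∃ c : ℝ, 0 < c ∧ ∀ η : ℝ, 0 < η → η ≤ 1 → c * η ≤ m.real (Ioo (1 - η) 1)) :
    ∃ C : ℝ, 0 < C ∧ ∀ z : ℝ, 0 < z → z / symbol m z ≤ C * Real.log (max z 2) := by
  obtain ⟨c, hc, hη⟩ := h
  have hl2 : 0 < Real.log 2 := Real.log_pos one_lt_two
  refine ⟨Real.exp 1 / c * (1 / Real.log 2), by positivity, fun z hz => ?_⟩
  -- For α > 1 - 1/M, (1-α) log z ≤ 1, hence z^α ≥ z/e. This interval has mass at least c/M, so w(z)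
  -- ≥ cz/(eM).
  set M := max 1 (Real.log z) with hM
  have hM1 : 1 ≤ M := le_max_left _ _
  have hM0 : 0 < M := one_pos.trans_le hM1
  set η := 1 / M with hηd
  have hη0 : 0 < η := by positivity
  have hη1 : η ≤ 1 := (div_le_one hM0).2 hM1
  have hsym : z / Real.exp 1 * (c * η) ≤ symbol m z := by
    calc z / Real.exp 1 * (c * η) ≤ z / Real.exp 1 * m.real (Ioo (1 - η) 1) := by
          gcongr; exact hη η hη0 hη1
      _ = ∫ _ in Ioo (1 - η) 1, z / Real.exp 1 ∂m := by
          rw [setIntegral_const, smul_eq_mul, mul_comm]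
      _ ≤ ∫ α in Ioo (1 - η) 1, z ^ α ∂m := by
          refine setIntegral_mono_on (integrable_const _).integrableOn
            (integrable_rpow hm hz).integrableOn measurableSet_Ioo fun α hα => ?_
          rw [div_le_iff₀ (Real.exp_pos _), Real.rpow_def_of_pos hz, ← Real.exp_add]
          nth_rewrite 1 [← Real.exp_log hz]
          apply Real.exp_le_exp.2
          have h1 : (1 - α) * Real.log z ≤ 1 := by
            calc (1 - α) * Real.log z ≤ (1 - α) * M := by
                  gcongr
                  · linarith [hα.2]
                  · exact le_max_right _ _
              _ ≤ η * M := by gcongr; linarith [hα.1]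
              _ = 1 := by rw [hηd]; field_simp
          nlinarith
      _ ≤ symbol m z := setIntegral_le_integral (integrable_rpow hm hz)
          (ae_of_all _ fun α => by positivity)
  -- The factor 1/log 2 covers both cases M = 1 and M = log z, as log 2 < 1.
  have hL : M ≤ 1 / Real.log 2 * Real.log (max z 2) := by
    have h1 : Real.log 2 ≤ Real.log (max z 2) := Real.log_le_log two_pos (le_max_right _ _)
    have h2 : Real.log z ≤ Real.log (max z 2) := Real.log_le_log hz (le_max_left _ _)
    have h3 : Real.log 2 < 1 := by linarith [Real.log_two_lt_d9]
    rw [one_div_mul_eq_div, le_div_iff₀ hl2]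
    rcases max_cases 1 (Real.log z) with h | h <;> rw [hM, h.1] <;> nlinarith
  calc z / symbol m z ≤ z / (z / Real.exp 1 * (c * η)) := by gcongr
    _ = Real.exp 1 / c * M := by rw [hηd]; field_simp
    _ ≤ Real.exp 1 / c * (1 / Real.log 2 * Real.log (max z 2)) := by gcongr
    _ = _ := by ring

/-! ### Monotonicity, local integrability and finiteness of the Caputo kernel. -/

section Kernel

variable {m : Measure ℝ}

lemma one_div_Gamma_one_sub_nonneg {α : ℝ} (hα : α ∈ Ioo (0 : ℝ) 1) :
    0 ≤ 1 / Real.Gamma (1 - α) :=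
  one_div_nonneg.2 (Real.Gamma_pos_of_pos (by linarith [hα.2])).le

lemma caputoKernel_anti (hm : ∀ᵐ α ∂m, α ∈ Ioo (0 : ℝ) 1) {s t : ℝ} (hs : 0 < s) (hst : s ≤ t) :
    caputoKernel m t ≤ caputoKernel m s := by
  refine lintegral_mono_ae ?_
  filter_upwards [hm] with α hα
  refine ENNReal.ofReal_le_ofReal (mul_le_mul_of_nonneg_left ?_ (one_div_Gamma_one_sub_nonneg hα))
  exact Real.rpow_le_rpow_of_nonpos hs hst (by linarith [hα.1])

lemma lintegral_caputoKernel_lt_top [IsFiniteMeasure m] (hm : ∀ᵐ α ∂m, α ∈ Ioo (0 : ℝ) 1) (t : ℝ) :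
    ∫⁻ s in Ioc 0 t, caputoKernel m s < ⊤ := by
  calc ∫⁻ s in Ioc 0 t, caputoKernel m s
      ≤ ∫⁻ s in Ioc 0 t, ENNReal.ofReal (Real.exp t) *
          (ENNReal.ofReal (Real.exp (-(1 * s))) * caputoKernel m s) := by
        refine setLIntegral_mono' measurableSet_Ioc fun s hs => ?_
        rw [← mul_assoc, ← ENNReal.ofReal_mul (Real.exp_pos _).le, ← Real.exp_add]
        refine le_mul_of_one_le_left' ?_
        rw [ENNReal.one_le_ofReal]
        exact Real.one_le_exp (by linarith [hs.2])
    _ ≤ ∫⁻ s in Ioi 0, ENNReal.ofReal (Real.exp t) *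
          (ENNReal.ofReal (Real.exp (-(1 * s))) * caputoKernel m s) :=
        lintegral_mono_set Ioc_subset_Ioi_self
    _ < ⊤ := by
        rw [lintegral_const_mul' _ _ ENNReal.ofReal_ne_top,
          laplace_caputoKernel hm one_pos]
        exact ENNReal.mul_lt_top ENNReal.ofReal_lt_top ENNReal.ofReal_lt_top

/-- Local integrability makes the kernel finite at some point of (0, t], and it is nonincreasing. -/
lemma caputoKernel_lt_top [IsFiniteMeasure m] (hm : ∀ᵐ α ∂m, α ∈ Ioo (0 : ℝ) 1) {t : ℝ}
    (ht : 0 < t) : caputoKernel m t < ⊤ := by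
  have h1 := ae_lt_top measurable_caputoKernel (lintegral_caputoKernel_lt_top hm t).ne
  have h2 : ∃ s, s ∈ Ioc 0 t ∧ caputoKernel m s < ⊤ := by
    have : (ae (volume.restrict (Ioc 0 t))).NeBot := by
      rw [ae_neBot, Ne, Measure.restrict_eq_zero, Real.volume_Ioc]
      simpa using ht
    exact ((ae_restrict_mem measurableSet_Ioc).and h1).exists
  obtain ⟨s, hs, hsf⟩ := h2
  exact (caputoKernel_anti hm hs.1 hs.2).trans_lt hsf

lemma toReal_caputoKernel (hm : ∀ᵐ α ∂m, α ∈ Ioo (0 : ℝ) 1) {t : ℝ} (ht : 0 < t) :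
    (caputoKernel m t).toReal = ∫ α, 1 / Real.Gamma (1 - α) * t ^ (-α) ∂m := by
  rw [integral_eq_lintegral_of_nonneg_ae]
  · rfl
  · filter_upwards [hm] with α hα
    exact mul_nonneg (one_div_Gamma_one_sub_nonneg hα) (by positivity)
  · exact (measurable_one_div_Gamma_one_sub.mul (by fun_prop)).aestronglyMeasurable

end Kernel

/-- The temporal regularity of solutions of the semidiscrete problem. -/
structure IsRegular (T : ℝ) (f : ℝ → ℝ) : Prop where
  cont : ContinuousOn f (Icc 0 T)
  contDiff : ContDiffOn ℝ 1 f (Ioc 0 T)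
  integrable : IntervalIntegrable (deriv f) volume 0 T

lemma IsRegular.differentiableAt {T : ℝ} {f : ℝ → ℝ} (hf : IsRegular T f) {t : ℝ}
    (ht : t ∈ Ioo 0 T) : DifferentiableAt ℝ f t :=
  (hf.contDiff.differentiableOn one_ne_zero).differentiableAt
    (mem_of_superset (isOpen_Ioo.mem_nhds ht) Ioo_subset_Ioc_self)

lemma IsRegular.continuousOn_deriv {T : ℝ} {f : ℝ → ℝ} (hf : IsRegular T f) :
    ContinuousOn (deriv f) (Ioo 0 T) :=
  (hf.contDiff.mono Ioo_subset_Ioc_self).continuousOn_deriv_of_isOpen isOpen_Ioo le_rfl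

/-- For t < T every s in (0, t] is interior to [0, T], so the two-sided `deriv` sees only values
inside the interval. This is why the scalar equations are used on the open interval. -/
lemma caputo_eq_of_eqOn {T : ℝ} {f g : ℝ → ℝ} (h : EqOn f g (Icc 0 T)) {t : ℝ} (ht : t ∈ Ioo 0 T)
    (α : ℝ) : caputo α f t = caputo α g t := by
  rw [caputo, caputo]
  congr 1
  rw [intervalIntegral.integral_of_le ht.1.le, intervalIntegral.integral_of_le ht.1.le]
  refine setIntegral_congr_fun measurableSet_Ioc fun s hs => ?_
  have : f =ᶠ[𝓝 s] g := h.eventuallyEq_of_mem (Icc_mem_nhds hs.1 (hs.2.trans_lt ht.2))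
  simp only [this.deriv_eq]

lemma distrDeriv_eq_of_eqOn {T : ℝ} {f g : ℝ → ℝ} (h : EqOn f g (Icc 0 T)) {t : ℝ}
    (ht : t ∈ Ioo 0 T) : distrDeriv μ f t = distrDeriv μ g t := by
  simp only [distrDeriv, caputo_eq_of_eqOn h ht]

lemma IsRegular.congr {T : ℝ} {f g : ℝ → ℝ} (hf : IsRegular T f) (h : EqOn g f (Icc 0 T))
    (hT : 0 ≤ T) : IsRegular T g where
  cont := hf.cont.congr h
  contDiff := hf.contDiff.congr fun t ht => h (Ioc_subset_Icc_self ht)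
  integrable := by
    refine hf.integrable.congr_ae ?_
    rw [uIoc_of_le hT, ← restrict_Ioo_eq_restrict_Ioc]
    filter_upwards [ae_restrict_mem measurableSet_Ioo] with t ht
    exact ((h.eventuallyEq_of_mem (Icc_mem_nhds ht.1 ht.2)).deriv_eq).symm

lemma IsRegular.sum_deriv {T : ℝ} {ι : Type*} {s : Finset ι} {f : ι → ℝ → ℝ} (c : ι → ℝ)
    (hf : ∀ i ∈ s, IsRegular T (f i)) {t : ℝ} (ht : t ∈ Ioo 0 T) :
    deriv (fun t => ∑ i ∈ s, c i * f i t) t = ∑ i ∈ s, c i * deriv (f i) t := by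
  rw [deriv_fun_sum fun i hi => ((hf i hi).differentiableAt ht).const_mul _]
  exact Finset.sum_congr rfl fun i hi => deriv_const_mul _ ((hf i hi).differentiableAt ht)

lemma IsRegular.sum {T : ℝ} (hT : 0 ≤ T) {ι : Type*} {s : Finset ι} {f : ι → ℝ → ℝ} (c : ι → ℝ)
    (hf : ∀ i ∈ s, IsRegular T (f i)) : IsRegular T fun t => ∑ i ∈ s, c i * f i t where
  cont := continuousOn_finsetSum _ fun i hi => continuousOn_const.mul (hf i hi).cont
  contDiff := ContDiffOn.sum fun i hi => contDiffOn_const.mul (hf i hi).contDiff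
  integrable := by
    have h : IntervalIntegrable (fun t => ∑ i ∈ s, c i * deriv (f i) t) volume 0 T := by
      have := IntervalIntegrable.sum s (f := fun i t => c i * deriv (f i) t) (μ := volume)
        (a := 0) (b := T) fun i hi => (hf i hi).integrable.const_mul _
      refine this.congr_ae (ae_of_all _ fun t => ?_)
      simp
    refine h.congr_ae ?_
    rw [uIoc_of_le hT, ← restrict_Ioo_eq_restrict_Ioc]
    filter_upwards [ae_restrict_mem measurableSet_Ioo] with t ht
    exact (IsRegular.sum_deriv c hf ht).symm

/-! ### The distributed order derivative as a single convolution. -/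

section Representation

variable {m : Measure ℝ} [IsFiniteMeasure m]

/-- Split at t/2: on the first half the kernel is bounded and f' is integrable, on the second half
f' is bounded and the kernel is integrable. -/
lemma integrable_caputo_integrand (hm : ∀ᵐ α ∂m, α ∈ Ioo (0 : ℝ) 1) {T : ℝ} {f : ℝ → ℝ}
    (hf : IsRegular T f) {t : ℝ} (ht : t ∈ Ioo 0 T) :
    Integrable (fun p : ℝ × ℝ => 1 / Real.Gamma (1 - p.2) * (t - p.1) ^ (-p.2) * deriv f p.1)
      ((volume.restrict (Ioc 0 t)).prod m) := by
  have hg : IntegrableOn (deriv f) (Ioc 0 t) :=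
    ((intervalIntegrable_iff_integrableOn_Ioc_of_le (ht.1.trans ht.2).le).1 hf.integrable).mono_set
      (Ioc_subset_Ioc le_rfl ht.2.le)
  have hmeas : Measurable fun p : ℝ × ℝ => 1 / Real.Gamma (1 - p.2) * (t - p.1) ^ (-p.2) :=
    (measurable_one_div_Gamma_one_sub.comp measurable_snd).mul
      ((measurable_const.sub measurable_fst).pow measurable_snd.neg)
  have hA : AEStronglyMeasurable
      (fun p : ℝ × ℝ => 1 / Real.Gamma (1 - p.2) * (t - p.1) ^ (-p.2) * deriv f p.1)
      ((volume.restrict (Ioc 0 t)).prod m) :=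
    hmeas.aestronglyMeasurable.mul hg.aestronglyMeasurable.comp_fst
  refine ⟨hA, ?_⟩
  rw [hasFiniteIntegral_iff_enorm, lintegral_prod _ hA.enorm]
  have hin : ∀ s ∈ Ioc 0 t, ∫⁻ α, ‖1 / Real.Gamma (1 - α) * (t - s) ^ (-α) * deriv f s‖ₑ ∂m =
      caputoKernel m (t - s) * ‖deriv f s‖ₑ := by
    intro s hs
    rw [caputoKernel, ← lintegral_mul_const]
    · refine lintegral_congr_ae ?_
      filter_upwards [hm] with α hα
      rw [enorm_mul, Real.enorm_of_nonneg
        (mul_nonneg (one_div_Gamma_one_sub_nonneg hα) (Real.rpow_nonneg (sub_nonneg.2 hs.2) _))]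
    · exact measurable_caputoKernel_integrand.comp measurable_prodMk_left
  rw [setLIntegral_congr_fun measurableSet_Ioc hin]
  have h2 : 0 < t / 2 := half_pos ht.1
  obtain ⟨B, hB⟩ := (isCompact_Icc (a := t / 2) (b := t)).exists_bound_of_continuousOn
    (hf.continuousOn_deriv.mono (Icc_subset_Ioo h2 ht.2))
  rw [← Ioc_union_Ioc_eq_Ioc h2.le (half_le_self ht.1.le)]
  refine (lintegral_union_le _ _ _).trans_lt (ENNReal.add_lt_top.2 ⟨?_, ?_⟩)
  · calc ∫⁻ s in Ioc 0 (t / 2), caputoKernel m (t - s) * ‖deriv f s‖ₑ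
        ≤ ∫⁻ s in Ioc 0 (t / 2), caputoKernel m (t / 2) * ‖deriv f s‖ₑ := by
          refine setLIntegral_mono' measurableSet_Ioc fun s hs => ?_
          gcongr
          exact caputoKernel_anti hm h2 (by linarith [hs.2])
      _ = caputoKernel m (t / 2) * ∫⁻ s in Ioc 0 (t / 2), ‖deriv f s‖ₑ := by
          rw [lintegral_const_mul' _ _ (caputoKernel_lt_top hm h2).ne]
      _ < ⊤ := ENNReal.mul_lt_top (caputoKernel_lt_top hm h2)
          (hg.mono_set (Ioc_subset_Ioc le_rfl (half_le_self ht.1.le))).hasFiniteIntegral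
  · calc ∫⁻ s in Ioc (t / 2) t, caputoKernel m (t - s) * ‖deriv f s‖ₑ
        ≤ ∫⁻ s in Ioc (t / 2) t, caputoKernel m (t - s) * ENNReal.ofReal B := by
          refine setLIntegral_mono' measurableSet_Ioc fun s hs => ?_
          gcongr
          rw [← ofReal_norm]
          exact ENNReal.ofReal_le_ofReal (hB s (Ioc_subset_Icc_self hs))
      _ ≤ ∫⁻ s in Icc 0 t, caputoKernel m (t - s) * ENNReal.ofReal B :=
          lintegral_mono_set (Ioc_subset_Icc_self.trans (Icc_subset_Icc h2.le le_rfl))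
      _ = (∫⁻ s in Icc 0 t, caputoKernel m (t - s)) * ENNReal.ofReal B := by
          rw [lintegral_mul_const' _ _ ENNReal.ofReal_ne_top]
      _ = (∫⁻ s in Icc 0 t, caputoKernel m s) * ENNReal.ofReal B := by
          congr 1
          rw [← lintegral_indicator measurableSet_Icc, ← lintegral_indicator measurableSet_Icc,
            ← lintegral_sub_left_eq_self _ t]
          refine lintegral_congr fun s => ?_
          simp only [indicator, mem_Icc, sub_nonneg, sub_le_self_iff]
          simp [and_comm]
      _ < ⊤ := by
          refine ENNReal.mul_lt_top ?_ ENNReal.ofReal_lt_top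
          rw [← Measure.restrict_congr_set Ioc_ae_eq_Icc]
          exact lintegral_caputoKernel_lt_top hm t

lemma intervalIntegrable_caputoKernel_mul_deriv (hm : ∀ᵐ α ∂m, α ∈ Ioo (0 : ℝ) 1) {T : ℝ}
    {f : ℝ → ℝ} (hf : IsRegular T f) {t : ℝ} (ht : t ∈ Ioo 0 T) :
    IntervalIntegrable (fun s => (caputoKernel m (t - s)).toReal * deriv f s) volume 0 t ∧
    ∫ α, caputo α f t ∂m = ∫ s in (0 : ℝ)..t, (caputoKernel m (t - s)).toReal * deriv f s := by
  have hI := integrable_caputo_integrand hm hf ht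
  have hne : ∀ᵐ s ∂(volume.restrict (Ioc 0 t)), s ∈ Ioo 0 t := by
    rw [← restrict_Ioo_eq_restrict_Ioc]; exact ae_restrict_mem measurableSet_Ioo
  have hin : (fun s => ∫ α, 1 / Real.Gamma (1 - α) * (t - s) ^ (-α) * deriv f s ∂m)
      =ᵐ[volume.restrict (Ioc 0 t)] fun s => (caputoKernel m (t - s)).toReal * deriv f s := by
    filter_upwards [hne] with s hs
    rw [integral_mul_const, toReal_caputoKernel hm (sub_pos.2 hs.2)]
  constructor
  · rw [intervalIntegrable_iff_integrableOn_Ioc_of_le ht.1.le]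
    exact hI.integral_prod_left.congr hin
  · rw [intervalIntegral.integral_of_le ht.1.le, ← integral_congr_ae hin]
    rw [integral_integral_swap hI]
    congr 1 with α
    rw [caputo, intervalIntegral.integral_of_le ht.1.le, ← integral_const_mul]
    congr 1 with s
    ring

end Representation

lemma distrDeriv_eq_integral (hμ : ContinuousOn μ (Icc 0 1)) (hμ0 : ∀ α ∈ Icc (0 : ℝ) 1, 0 ≤ μ α)
    {T : ℝ} {f : ℝ → ℝ} (hf : IsRegular T f) {t : ℝ} (ht : t ∈ Ioo 0 T) :
    distrDeriv μ f t =
      ∫ s in (0 : ℝ)..t, (caputoKernel (weightMeasure μ) (t - s)).toReal * deriv f s := by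
  have := isFiniteMeasure_weightMeasure hμ
  rw [distrDeriv, ← integral_weightMeasure hμ hμ0,
    (intervalIntegrable_caputoKernel_mul_deriv (ae_weightMeasure μ) hf ht).2]

/-- Linearity is not formal, since divergent integrals have the value 0; the convolution form
supplies the integrability it requires. -/
lemma distrDeriv_sum (hμ : ContinuousOn μ (Icc 0 1)) (hμ0 : ∀ α ∈ Icc (0 : ℝ) 1, 0 ≤ μ α)
    {T : ℝ} {ι : Type*} {s : Finset ι} {f : ι → ℝ → ℝ} (c : ι → ℝ)
    (hf : ∀ i ∈ s, IsRegular T (f i)) {t : ℝ} (ht : t ∈ Ioo 0 T) :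
    distrDeriv μ (fun t => ∑ i ∈ s, c i * f i t) t = ∑ i ∈ s, c i * distrDeriv μ (f i) t := by
  have := isFiniteMeasure_weightMeasure hμ
  rw [distrDeriv_eq_integral hμ hμ0 (IsRegular.sum (ht.1.trans ht.2).le c hf) ht]
  have h1 : ∀ i ∈ s, c i * distrDeriv μ (f i) t = ∫ r in (0 : ℝ)..t,
      c i * ((caputoKernel (weightMeasure μ) (t - r)).toReal * deriv (f i) r) := fun i hi => by
    rw [distrDeriv_eq_integral hμ hμ0 (hf i hi) ht, intervalIntegral.integral_const_mul]
  rw [Finset.sum_congr rfl h1, ← intervalIntegral.integral_finsetSum fun i hi =>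
    ((intervalIntegrable_caputoKernel_mul_deriv (ae_weightMeasure μ) (hf i hi) ht).1.const_mul _)]
  rw [intervalIntegral.integral_of_le ht.1.le, intervalIntegral.integral_of_le ht.1.le]
  refine setIntegral_congr_fun measurableSet_Ioc fun r hr => ?_
  rw [IsRegular.sum_deriv c hf ⟨hr.1, hr.2.trans_lt ht.2⟩, Finset.mul_sum]
  exact Finset.sum_congr rfl fun i _ => by ring

lemma cqWeight_eq_taylorCoeff (hμ : ContinuousOn μ (Icc 0 1))
    (hμ0 : ∀ α ∈ Icc (0 : ℝ) 1, 0 ≤ μ α) (τ : ℝ) (j : ℕ) :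
    cqWeight μ τ j = taylorCoeff (fun ξ => symbol (weightMeasure μ) ((1 - ξ) / τ)) j := by
  have : cqSymbol μ τ = fun ξ => symbol (weightMeasure μ) ((1 - ξ) / τ) := by
    ext ξ
    rw [cqSymbol, symbol, integral_weightMeasure hμ hμ0]
  rw [cqWeight, taylorCoeff, this]

/-- The error estimate for the scalar problem, uniformly in the eigenvalue. -/
theorem exists_scalar_error_bound (hμ : ContinuousOn μ (Icc 0 1))
    (hμ0 : ∀ α ∈ Icc (0 : ℝ) 1, 0 ≤ μ α) (hμ1 : 0 < μ 1) :
    ∃ C : ℝ, 0 < C ∧ ∀ (lam : ℝ), 0 < lam → ∀ (T : ℝ), 0 < T → ∀ (N : ℕ), 1 ≤ N →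
      ∀ (τ : ℝ), τ = T / N → ∀ (f : ℝ → ℝ), IsRegular T f →
      (∀ t ∈ Ioo 0 T, distrDeriv μ f t + lam * f t = 0) →
      ∀ (U : ℕ → ℝ), (∀ n, 1 ≤ n → n ≤ N →
        cqSum μ τ n U + lam * U n = cqSum μ τ n (fun _ => 1) * f 0) →
      ∀ n : ℕ, 1 ≤ n → n ≤ N → |f (n * τ) - U n| ≤ C * τ * logFactor (n * τ) * (lam * |f 0|) := by
  have hfin := isFiniteMeasure_weightMeasure hμ
  have hm := ae_weightMeasure μ
  have hge := exists_weightMeasure_ge hμ hμ1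
  have hm0 : weightMeasure μ ≠ 0 := by
    obtain ⟨c, hc, h⟩ := hge
    intro h0
    have := h 1 one_pos le_rfl
    rw [h0] at this
    simp at this
    linarith
  obtain ⟨C, hC, hCb⟩ := exists_div_symbol_le hm hge
  refine ⟨8 * C, by positivity, ?_⟩
  intro lam hl T hT N hN τ hτ f hf hfe U hU n hn hnN
  have hN0 : (0 : ℝ) < N := by exact_mod_cast hN
  have hn0 : (0 : ℝ) < n := by exact_mod_cast hn
  have hτ0 : 0 < τ := by rw [hτ]; positivity
  -- The measure ν depends on λ, but it enters the final bound only through w, so C does not.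
  obtain ⟨ν, hνp, hν, hS⟩ := exists_spectral_measure hm hm0 hl
  have hnT : n * τ ∈ Ioc 0 T := by
    refine ⟨by positivity, ?_⟩
    rw [hτ, mul_div_assoc', div_le_iff₀ hN0, mul_comm]
    gcongr
  have h1 : f (n * τ) = f 0 * ∫ r, Real.exp (-(r * (n * τ))) ∂ν := by
    refine relaxation_solution_eq hm hm0 hl hν hS hf.cont
      (fun t ht => (hf.differentiableAt ht).hasDerivAt) hf.integrable
      (fun t ht => (intervalIntegrable_caputoKernel_mul_deriv hm hf ht).1) (fun t ht => ?_) hnT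
    rw [← distrDeriv_eq_integral hμ hμ0 hf ht]
    linarith [hfe t ht]
  have h2 : U n = f 0 * ∫ r, ((1 + τ * r) ^ n)⁻¹ ∂ν := by
    refine discrete_solution_eq hm hm0 hl hν hS hτ0 (fun k hk hkN => ?_) hn hnN
    have := hU k hk hkN
    simp only [cqSum, cqWeight_eq_taylorCoeff hμ hμ0, mul_one] at this
    exact this
  have h3 := abs_integral_error_le hm hm0 hl hν hS hτ0 hn
  have h4 := hCb (n * τ)⁻¹ (by positivity)
  rw [h1, h2, ← mul_sub, abs_mul]
  calc |f 0| * |∫ r, Real.exp (-(r * (n * τ))) ∂ν - ∫ r, ((1 + τ * r) ^ n)⁻¹ ∂ν|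
      ≤ |f 0| * (8 * τ * lam * (C * Real.log (max (n * τ)⁻¹ 2))) := by
        gcongr
        exact h3.trans (by gcongr)
    _ = 8 * C * τ * logFactor (n * τ) * (lam * |f 0|) := by rw [logFactor]; ring

end Scalar

/-! ### Finite element functions are Lipschitz, with classical weak derivatives. -/

section Sobolev
open Filter Topology
open scoped NNReal Convolution

/-- A continuous function is Lipschitz if it is so on each piece of a finite closed cover. -/
lemma lipschitzWith_of_finite_closed_cover {E : Type*} [NormedAddCommGroup E] [NormedSpace ℝ E]
    {ι : Type*} [Finite ι] {C : ι → Set E} (hC : ∀ i, IsClosed (C i)) (hcov : ∀ x, ∃ i, x ∈ C i)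
    {χ : E → ℝ} (hχ : Continuous χ) {L : ℝ≥0}
    (hL : ∀ i, ∀ x ∈ C i, ∀ y ∈ C i, |χ x - χ y| ≤ L * ‖x - y‖) : LipschitzWith L χ := by
  refine LipschitzWith.of_dist_le_mul fun y x => ?_
  rw [Real.dist_eq, dist_eq_norm]
  set p : ℝ → E := fun t => AffineMap.lineMap x y t with hp
  have hpc : Continuous p := AffineMap.lineMap_continuous
  have hpsub : ∀ s t : ℝ, ‖p s - p t‖ = |s - t| * ‖y - x‖ := by
    intro s t
    rw [← Real.norm_eq_abs, ← norm_smul]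
    congr 1
    simp only [hp, AffineMap.lineMap_apply_module']
    module
  set D := L * ‖y - x‖ with hD
  refine le_of_forall_pos_le_add fun ε hε => ?_
  -- Along the segment from x to y, χ changes at rate at most D; a comparison with slope D + ε gives
  -- the bound at the endpoint.
  have key := image_norm_le_of_liminf_right_slope_norm_lt_deriv_boundary (a := 0) (b := 1)
    (f := fun t => χ (p t) - χ x) (f' := fun _ => D) (B := fun t => (D + ε) * t)
    (B' := fun _ => D + ε) (by fun_prop) ?_ (by simp [hp]) (by fun_prop)
    (fun t _ => by simpa using ((hasDerivAt_id t).const_mul (D + ε)).hasDerivWithinAt)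
    (fun t _ _ => by linarith)
  · have h1 := key (x := 1) (by simp)
    simpa [hp] using h1
  · intro t _ r hr
    by_contra hcon
    rw [not_frequently] at hcon
    -- If all right slopes at t exceeded D, points just to the right of t would avoid every piece:
    -- pieces containing p(t) by their Lipschitz bound, the others by closedness. Finitely many
    -- pieces cannot all be avoided.
    have hev : ∀ i, ∀ᶠ z in 𝓝[>] t, p z ∉ C i := by
      intro i
      by_cases hi : p t ∈ C i
      · filter_upwards [hcon, self_mem_nhdsWithin] with z hz hzt hzi
        have hzt' : 0 < z - t := sub_pos.2 hzt
        refine hz (lt_of_le_of_lt ?_ hr)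
        rw [slope_def_field, div_le_iff₀ hzt']
        simp only [Function.comp]
        refine (norm_sub_norm_le _ _).trans ?_
        rw [sub_sub_sub_cancel_right, Real.norm_eq_abs]
        refine (hL i _ hzi _ hi).trans (le_of_eq ?_)
        rw [hpsub, abs_of_pos hzt', hD]; ring
      · exact (hpc.continuousAt.eventually ((hC i).isOpen_compl.mem_nhds hi)).filter_mono
          nhdsWithin_le_nhds
    obtain ⟨z, hz⟩ := (eventually_all.2 hev).exists
    obtain ⟨i, hi⟩ := hcov (p z)
    exact hz i hi

variable {d : ℕ} {Ω : Set (Euc d)}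

lemma IsConvexPolytopeDomain.isOpen (h : IsConvexPolytopeDomain Ω) : IsOpen Ω := by
  obtain ⟨_, S, rfl⟩ := h; exact isOpen_interior

lemma IsConvexPolytopeDomain.isBounded (h : IsConvexPolytopeDomain Ω) :
    Bornology.IsBounded Ω := by
  obtain ⟨_, S, rfl⟩ := h
  exact ((isBounded_convexHull.2 S.finite_toSet.isBounded)).subset interior_subset

variable {K : Geometry.SimplicialComplex ℝ (Euc d)}

/-- The simplices, on which χ is affine, and the complement of Ω, on which χ = 0 (the index `none`),
form a finite closed cover. -/
lemma MemFEM.exists_lipschitzWith (hΩ : IsOpen Ω) (hK : IsTriangulation Ω K) {χ : Euc d → ℝ}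
    (hχ : MemFEM Ω K χ) : ∃ L, LipschitzWith L χ := by
  have hfin : Finite K.faces := hK.1
  choose! ℓ hℓ using hχ.2.2
  have hb : ∀ s : K.faces, ∃ M : ℝ≥0, ∀ x y, |ℓ s x - ℓ s y| ≤ M * ‖x - y‖ := by
    intro s
    set l := LinearMap.toContinuousLinearMap (ℓ s).linear
    refine ⟨‖l‖₊, fun x y => ?_⟩
    have h1 := l.le_opNorm (x - y)
    have h2 : l (x - y) = ℓ s x - ℓ s y := by
      simp only [l, LinearMap.coe_toContinuousLinearMap']
      rw [← vsub_eq_sub x y, AffineMap.linearMap_vsub, vsub_eq_sub]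
    rw [h2] at h1
    simpa using h1
  choose M hM using hb
  have := Fintype.ofFinite K.faces
  refine ⟨∑ s, M s, lipschitzWith_of_finite_closed_cover (ι := Option K.faces)
    (C := fun o => o.elim Ωᶜ fun s => convexHull ℝ ((s : Finset (Euc d)) : Set (Euc d)))
    ?_ ?_ hχ.1 ?_⟩
  · rintro (_ | s)
    · exact hΩ.isClosed_compl
    · exact (s.1.finite_toSet.isCompact_convexHull (𝕜 := ℝ)).isClosed
  · intro x
    by_cases hx : x ∈ Ω
    · have : x ∈ K.space := by rw [hK.2]; exact subset_closure hx
      obtain ⟨s, hs, hxs⟩ := Geometry.SimplicialComplex.mem_space_iff.1 this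
      exact ⟨some ⟨s, hs⟩, hxs⟩
    · exact ⟨none, hx⟩
  · rintro (_ | s) x hx y hy
    · rw [hχ.2.1 x hx, hχ.2.1 y hy]
      simp; positivity
    · rw [hℓ s s.2 hx, hℓ s s.2 hy]
      refine (hM s x y).trans ?_
      gcongr
      exact_mod_cast Finset.single_le_sum (f := M) (fun _ _ => zero_le) (Finset.mem_univ s)

lemma hasCompactSupport_of_zero_off (hb : Bornology.IsBounded Ω) {χ : Euc d → ℝ}
    (h0 : ∀ x, x ∉ Ω → χ x = 0) : HasCompactSupport χ :=
  HasCompactSupport.intro hb.isCompact_closure fun x hx => h0 x fun h => hx (subset_closure h)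

lemma isWeakPartial_unique (hΩ : IsOpen Ω) {i : Fin d} {u g₁ g₂ : Euc d → ℝ}
    (h₁ : IsWeakPartial Ω i u g₁) (h₂ : IsWeakPartial Ω i u g₂) :
    g₁ =ᵐ[volume.restrict Ω] g₂ := by
  have hd : LocallyIntegrableOn (fun x => g₁ x - g₂ x) Ω := by
    have := ((h₁.1.sub h₂.1).locallyIntegrable one_le_two)
    exact locallyIntegrableOn_of_locallyIntegrable_restrict this
  have h := hΩ.ae_eq_zero_of_integral_contDiff_smul_eq_zero hd fun φ hφ hφc hφs => by
    have hφL : MemLp φ 2 (volume.restrict Ω) :=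
      (hφ.continuous.memLp_of_hasCompactSupport hφc).restrict Ω
    have hi : ∀ {g}, MemLp g 2 (volume.restrict Ω) →
        Integrable (fun x => g x * φ x) (volume.restrict Ω) := fun hg => hg.integrable_mul hφL
    have e1 := h₁.2 φ ⟨hφ, hφc, hφs⟩
    have e2 := h₂.2 φ ⟨hφ, hφc, hφs⟩
    have e3 : ∫ x in Ω, (g₁ x * φ x - g₂ x * φ x) = 0 := by
      rw [integral_sub (hi h₁.1) (hi h₂.1)]; linarith
    rw [← e3, ← integral_indicator hΩ.measurableSet]
    congr 1 with x
    by_cases hx : x ∈ Ω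
    · rw [indicator_of_mem hx, smul_eq_mul]; ring
    · have : φ x = 0 := by
        by_contra h
        exact hx (hφs (subset_tsupport _ h))
      simp [hx, this]
  rw [EventuallyEq, ae_restrict_iff' hΩ.measurableSet]
  filter_upwards [h] with x hx hxΩ
  exact sub_eq_zero.1 (hx hxΩ)

lemma weakPartial_spec {i : Fin d} {u : Euc d → ℝ} (h : ∃ g, IsWeakPartial Ω i u g) :
    IsWeakPartial Ω i u (weakPartial Ω i u) := by
  rw [weakPartial, dif_pos h]; exact h.choose_spec

/-- The partial derivative of a Lipschitz function. -/
noncomputable def lipPartial (i : Fin d) (χ : Euc d → ℝ) (x : Euc d) : ℝ :=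
  lineDeriv ℝ χ x (EuclideanSpace.single i 1)

lemma abs_lipPartial_le {L : ℝ≥0} {χ : Euc d → ℝ} (hL : LipschitzWith L χ) (i : Fin d) (x : Euc d) :
    |lipPartial i χ x| ≤ L := by
  have := norm_lineDeriv_le_of_lipschitz ℝ hL (x₀ := x) (v := EuclideanSpace.single i 1)
  simpa [lipPartial] using this

lemma measurable_lipPartial {L : ℝ≥0} {χ : Euc d → ℝ} (hL : LipschitzWith L χ) (i : Fin d) :
    Measurable (lipPartial i χ) :=
  measurable_lineDeriv hL.continuous

lemma memLp_lipPartial (hb : Bornology.IsBounded Ω) {L : ℝ≥0} {χ : Euc d → ℝ}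
    (hL : LipschitzWith L χ) (i : Fin d) : MemLp (lipPartial i χ) 2 (volume.restrict Ω) := by
  have : IsFiniteMeasure (volume.restrict Ω) := ⟨by simpa using hb.measure_lt_top⟩
  exact MemLp.of_bound (measurable_lipPartial hL i).aestronglyMeasurable L
    (ae_of_all _ fun x => abs_lipPartial_le hL i x)

lemma setIntegral_eq_of_zero_off {f : Euc d → ℝ} (h : ∀ x, x ∉ Ω → f x = 0) :
    ∫ x in Ω, f x = ∫ x, f x :=
  setIntegral_eq_integral_of_forall_compl_eq_zero h

/-- Extension by zero keeps χ Lipschitz on the whole space, where integration by parts has no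
boundary term. -/
lemma isWeakPartial_lipPartial (hb : Bornology.IsBounded Ω) {L : ℝ≥0}
    {χ : Euc d → ℝ} (hL : LipschitzWith L χ) (h0 : ∀ x, x ∉ Ω → χ x = 0) (i : Fin d) :
    IsWeakPartial Ω i χ (lipPartial i χ) := by
  refine ⟨memLp_lipPartial hb hL i, fun φ hφ => ?_⟩
  obtain ⟨D, hD⟩ := hφ.1.lipschitzWith_of_hasCompactSupport hφ.2.1 (by simp)
  have h := hL.integral_lineDeriv_mul_eq (μ := volume) hD hφ.2.1 (EuclideanSpace.single i 1)
  rw [setIntegral_eq_of_zero_off fun x hx => by rw [h0 x hx, zero_mul],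
    setIntegral_eq_of_zero_off fun x hx => by
      have : φ x = 0 := by
        by_contra h
        exact hx (hφ.2.2 (subset_tsupport _ h))
      rw [this, mul_zero]]
  simp only [lipPartial]
  rw [h, ← integral_neg]
  congr 1 with x
  rw [(hφ.1.differentiable (by simp)).differentiableAt.lineDeriv_eq_fderiv, partialDeriv, map_neg]
  ring

lemma weakPartial_ae_eq_lipPartial (hΩ : IsOpen Ω) (hb : Bornology.IsBounded Ω) {L : ℝ≥0}
    {χ : Euc d → ℝ} (hL : LipschitzWith L χ) (h0 : ∀ x, x ∉ Ω → χ x = 0) (i : Fin d) :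
    weakPartial Ω i χ =ᵐ[volume.restrict Ω] lipPartial i χ :=
  isWeakPartial_unique hΩ (weakPartial_spec ⟨_, isWeakPartial_lipPartial hb hL h0 i⟩)
    (isWeakPartial_lipPartial hb hL h0 i)

end Sobolev

/-! ### Integration by parts against Lipschitz functions vanishing off Ω. -/

section Mollify
open Filter Topology
open scoped NNReal Convolution

variable {d : ℕ} {Ω : Set (Euc d)}

/-- A sequence of mollifiers. -/
noncomputable def bump (d : ℕ) (n : ℕ) : ContDiffBump (0 : Euc d) where
  rIn := 1 / (n + 1)
  rOut := 2 / (n + 1)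
  rIn_pos := by positivity
  rIn_lt_rOut := by gcongr; norm_num

lemma tendsto_bump_rOut (d : ℕ) : Tendsto (fun n => (bump d n).rOut) atTop (𝓝 0) := by
  have := (tendsto_one_div_add_atTop_nhds_zero_nat (𝕜 := ℝ)).const_mul 2
  rw [mul_zero] at this
  refine this.congr fun n => ?_
  simp only [bump]; ring

/-- The mollification of `f`. -/
noncomputable def mollify (n : ℕ) (f : Euc d → ℝ) (x : Euc d) : ℝ :=
  ∫ y, (bump d n).normed volume y * f (x - y)

lemma mollify_eq_convolution (n : ℕ) (f : Euc d → ℝ) :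
    mollify n f = ((bump d n).normed volume ⋆[ContinuousLinearMap.lsmul ℝ ℝ, volume] f) := by
  ext x; simp [mollify, convolution]

lemma abs_mollify_le {n : ℕ} {f : Euc d → ℝ} {C : ℝ} (hf : ∀ x, |f x| ≤ C) (x : Euc d) :
    |mollify n f x| ≤ C := by
  have h : ‖∫ y, (bump d n).normed volume y * f (x - y)‖ ≤
      ∫ y, (bump d n).normed volume y * C := by
    refine norm_integral_le_of_norm_le ((bump d n).integrable_normed.mul_const C)
      (ae_of_all _ fun y => ?_)
    rw [norm_mul, Real.norm_eq_abs, Real.norm_eq_abs, abs_of_nonneg ((bump d n).nonneg_normed y)]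
    exact mul_le_mul_of_nonneg_left (hf _) ((bump d n).nonneg_normed y)
  rwa [integral_mul_const, (bump d n).integral_normed, one_mul] at h

lemma contDiff_mollify (n : ℕ) {f : Euc d → ℝ} (hf : Continuous f) :
    ContDiff ℝ ∞ (mollify n f) := by
  rw [mollify_eq_convolution]
  exact (bump d n).hasCompactSupport_normed.contDiff_convolution_left _
    (bump d n).contDiff_normed hf.locallyIntegrable

lemma hasCompactSupport_mollify (n : ℕ) {f : Euc d → ℝ} (hf : HasCompactSupport f) :
    HasCompactSupport (mollify n f) := by
  rw [mollify_eq_convolution]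
  exact (bump d n).hasCompactSupport_normed.convolution _ hf

lemma eventually_tsupport_mollify_subset (hΩ : IsOpen Ω) {f : Euc d → ℝ}
    (hf : HasCompactSupport f) (hs : tsupport f ⊆ Ω) :
    ∀ᶠ n in atTop, tsupport (mollify n f) ⊆ Ω := by
  obtain ⟨δ, hδ, hδs⟩ := IsCompact.exists_cthickening_subset_open hf hΩ hs
  filter_upwards [(tendsto_bump_rOut d).eventually (gt_mem_nhds hδ)] with n hn
  refine Subset.trans (closure_minimal (fun x hx => ?_) Metric.isClosed_cthickening) hδs
  by_contra hcon
  refine hx (integral_eq_zero_of_ae (ae_of_all _ fun y => ?_))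
  simp only [Pi.zero_apply, mul_eq_zero]
  by_contra h
  rw [not_or] at h
  have h1 : y ∈ Metric.ball (0 : Euc d) (bump d n).rOut := by
    rw [← (bump d n).support_normed_eq (μ := volume)]; exact h.1
  have h2 : x - y ∈ tsupport f := subset_tsupport _ h.2
  refine hcon (Metric.mem_cthickening_of_dist_le x (x - y) δ _ h2 ?_)
  rw [dist_eq_norm, sub_sub_cancel]
  exact (mem_ball_zero_iff.1 h1).le.trans hn.le

/-- Differentiation under the integral: f is line differentiable almost everywhere, and the
difference quotients are dominated by L times the mollifier. -/
lemma partialDeriv_mollify (n : ℕ) {f : Euc d → ℝ} {L : ℝ≥0} (hL : LipschitzWith L f)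
    (i : Fin d) (x : Euc d) :
    partialDeriv i (mollify n f) x = mollify n (lipPartial i f) x := by
  set e : Euc d := EuclideanSpace.single i 1 with he
  have he1 : ‖e‖ = 1 := by simp [he]
  set ρ := (bump d n).normed (volume : Measure (Euc d)) with hρ
  have hρc : Continuous ρ := (bump d n).contDiff_normed (n := 0).continuous
  have hρi : Integrable ρ := (bump d n).integrable_normed
  have hρ0 : ∀ y, 0 ≤ ρ y := (bump d n).nonneg_normed
  have hae : ∀ᵐ y : Euc d, LineDifferentiableAt ℝ f (x - y) e :=
    (quasiMeasurePreserving_sub_left volume x).ae (hL.ae_lineDifferentiableAt e)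
  have h := (hasDerivAt_integral_of_dominated_loc_of_lip (μ := (volume : Measure (Euc d)))
    (F := fun (t : ℝ) y => ρ y * f (x - y + t • e)) (x₀ := 0) (s := univ)
    (F' := fun y => ρ y * lipPartial i f (x - y)) (bound := fun y => ρ y * L) univ_mem
    (Eventually.of_forall fun t =>
      (hρc.mul (hL.continuous.comp (by fun_prop))).aestronglyMeasurable) ?_ ?_ ?_
    (hρi.mul_const _) ?_).2
  · have hd : HasLineDerivAt ℝ (mollify n f) (∫ y, ρ y * lipPartial i f (x - y)) x e := by
      refine h.congr_of_eventuallyEq (Eventually.of_forall fun t => ?_)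
      simp only [mollify, ← hρ]
      congr 1 with y
      congr 2; abel
    rw [partialDeriv, ← ((contDiff_mollify n hL.continuous).differentiable
      (by simp)).differentiableAt.lineDeriv_eq_fderiv, hd.lineDeriv]
    rfl
  · refine (Continuous.integrable_of_hasCompactSupport ?_ ?_)
    · exact hρc.mul (hL.continuous.comp (by fun_prop))
    · exact (bump d n).hasCompactSupport_normed.mul_right
  · exact hρc.aestronglyMeasurable.mul
      ((measurable_lipPartial hL i).comp (measurable_const.sub measurable_id)).aestronglyMeasurable
  · refine ae_of_all _ fun y => LipschitzOnWith.of_dist_le_mul fun s _ t _ => ?_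
    rw [Real.dist_eq, ← mul_sub, abs_mul, abs_of_nonneg (hρ0 y)]
    have h1 : |f (x - y + s • e) - f (x - y + t • e)| ≤ L * |s - t| := by
      have := hL.dist_le_mul (x - y + s • e) (x - y + t • e)
      rw [Real.dist_eq, dist_eq_norm, add_sub_add_left_eq_sub, ← sub_smul, norm_smul, he1,
        mul_one] at this
      exact this
    rw [Real.dist_eq, Real.coe_nnabs, abs_of_nonneg (mul_nonneg (hρ0 y) L.coe_nonneg), mul_assoc]
    exact mul_le_mul_of_nonneg_left h1 (hρ0 y)
  · filter_upwards [hae] with y hy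
    exact hy.hasLineDerivAt.const_mul (ρ y)

/-- Integration by parts against a Lipschitz function with compact support in `Ω`. -/
lemma IsWeakPartial.integral_lipPartial_of_tsupport (hΩ : IsOpen Ω) (hb : Bornology.IsBounded Ω)
    {i : Fin d} {w g : Euc d → ℝ} (hw : MemLp w 2 (volume.restrict Ω)) (hg : IsWeakPartial Ω i w g)
    {f : Euc d → ℝ} {L : ℝ≥0} (hL : LipschitzWith L f) (hf : HasCompactSupport f)
    (hs : tsupport f ⊆ Ω) :
    ∫ x in Ω, w x * lipPartial i f x = -∫ x in Ω, g x * f x := by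
  have : IsFiniteMeasure (volume.restrict Ω) := ⟨by simpa using hb.measure_lt_top⟩
  obtain ⟨C, hC⟩ := hf.exists_bound_of_continuous hL.continuous
  have hev := eventually_tsupport_mollify_subset hΩ hf hs
  -- For large n the mollified f is a test function; both sides then pass to the limit by dominated
  -- convergence.
  have heq : ∀ᶠ n in atTop, ∫ x in Ω, w x * mollify n (lipPartial i f) x =
      -∫ x in Ω, g x * mollify n f x := by
    filter_upwards [hev] with n hn
    rw [← hg.2 _ ⟨contDiff_mollify n hL.continuous, hasCompactSupport_mollify n hf, hn⟩]
    simp only [partialDeriv_mollify n hL]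
  -- A bounded ratio of the radii is what the almost everywhere convergence of mollified bounded
  -- functions requires.
  have hK : ∀ n, (bump d n).rOut ≤ 2 * (bump d n).rIn := fun n => by
    simp only [bump]; rw [mul_one_div]
  have hmeas : ∀ (n : ℕ) (h : Euc d → ℝ), Measurable h → AEStronglyMeasurable (mollify n h)
      (volume.restrict Ω) := by
    intro n h hh
    have : Measurable fun p : Euc d × Euc d => (bump d n).normed volume p.2 * h (p.1 - p.2) :=
      (((bump d n).contDiff_normed (n := 0)).continuous.measurable.comp measurable_snd).mul
        (hh.comp (measurable_fst.sub measurable_snd))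
    exact (this.stronglyMeasurable.integral_prod_right').aestronglyMeasurable
  have h1 : Tendsto (fun n => ∫ x in Ω, w x * mollify n (lipPartial i f) x) atTop
      (𝓝 (∫ x in Ω, w x * lipPartial i f x)) := by
    refine tendsto_integral_of_dominated_convergence (fun x => ‖w x‖ * L)
      (fun n => hw.1.mul (hmeas n _ (measurable_lipPartial hL i)))
      ((hw.integrable one_le_two).norm.mul_const _) (fun n => ae_of_all _ fun x => ?_) ?_
    · rw [norm_mul]
      exact mul_le_mul_of_nonneg_left (abs_mollify_le (abs_lipPartial_le hL i) x) (norm_nonneg _)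
    · have := ContDiffBump.ae_convolution_tendsto_right_of_locallyIntegrable
        (tendsto_bump_rOut d) (Eventually.of_forall hK)
        (hL.locallyIntegrable_lineDeriv (μ := volume) (EuclideanSpace.single i 1))
      refine ae_restrict_of_ae ?_
      filter_upwards [this] with x hx
      refine Tendsto.const_mul _ (hx.congr fun n => ?_)
      rw [← mollify_eq_convolution]; rfl
  have h2 : Tendsto (fun n => ∫ x in Ω, g x * mollify n f x) atTop (𝓝 (∫ x in Ω, g x * f x)) := by
    refine tendsto_integral_of_dominated_convergence (fun x => ‖g x‖ * C)
      (fun n => hg.1.1.mul (hmeas n _ hL.continuous.measurable))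
      ((hg.1.integrable one_le_two).norm.mul_const _) (fun n => ae_of_all _ fun x => ?_) ?_
    · rw [norm_mul]
      exact mul_le_mul_of_nonneg_left (abs_mollify_le hC x) (norm_nonneg _)
    · refine ae_of_all _ fun x => Tendsto.const_mul _ ?_
      have := ContDiffBump.convolution_tendsto_right_of_continuous (μ := (volume : Measure (Euc d)))
        (tendsto_bump_rOut d) hL.continuous x
      exact this.congr fun n => by rw [← mollify_eq_convolution]
  exact tendsto_nhds_unique (h1.congr' heq) h2.neg

/-- Soft thresholding. -/
noncomputable def softThreshold (ε a : ℝ) : ℝ := a - max (-ε) (min a ε)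

/-- Thresholding a Lipschitz f that vanishes off Ω therefore keeps its Lipschitz constant, while the
support moves into the closed subset {ε ≤ |f|} of Ω. -/
lemma abs_softThreshold_sub_le (ε a b : ℝ) :
    |softThreshold ε a - softThreshold ε b| ≤ |a - b| := by
  simp only [softThreshold]
  rcases max_cases (-ε) (min a ε) with h | h <;> rcases min_cases a ε with h' | h' <;>
  rcases max_cases (-ε) (min b ε) with k | k <;> rcases min_cases b ε with k' | k' <;>
  rcases abs_cases (a - b) with l | l <;>
  rw [h.1, k.1, abs_le] <;> constructor <;> linarith

lemma softThreshold_of_abs_le {ε a : ℝ} (h : |a| ≤ ε) : softThreshold ε a = 0 := by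
  rw [abs_le] at h
  rw [softThreshold, min_eq_left h.2, max_eq_right h.1, sub_self]

lemma softThreshold_of_le {ε a : ℝ} (hε : 0 ≤ ε) (h : ε ≤ a) : softThreshold ε a = a - ε := by
  rw [softThreshold, min_eq_right h, max_eq_right (by linarith)]

lemma softThreshold_of_le_neg {ε a : ℝ} (hε : 0 ≤ ε) (h : a ≤ -ε) :
    softThreshold ε a = a + ε := by
  rw [softThreshold, min_eq_left (by linarith), max_eq_left h]; ring

lemma abs_softThreshold_le {ε : ℝ} (hε : 0 ≤ ε) (a : ℝ) : |softThreshold ε a| ≤ |a| := by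
  have := abs_softThreshold_sub_le ε a 0
  rwa [softThreshold_of_abs_le (a := 0) (by simpa using hε), sub_zero, sub_zero] at this

lemma abs_softThreshold_sub_self_le {ε : ℝ} (hε : 0 ≤ ε) (a : ℝ) : |softThreshold ε a - a| ≤ ε := by
  rw [softThreshold, sub_sub_cancel_left, abs_neg, abs_le]
  exact ⟨le_max_left _ _, max_le (by linarith) (min_le_right _ _)⟩

lemma LipschitzWith.softThreshold_comp {f : Euc d → ℝ} {L : ℝ≥0} (hL : LipschitzWith L f) (ε : ℝ) :
    LipschitzWith L fun x => softThreshold ε (f x) :=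
  LipschitzWith.of_dist_le_mul fun x y => by
    rw [Real.dist_eq]
    exact (abs_softThreshold_sub_le ε _ _).trans (hL.dist_le_mul x y)

/-- The gradient of a Lipschitz function vanishes almost everywhere on its zero set. -/
lemma ae_lipPartial_eq_zero_of_zero {f : Euc d → ℝ} {L : ℝ≥0} (hL : LipschitzWith L f) (i : Fin d) :
    ∀ᵐ x : Euc d, f x = 0 → lipPartial i f x = 0 := by
  -- Almost everywhere |f| is differentiable in direction i. A zero of f is a minimum of |f|, so
  -- there the derivative of |f| vanishes, and with it that of f.
  have hA : LipschitzWith L fun x => |f x| := LipschitzWith.of_dist_le_mul fun x y => by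
    rw [Real.dist_eq]
    exact (abs_abs_sub_abs_le _ _).trans (hL.dist_le_mul x y)
  filter_upwards [hA.ae_lineDifferentiableAt (EuclideanSpace.single i 1)] with x hx h0
  set e : Euc d := EuclideanSpace.single i 1
  have h1 : HasDerivAt (fun t : ℝ => |f (x + t • e)|) (lineDeriv ℝ (fun x => |f x|) x e) 0 :=
    hx.hasLineDerivAt
  have hmin : IsLocalMin (fun t : ℝ => |f (x + t • e)|) 0 :=
    Eventually.of_forall fun t => by simp [h0]
  rw [hmin.hasDerivAt_eq_zero h1] at h1
  have h2 : HasDerivAt (fun t : ℝ => f (x + t • e)) 0 0 := by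
    rw [hasDerivAt_iff_isLittleO] at h1 ⊢
    refine (Asymptotics.isLittleO_norm_left.1 (h1.congr_left fun t => ?_))
    simp [h0]
  exact HasLineDerivAt.lineDeriv h2

lemma lipPartial_softThreshold_of_ne {f : Euc d → ℝ} (hf : Continuous f) (i : Fin d) {x : Euc d}
    (hx : f x ≠ 0) {ε : ℝ} (hε0 : 0 ≤ ε) (hε : ε < |f x|) :
    lipPartial i (fun x => softThreshold ε (f x)) x = lipPartial i f x := by
  rcases lt_or_gt_of_ne hx with h | h
  · rw [abs_of_neg h] at hε
    have : (fun x => softThreshold ε (f x)) =ᶠ[𝓝 x] fun x => f x + ε := by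
      filter_upwards [hf.continuousAt.eventually (gt_mem_nhds (by linarith : f x < -ε))] with y hy
      exact softThreshold_of_le_neg hε0 hy.le
    rw [lipPartial, this.lineDeriv_eq, lipPartial, lineDeriv, lineDeriv, deriv_add_const]
  · rw [abs_of_pos h] at hε
    have : (fun x => softThreshold ε (f x)) =ᶠ[𝓝 x] fun x => f x - ε := by
      filter_upwards [hf.continuousAt.eventually (lt_mem_nhds hε)] with y hy
      exact softThreshold_of_le hε0 hy.le
    rw [lipPartial, this.lineDeriv_eq, lipPartial, lineDeriv, lineDeriv, deriv_sub_const]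

lemma lipPartial_softThreshold_of_eq {f : Euc d → ℝ} (hf : Continuous f) (i : Fin d) {x : Euc d}
    (hx : f x = 0) {ε : ℝ} (hε : 0 < ε) :
    lipPartial i (fun x => softThreshold ε (f x)) x = 0 := by
  have : (fun x => softThreshold ε (f x)) =ᶠ[𝓝 x] fun _ => (0 : ℝ) := by
    filter_upwards [hf.abs.continuousAt.eventually (gt_mem_nhds (by simpa [hx] using hε))] with y hy
    exact softThreshold_of_abs_le hy.le
  rw [lipPartial, this.lineDeriv_eq]
  simp [lineDeriv]

/-- Integration by parts against a Lipschitz function that vanishes outside `Ω`. -/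
theorem IsWeakPartial.integral_lipPartial (hΩ : IsOpen Ω) (hb : Bornology.IsBounded Ω)
    {i : Fin d} {w g : Euc d → ℝ} (hw : MemLp w 2 (volume.restrict Ω)) (hg : IsWeakPartial Ω i w g)
    {f : Euc d → ℝ} {L : ℝ≥0} (hL : LipschitzWith L f) (h0 : ∀ x, x ∉ Ω → f x = 0) :
    ∫ x in Ω, w x * lipPartial i f x = -∫ x in Ω, g x * f x := by
  have : IsFiniteMeasure (volume.restrict Ω) := ⟨by simpa using hb.measure_lt_top⟩
  set ε : ℕ → ℝ := fun n => 1 / (n + 1) with hε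
  have hε0 : ∀ n, 0 < ε n := fun n => by positivity
  have hεt : Tendsto ε atTop (𝓝 0) := tendsto_one_div_add_atTop_nhds_zero_nat
  obtain ⟨C, hC⟩ := (hasCompactSupport_of_zero_off hb h0).exists_bound_of_continuous hL.continuous
  have heq : ∀ n, ∫ x in Ω, w x * lipPartial i (fun x => softThreshold (ε n) (f x)) x =
      -∫ x in Ω, g x * softThreshold (ε n) (f x) := by
    intro n
    have hcl : IsClosed {x | ε n ≤ |f x|} := isClosed_le continuous_const hL.continuous.abs
    have hsub : {x | ε n ≤ |f x|} ⊆ Ω := fun x hx => by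
      by_contra h
      have : ε n ≤ |f x| := hx
      rw [h0 x h, abs_zero] at this
      exact absurd (hε0 n) this.not_gt
    have hts : tsupport (fun x => softThreshold (ε n) (f x)) ⊆ {x | ε n ≤ |f x|} := by
      refine closure_minimal (fun x hx => ?_) hcl
      by_contra h
      exact hx (softThreshold_of_abs_le (not_le.1 h).le)
    exact hg.integral_lipPartial_of_tsupport hΩ hb hw (LipschitzWith.softThreshold_comp hL _)
      (hb.isCompact_closure.of_isClosed_subset (isClosed_tsupport _)
        (hts.trans (hsub.trans subset_closure))) (hts.trans hsub)
  -- As ε tends to 0 the derivatives converge almost everywhere: where f ≠ 0 they eventually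
  -- coincide, and where f = 0 all of them vanish almost everywhere.
  have h1 : Tendsto (fun n => ∫ x in Ω, w x * lipPartial i (fun x => softThreshold (ε n) (f x)) x)
      atTop (𝓝 (∫ x in Ω, w x * lipPartial i f x)) := by
    refine tendsto_integral_of_dominated_convergence (fun x => ‖w x‖ * L)
      (fun n => hw.1.mul
        (measurable_lipPartial (LipschitzWith.softThreshold_comp hL _) i).aestronglyMeasurable)
      ((hw.integrable one_le_two).norm.mul_const _) (fun n => ae_of_all _ fun x => ?_) ?_
    · rw [norm_mul]
      exact mul_le_mul_of_nonneg_left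
        (abs_lipPartial_le (LipschitzWith.softThreshold_comp hL _) i x) (norm_nonneg _)
    · refine ae_restrict_of_ae ?_
      filter_upwards [ae_lipPartial_eq_zero_of_zero hL i] with x hx
      refine Tendsto.const_mul _ ?_
      by_cases hfx : f x = 0
      · rw [hx hfx]
        exact tendsto_const_nhds.congr fun n =>
          (lipPartial_softThreshold_of_eq hL.continuous i hfx (hε0 n)).symm
      · refine tendsto_const_nhds.congr' ?_
        filter_upwards [hεt.eventually (gt_mem_nhds (abs_pos.2 hfx))] with n hn
        exact (lipPartial_softThreshold_of_ne hL.continuous i hfx (hε0 n).le hn).symm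
  have h2 : Tendsto (fun n => ∫ x in Ω, g x * softThreshold (ε n) (f x)) atTop
      (𝓝 (∫ x in Ω, g x * f x)) := by
    refine tendsto_integral_of_dominated_convergence (fun x => ‖g x‖ * C)
      (fun n => hg.1.1.mul
        (LipschitzWith.softThreshold_comp hL _).continuous.aestronglyMeasurable)
      ((hg.1.integrable one_le_two).norm.mul_const _) (fun n => ae_of_all _ fun x => ?_) ?_
    · rw [norm_mul]
      exact mul_le_mul_of_nonneg_left
        ((abs_softThreshold_le (hε0 n).le _).trans (hC x)) (norm_nonneg _)
    · refine ae_of_all _ fun x => Tendsto.const_mul _ ?_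
      rw [tendsto_iff_norm_sub_tendsto_zero]
      exact squeeze_zero (fun _ => norm_nonneg _)
        (fun n => abs_softThreshold_sub_self_le (hε0 n).le _) hεt
  exact tendsto_nhds_unique (h1.congr heq) h2.neg

/-- A Lipschitz function that vanishes outside the bounded set `Ω` and whose gradient vanishes
almost everywhere in `Ω` is zero. -/
lemma eq_zero_of_lipPartial_eq_zero (hb : Bornology.IsBounded Ω) {f : Euc d → ℝ}
    {L : ℝ≥0} (hL : LipschitzWith L f) (h0 : ∀ x, x ∉ Ω → f x = 0) (i : Fin d)
    (h : lipPartial i f =ᵐ[volume.restrict Ω] 0) (hΩ : IsOpen Ω) : f = 0 := by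
  have hfc := hasCompactSupport_of_zero_off hb h0
  obtain ⟨C, hC⟩ := hfc.exists_bound_of_continuous hL.continuous
  have hC0 : 0 ≤ C := (norm_nonneg _).trans (hC 0)
  -- Integrating ∂_i(x_i) f² by parts gives ∫ f² = -∫ x_i ∂_i(f²) = 0.
  set q : Euc d → ℝ := fun x => f x * f x with hq
  have hqL : LipschitzWith ((2 * C).toNNReal * L) q := by
    refine LipschitzWith.of_dist_le_mul fun x y => ?_
    have h1 := hL.dist_le_mul x y
    rw [Real.dist_eq] at h1 ⊢
    simp only [hq]
    rw [NNReal.coe_mul, Real.coe_toNNReal _ (by positivity), mul_self_sub_mul_self, abs_mul, mul_assoc]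
    refine mul_le_mul ?_ h1 (abs_nonneg _) (by positivity)
    have := hC x
    have := hC y
    simp only [Real.norm_eq_abs] at *
    linarith [abs_add_le (f x) (f y)]
  have hqc : HasCompactSupport q := hfc.mul_left
  set e : Euc d := EuclideanSpace.single i 1 with he
  have hcoord : LipschitzWith 1 fun x : Euc d => x i := LipschitzWith.of_dist_le_mul fun x y => by
    rw [Real.dist_eq, dist_eq_norm]
    have := EuclideanSpace.norm_eq (x - y)
    simpa using PiLp.norm_apply_le (x - y) i
  have hparts := hcoord.integral_lineDeriv_mul_eq (μ := volume) hqL hqc e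
  have hld : ∀ x : Euc d, lineDeriv ℝ (fun x : Euc d => x i) x e = 1 := by
    intro x
    have : HasLineDerivAt ℝ (fun x : Euc d => x i) 1 x e := by
      have h2 : HasDerivAt (fun t : ℝ => x i + t * 1) 1 0 := by
        simpa using (hasDerivAt_id (0 : ℝ)).const_add (x i)
      refine h2.congr_of_eventuallyEq (Eventually.of_forall fun t => ?_)
      simp [he]
    exact this.lineDeriv
  have hq0 : ∀ᵐ x : Euc d, lineDeriv ℝ q x (-e) = 0 := by
    have h' := (ae_restrict_iff' hΩ.measurableSet).1 h
    filter_upwards [hL.ae_lineDifferentiableAt e, h'] with x hx hx'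
    have h2 : HasLineDerivAt ℝ f (lipPartial i f x) x e := hx.hasLineDerivAt
    have h3 : HasLineDerivAt ℝ q (lipPartial i f x * f (x + (0 : ℝ) • e) +
        f (x + (0 : ℝ) • e) * lipPartial i f x) x e := HasDerivAt.mul h2 h2
    rw [lineDeriv_neg, h3.lineDeriv, zero_smul, add_zero]
    by_cases hxΩ : x ∈ Ω
    · rw [hx' hxΩ]; simp
    · rw [h0 x hxΩ]; simp
  have hint : ∫ x, q x = 0 := by
    simp only [hld, one_mul] at hparts
    rw [hparts]
    refine integral_eq_zero_of_ae ?_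
    filter_upwards [hq0] with x hx
    simp [hx]
  have hqcont : Continuous q := hL.continuous.mul hL.continuous
  funext x
  by_contra hx
  exact (hqcont.integral_pos_of_hasCompactSupport_nonneg_nonzero (μ := volume) hqc
    (fun x => mul_self_nonneg (f x)) (x := x) (mul_self_ne_zero.2 hx)).ne' hint

end Mollify

/-! ### Diagonalization of the Dirichlet form on the finite element space. -/

section Spectral
open Filter Topology
open scoped NNReal

/-- Simultaneous diagonalization of an inner product and a symmetric bilinear form on a finite
dimensional space that is embedded in an inner product space. -/
lemma exists_eigenbasis {X H : Type*} [AddCommGroup X] [Module ℝ X] [FiniteDimensional ℝ X]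
    [NormedAddCommGroup H] [InnerProductSpace ℝ H] (J : X →ₗ[ℝ] H) (hJ : Function.Injective J)
    (a : X →ₗ[ℝ] X →ₗ[ℝ] ℝ) (ha : ∀ x y, a x y = a y x) :
    ∃ (n : ℕ) (e : Fin n → X) (lam : Fin n → ℝ), Orthonormal ℝ (fun i => J (e i)) ∧
      (∀ x, ∑ i, inner ℝ (J (e i)) (J x) • e i = x) ∧
      ∀ i x, a (e i) x = lam i * inner ℝ (J (e i)) (J x) := by
  set S := LinearMap.range J
  have : FiniteDimensional ℝ S := inferInstance
  set φ : X ≃ₗ[ℝ] S := LinearEquiv.ofInjective J hJ with hφ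
  have hφJ : ∀ x, ((φ x : S) : H) = J x := fun x => rfl
  set B : S →ₗ[ℝ] S →ₗ[ℝ] ℝ := a.compl₁₂ φ.symm.toLinearMap φ.symm.toLinearMap with hB
  have hBs : ∀ x y, B x y = B y x := fun x y => ha _ _
  set b := stdOrthonormalBasis ℝ S
  set A : S →ₗ[ℝ] S := ∑ k, (B.flip (b k)).smulRight (b k) with hA
  have hAi : ∀ x y, inner ℝ (A x) y = B x y := by
    intro x y
    simp only [hA, LinearMap.sum_apply, LinearMap.smulRight_apply, LinearMap.flip_apply, sum_inner,
      real_inner_smul_left]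
    conv_rhs => rw [← b.sum_repr' y]
    simp only [map_sum, map_smul, smul_eq_mul]
    exact Finset.sum_congr rfl fun k _ => mul_comm _ _
  have hsym : A.IsSymmetric := fun x y => by
    rw [hAi, real_inner_comm, hAi, hBs]
  set c := hsym.eigenvectorBasis rfl with hc
  refine ⟨_, fun i => φ.symm (c i), fun i => hsym.eigenvalues rfl i, ?_, fun x => ?_, fun i x => ?_⟩
  · have h1 : (fun i => J (φ.symm (c i))) = fun i => ((c i : S) : H) := by
      ext i; rw [← hφJ, φ.apply_symm_apply]
    rw [h1]
    exact c.orthonormal.comp_linearIsometry S.subtypeₗᵢ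
  · apply φ.injective
    simp only [map_sum, map_smul, φ.apply_symm_apply]
    conv_rhs => rw [← c.sum_repr' (φ x)]
    refine Finset.sum_congr rfl fun i _ => ?_
    congr 1
    rw [← hφJ, ← hφJ, φ.apply_symm_apply]
    rfl
  · have h1 : a (φ.symm (c i)) x = B (c i) (φ x) := by simp [hB]
    have h2 : inner ℝ (J (φ.symm (c i))) (J x) = inner ℝ (c i) (φ x) := by
      rw [← hφJ, ← hφJ, φ.apply_symm_apply]
      rfl
    rw [h1, h2, ← hAi, hc, hsym.apply_eigenvectorBasis]
    exact real_inner_smul_left _ _ _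

variable {d : ℕ} {Ω : Set (Euc d)} {K : Geometry.SimplicialComplex ℝ (Euc d)}

/-- The finite element space as a space of functions. -/
def femSpace (Ω : Set (Euc d)) (K : Geometry.SimplicialComplex ℝ (Euc d)) :
    Submodule ℝ (Euc d → ℝ) where
  carrier := {χ | MemFEM Ω K χ}
  add_mem' := by
    intro χ ψ hχ hψ
    refine ⟨hχ.1.add hψ.1, fun x hx => by simp [hχ.2.1 x hx, hψ.2.1 x hx], fun s hs => ?_⟩
    obtain ⟨l, hl⟩ := hχ.2.2 s hs
    obtain ⟨k, hk⟩ := hψ.2.2 s hs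
    exact ⟨l + k, fun x hx => by simp [hl hx, hk hx]⟩
  zero_mem' := ⟨continuous_const, fun _ _ => rfl, fun _ _ => ⟨0, fun _ _ => rfl⟩⟩
  smul_mem' := by
    intro c χ hχ
    refine ⟨hχ.1.const_smul c, fun x hx => by simp [hχ.2.1 x hx], fun s hs => ?_⟩
    obtain ⟨l, hl⟩ := hχ.2.2 s hs
    exact ⟨c • l, fun x hx => by simp [hl hx]⟩

/-- The vertices of a triangulation. -/
def vertexSet (K : Geometry.SimplicialComplex ℝ (Euc d)) : Set (Euc d) :=
  ⋃ s ∈ K.faces, (s : Set (Euc d))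

lemma finite_vertexSet (hK : IsTriangulation Ω K) : (vertexSet K).Finite :=
  hK.1.biUnion fun s _ => s.finite_toSet

/-- Evaluation of finite element functions at the vertices. -/
def vertexEval (Ω : Set (Euc d)) (K : Geometry.SimplicialComplex ℝ (Euc d)) :
    femSpace Ω K →ₗ[ℝ] (vertexSet K → ℝ) where
  toFun χ p := (χ : Euc d → ℝ) p
  map_add' _ _ := rfl
  map_smul' _ _ := rfl

/-- An affine function vanishing at the vertices of a simplex vanishes on their convex hull. Finite
dimensionality follows, and functionals become combinations of point values. -/
lemma vertexEval_injective (hK : IsTriangulation Ω K) : Function.Injective (vertexEval Ω K) := by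
  rw [injective_iff_map_eq_zero]
  intro χ hχ0
  have hχ : MemFEM Ω K χ := χ.2
  ext x
  by_cases hx : x ∈ Ω
  · have hxs : x ∈ K.space := by rw [hK.2]; exact subset_closure hx
    obtain ⟨s, hs, hxs⟩ := Geometry.SimplicialComplex.mem_space_iff.1 hxs
    obtain ⟨l, hl⟩ := hχ.2.2 s hs
    have hconv : Convex ℝ (l ⁻¹' {0}) := (convex_singleton 0).affine_preimage l
    have hsub : convexHull ℝ (s : Set (Euc d)) ⊆ l ⁻¹' {0} := by
      refine convexHull_min (fun p hp => ?_) hconv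
      have h1 : (χ : Euc d → ℝ) p = 0 :=
        congrFun hχ0 ⟨p, mem_biUnion (by exact hs) hp⟩
      rw [hl (subset_convexHull ℝ _ hp)] at h1
      exact h1
    rw [hl hxs]
    exact hsub hxs
  · exact hχ.2.1 x hx

lemma finiteDimensional_femSpace (hK : IsTriangulation Ω K) :
    FiniteDimensional ℝ (femSpace Ω K) := by
  have := (finite_vertexSet hK).to_subtype
  exact FiniteDimensional.of_injective _ (vertexEval_injective hK)

lemma MemFEM.memLp (hb : Bornology.IsBounded Ω) {χ : Euc d → ℝ} (hχ : MemFEM Ω K χ) :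
    MemLp χ 2 (volume.restrict Ω) :=
  (hχ.1.memLp_of_hasCompactSupport (hasCompactSupport_of_zero_off hb hχ.2.1)).restrict Ω

/-- The embedding of the finite element space in `L²(Ω)`. -/
noncomputable def femToLp (hb : Bornology.IsBounded Ω)
    (K : Geometry.SimplicialComplex ℝ (Euc d)) :
    femSpace Ω K →ₗ[ℝ] Lp ℝ 2 (volume.restrict Ω) where
  toFun χ := (MemFEM.memLp hb χ.2).toLp χ
  map_add' _ _ := rfl
  map_smul' _ _ := rfl

lemma femToLp_injective (hΩ : IsOpen Ω) (hb : Bornology.IsBounded Ω) :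
    Function.Injective (femToLp hb K) := by
  rw [injective_iff_map_eq_zero]
  intro χ h
  have hχ : MemFEM Ω K χ := χ.2
  have h1 : (χ : Euc d → ℝ) =ᵐ[volume.restrict Ω] fun _ => 0 := by
    have hmem : MemLp (χ : Euc d → ℝ) 2 (volume.restrict Ω) := hχ.memLp hb
    have h2 := hmem.coeFn_toLp
    have h3 : hmem.toLp (χ : Euc d → ℝ) = 0 := h
    rw [h3] at h2
    exact h2.symm.trans (Lp.coeFn_zero _ _ _)
  have h4 := Measure.eqOn_open_of_ae_eq h1 hΩ hχ.1.continuousOn continuousOn_const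
  ext x
  by_cases hx : x ∈ Ω
  · exact h4 hx
  · exact hχ.2.1 x hx

lemma inner_toLp {f g : Euc d → ℝ} (hf : MemLp f 2 (volume.restrict Ω))
    (hg : MemLp g 2 (volume.restrict Ω)) : inner ℝ (hf.toLp f) (hg.toLp g) = l2Inner Ω f g := by
  rw [L2.inner_def, l2Inner]
  refine integral_congr_ae ?_
  filter_upwards [hf.coeFn_toLp, hg.coeFn_toLp] with x h1 h2
  rw [h1, h2]
  simp [mul_comm]

lemma norm_toLp_eq_l2Norm {f : Euc d → ℝ} (hf : MemLp f 2 (volume.restrict Ω)) :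
    ‖hf.toLp f‖ = l2Norm Ω f := Lp.norm_toLp f hf

/-- The partial derivatives of finite element functions. -/
noncomputable def femPartial (hΩ : IsOpen Ω) (hb : Bornology.IsBounded Ω)
    (hK : IsTriangulation Ω K) (i : Fin d) :
    femSpace Ω K →ₗ[ℝ] Lp ℝ 2 (volume.restrict Ω) where
  toFun χ := (memLp_lipPartial hb (MemFEM.exists_lipschitzWith hΩ hK χ.2).choose_spec i).toLp _
  map_add' χ ψ := by
    obtain ⟨L, hL⟩ := MemFEM.exists_lipschitzWith hΩ hK χ.2
    obtain ⟨M, hM⟩ := MemFEM.exists_lipschitzWith hΩ hK ψ.2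
    rw [← MemLp.toLp_add]
    -- Line derivatives add only where both exist, that is almost everywhere; as L² classes they
    -- depend linearly on the function.
    refine MemLp.toLp_congr _ _ (ae_restrict_of_ae ?_)
    filter_upwards [hL.ae_lineDifferentiableAt (EuclideanSpace.single i 1),
      hM.ae_lineDifferentiableAt (EuclideanSpace.single i 1)] with x h1 h2
    have h3 : HasLineDerivAt ℝ ((χ : Euc d → ℝ) + (ψ : Euc d → ℝ))
        (lineDeriv ℝ (χ : Euc d → ℝ) x (EuclideanSpace.single i 1) +
          lineDeriv ℝ (ψ : Euc d → ℝ) x (EuclideanSpace.single i 1)) x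
        (EuclideanSpace.single i 1) := HasDerivAt.add h1.hasLineDerivAt h2.hasLineDerivAt
    exact h3.lineDeriv
  map_smul' c χ := by
    obtain ⟨L, hL⟩ := MemFEM.exists_lipschitzWith hΩ hK χ.2
    rw [RingHom.id_apply, ← MemLp.toLp_const_smul]
    refine MemLp.toLp_congr _ _ (ae_restrict_of_ae ?_)
    filter_upwards [hL.ae_lineDifferentiableAt (EuclideanSpace.single i 1)] with x h1
    have h3 : HasLineDerivAt ℝ (c • (χ : Euc d → ℝ))
        (c * lineDeriv ℝ (χ : Euc d → ℝ) x (EuclideanSpace.single i 1)) x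
        (EuclideanSpace.single i 1) := HasDerivAt.const_mul c h1.hasLineDerivAt
    exact h3.lineDeriv

/-- The Dirichlet form on the finite element space. -/
noncomputable def femForm (hΩ : IsOpen Ω) (hb : Bornology.IsBounded Ω)
    (hK : IsTriangulation Ω K) : femSpace Ω K →ₗ[ℝ] femSpace Ω K →ₗ[ℝ] ℝ :=
  ∑ i, (innerₗ (Lp ℝ 2 (volume.restrict Ω))).compl₁₂ (femPartial hΩ hb hK i) (femPartial hΩ hb hK i)

lemma femForm_apply (hΩ : IsOpen Ω) (hb : Bornology.IsBounded Ω) (hK : IsTriangulation Ω K)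
    (χ ψ : femSpace Ω K) : femForm hΩ hb hK χ ψ =
      ∑ i, inner ℝ (femPartial hΩ hb hK i χ) (femPartial hΩ hb hK i ψ) := by
  simp [femForm, LinearMap.sum_apply]

lemma femForm_eq_dirichletForm (hΩ : IsOpen Ω) (hb : Bornology.IsBounded Ω)
    (hK : IsTriangulation Ω K) (χ ψ : femSpace Ω K) :
    femForm hΩ hb hK χ ψ = dirichletForm Ω χ ψ := by
  rw [femForm_apply, dirichletForm]
  refine Finset.sum_congr rfl fun i _ => ?_
  simp only [femPartial, LinearMap.coe_mk, AddHom.coe_mk]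
  rw [inner_toLp, l2Inner, l2Inner]
  refine integral_congr_ae ?_
  obtain ⟨L, hL⟩ := MemFEM.exists_lipschitzWith hΩ hK χ.2
  obtain ⟨M, hM⟩ := MemFEM.exists_lipschitzWith hΩ hK ψ.2
  filter_upwards [weakPartial_ae_eq_lipPartial hΩ hb hL χ.2.2.1 i,
    weakPartial_ae_eq_lipPartial hΩ hb hM ψ.2.2.1 i] with x h1 h2
  rw [h1, h2]

/-- A single vanishing partial derivative suffices; d ≥ 1 provides the index 0. This makes the
eigenvalues positive. -/
lemma eq_zero_of_femForm_self (hd : 1 ≤ d) (hΩ : IsOpen Ω) (hb : Bornology.IsBounded Ω)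
    (hK : IsTriangulation Ω K) {χ : femSpace Ω K} (h : femForm hΩ hb hK χ χ = 0) : χ = 0 := by
  rw [femForm_apply, Finset.sum_eq_zero_iff_of_nonneg fun _ _ => real_inner_self_nonneg] at h
  have h1 := h ⟨0, hd⟩ (Finset.mem_univ _)
  rw [inner_self_eq_zero] at h1
  obtain ⟨L, hL⟩ := MemFEM.exists_lipschitzWith hΩ hK χ.2
  have h2 : lipPartial ⟨0, hd⟩ χ =ᵐ[volume.restrict Ω] 0 := by
    have h3 := MemLp.coeFn_toLp (memLp_lipPartial hb
      (MemFEM.exists_lipschitzWith hΩ hK χ.2).choose_spec ⟨0, hd⟩)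
    simp only [femPartial, LinearMap.coe_mk, AddHom.coe_mk] at h1
    rw [h1] at h3
    exact h3.symm.trans (Lp.coeFn_zero _ _ _)
  exact Subtype.ext (eq_zero_of_lipPartial_eq_zero hb hL χ.2.2.1 _ h2 hΩ)

lemma memLp_opA {v : Euc d → ℝ} (hv : MemDomA Ω v) : MemLp (opA Ω v) 2 (volume.restrict Ω) := by
  have h : ∀ i ∈ Finset.univ, MemLp (weakPartial Ω i (weakPartial Ω i v)) 2 (volume.restrict Ω) :=
    fun i _ => (weakPartial_spec ((hv.2.2 i).2 i)).1
  exact (memLp_finsetSum _ h).neg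

/-- Green's formula `(∇v, ∇χ) = (A v, χ)` for finite element functions `χ`. -/
lemma dirichletForm_eq_l2Inner_opA (hΩ : IsOpen Ω) (hb : Bornology.IsBounded Ω)
    (hK : IsTriangulation Ω K) {v χ : Euc d → ℝ} (hv : MemDomA Ω v) (hχ : MemFEM Ω K χ) :
    dirichletForm Ω v χ = l2Inner Ω (opA Ω v) χ := by
  obtain ⟨L, hL⟩ := hχ.exists_lipschitzWith hΩ hK
  have h1 : ∀ i, l2Inner Ω (weakPartial Ω i v) (weakPartial Ω i χ) =
      -∫ x in Ω, weakPartial Ω i (weakPartial Ω i v) x * χ x := by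
    intro i
    -- Integration by parts is applied to ∂_i v and its weak derivative, with χ as the Lipschitz
    -- test function.
    rw [← IsWeakPartial.integral_lipPartial hΩ hb (weakPartial_spec (hv.2.1.2 i)).1
      (weakPartial_spec ((hv.2.2 i).2 i)) hL hχ.2.1, l2Inner]
    refine integral_congr_ae ?_
    filter_upwards [weakPartial_ae_eq_lipPartial hΩ hb hL hχ.2.1 i] with x hx
    rw [hx]
  rw [dirichletForm, Finset.sum_congr rfl fun i _ => h1 i, Finset.sum_neg_distrib, l2Inner,
    ← integral_finsetSum]
  · rw [← integral_neg]
    congr 1 with x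
    rw [opA, neg_mul, Finset.sum_mul]
  · intro i _
    exact (weakPartial_spec ((hv.2.2 i).2 i)).1.integrable_mul (hχ.memLp hb)

end Spectral

/-! ### Fourier coefficients of the semidiscrete and fully discrete solutions. -/

section Modes
open Filter Topology

variable {d : ℕ} {Ω : Set (Euc d)} {K : Geometry.SimplicialComplex ℝ (Euc d)}

/-- Linear functionals of finite element functions are combinations of the vertex values. -/
lemma exists_vertex_representation (hK : IsTriangulation Ω K) (c : femSpace Ω K →ₗ[ℝ] ℝ) :
    ∃ (s : Finset (Euc d)) (φ : Euc d → ℝ), ∀ χ : femSpace Ω K,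
      c χ = ∑ p ∈ s, φ p * (χ : Euc d → ℝ) p := by
  classical
  have := (finite_vertexSet hK).fintype
  obtain ⟨g, hg⟩ := (vertexEval Ω K).exists_leftInverse_of_injective
    (LinearMap.ker_eq_bot.2 (vertexEval_injective hK))
  set φ : Euc d → ℝ := fun p =>
    if h : p ∈ vertexSet K then c (g (Pi.single ⟨p, h⟩ 1)) else 0 with hφ
  refine ⟨(vertexSet K).toFinset, φ, fun χ => ?_⟩
  have h1 : c χ = c (g (vertexEval Ω K χ)) := by
    rw [← LinearMap.comp_apply g, hg]; rfl
  have h2 : c χ = ∑ p : vertexSet K, φ p * (χ : Euc d → ℝ) p := by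
    rw [h1, pi_eq_sum_univ' (vertexEval Ω K χ)]
    simp only [map_sum, map_smul, smul_eq_mul]
    refine Finset.sum_congr rfl fun p _ => ?_
    rw [hφ]
    simp only [Subtype.coe_prop, dif_pos, Subtype.coe_eta]
    rw [mul_comm]
    congr 3
  rw [h2]
  exact (Finset.sum_subtype _ (fun p => mem_toFinset) fun p => φ p * (χ : Euc d → ℝ) p).symm

lemma logFactor_nonneg (t : ℝ) : 0 ≤ logFactor t :=
  Real.log_nonneg (le_max_of_le_right one_le_two)

lemma cqSum_finset_sum {ι : Type*} (μ : ℝ → ℝ) (τ : ℝ) (n : ℕ) (s : Finset ι) (c : ι → ℝ)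
    (W : ι → ℕ → ℝ) :
    cqSum μ τ n (fun j => ∑ i ∈ s, c i * W i j) = ∑ i ∈ s, c i * cqSum μ τ n (W i) := by
  simp only [cqSum, Finset.mul_sum]
  rw [Finset.sum_comm]
  exact Finset.sum_congr rfl fun _ _ => Finset.sum_congr rfl fun _ _ => by ring

lemma cqSum_congr {μ : ℝ → ℝ} {τ : ℝ} {n : ℕ} {φ ψ : ℕ → ℝ} (h : ∀ j ≤ n, φ j = ψ j) :
    cqSum μ τ n φ = cqSum μ τ n ψ :=
  Finset.sum_congr rfl fun j hj => by rw [h j (Finset.mem_Icc.1 hj).2]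

lemma inner_femToLp (hb : Bornology.IsBounded Ω) (χ ψ : femSpace Ω K) :
    inner ℝ (femToLp hb K χ) (femToLp hb K ψ) = l2Inner Ω χ ψ :=
  inner_toLp (MemFEM.memLp hb χ.2) (MemFEM.memLp hb ψ.2)

lemma norm_femToLp (hb : Bornology.IsBounded Ω) (χ : femSpace Ω K) :
    ‖femToLp hb K χ‖ = l2Norm Ω χ :=
  norm_toLp_eq_l2Norm (MemFEM.memLp hb χ.2)

/-- An `L²(Ω)`-orthonormal basis of the finite element space that diagonalizes the Dirichlet
form. -/
lemma exists_fem_eigenbasis (hd : 1 ≤ d) (hΩ : IsOpen Ω) (hb : Bornology.IsBounded Ω)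
    (hK : IsTriangulation Ω K) :
    ∃ (m : ℕ) (e : Fin m → femSpace Ω K) (lam : Fin m → ℝ),
      Orthonormal ℝ (fun i => femToLp hb K (e i)) ∧ (∀ i, 0 < lam i) ∧
      (∀ χ : femSpace Ω K, ∑ i, l2Inner Ω (e i) χ • e i = χ) ∧
      ∀ i (χ : femSpace Ω K), dirichletForm Ω χ (e i) = lam i * l2Inner Ω (e i) χ := by
  have := finiteDimensional_femSpace hK
  have hsymm : ∀ χ ψ, femForm hΩ hb hK χ ψ = femForm hΩ hb hK ψ χ := fun χ ψ => by
    simp only [femForm_apply, real_inner_comm]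
  obtain ⟨m, e, lam, he, hsum, ha⟩ := exists_eigenbasis (femToLp hb K)
    (femToLp_injective hΩ hb) (femForm hΩ hb hK) hsymm
  refine ⟨m, e, lam, he, fun i => ?_, fun χ => ?_, fun i χ => ?_⟩
  · have h1 : femForm hΩ hb hK (e i) (e i) = lam i := by
      rw [ha, real_inner_self_eq_norm_sq, he.1 i]; simp
    have h2 : 0 ≤ femForm hΩ hb hK (e i) (e i) := by
      rw [femForm_apply]
      exact Finset.sum_nonneg fun _ _ => real_inner_self_nonneg
    refine lt_of_le_of_ne (h1 ▸ h2) fun h3 => ?_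
    have h4 := eq_zero_of_femForm_self hd hΩ hb hK (h1.trans h3.symm)
    have h5 := he.1 i
    simp [h4] at h5
  · simp only [← inner_femToLp hb]
    exact hsum χ
  · rw [← femForm_eq_dirichletForm hΩ hb hK, hsymm, ha, inner_femToLp]

variable {m : ℕ} {e : Fin m → femSpace Ω K}

lemma l2Inner_sum_mul {hb : Bornology.IsBounded Ω}
    (he : Orthonormal ℝ fun i => femToLp hb K (e i)) (D : Fin m → ℝ) (i : Fin m) :
    l2Inner Ω (fun x => ∑ k, (e k : Euc d → ℝ) x * D k) (e i) = D i := by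
  have h1 : (fun x => ∑ k, (e k : Euc d → ℝ) x * D k) =
      ((∑ k, D k • e k : femSpace Ω K) : Euc d → ℝ) := by
    ext x
    simp [Finset.sum_apply, mul_comm]
  rw [h1, ← inner_femToLp hb, map_sum]
  simp only [map_smul]
  rw [he.inner_left_fintype D i]
  simp

lemma l2Norm_sq_eq_sum (hb : Bornology.IsBounded Ω)
    (hsum : ∀ χ : femSpace Ω K, ∑ i, l2Inner Ω (e i) χ • e i = χ) (χ : femSpace Ω K) :
    l2Norm Ω χ ^ 2 = ∑ i, l2Inner Ω (e i) χ ^ 2 := by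
  rw [← norm_femToLp hb, ← real_inner_self_eq_norm_sq]
  conv_lhs => rw [← hsum χ]
  nth_rewrite 2 [hsum χ]
  simp only [map_sum, map_smul, sum_inner, real_inner_smul_left, inner_femToLp, sq]

lemma apply_eq_sum (hsum : ∀ χ : femSpace Ω K, ∑ i, l2Inner Ω (e i) χ • e i = χ)
    {χ : Euc d → ℝ} (hχ : MemFEM Ω K χ) (x : Euc d) :
    χ x = ∑ i, (e i : Euc d → ℝ) x * l2Inner Ω (e i) χ := by
  have h := congrFun (congrArg Subtype.val (hsum ⟨χ, hχ⟩)) x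
  refine h.symm.trans ?_
  simp [Finset.sum_apply, mul_comm]

lemma MemFEM.sub {f g : Euc d → ℝ} (hf : MemFEM Ω K f) (hg : MemFEM Ω K g) :
    MemFEM Ω K fun x => f x - g x :=
  (femSpace Ω K).sub_mem hf hg

lemma l2Inner_sub_right (hb : Bornology.IsBounded Ω) {f g h : Euc d → ℝ} (hf : MemFEM Ω K f)
    (hg : MemFEM Ω K g) (hh : MemFEM Ω K h) :
    l2Inner Ω f (fun x => g x - h x) = l2Inner Ω f g - l2Inner Ω f h := by
  have h1 := inner_femToLp hb (⟨f, hf⟩ : femSpace Ω K) (⟨g, hg⟩ - ⟨h, hh⟩)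
  rw [map_sub, inner_sub_right, inner_femToLp, inner_femToLp] at h1
  exact h1.symm

variable {μ : ℝ → ℝ} {T τ : ℝ} {N : ℕ} {vh : Euc d → ℝ} {lam : Fin m → ℝ}

/-- The Fourier coefficients of a semidiscrete solution are regular. -/
lemma IsSemidiscreteSolution.isRegular_l2Inner {u : ℝ → Euc d → ℝ}
    (hu : IsSemidiscreteSolution Ω K μ T vh u) (hb : Bornology.IsBounded Ω)
    (hK : IsTriangulation Ω K) (hT : 0 ≤ T) (χ : femSpace Ω K) :
    IsRegular T fun t => l2Inner Ω χ (u t) := by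
  -- The coefficient is a fixed finite combination of the values u(t, p) at vertices p, so it
  -- inherits their regularity in time.
  obtain ⟨s, φ, h⟩ := exists_vertex_representation hK
    ((innerₗ (Lp ℝ 2 (volume.restrict Ω)) (femToLp hb K χ)).comp (femToLp hb K))
  refine (IsRegular.sum (s := s) (f := fun p t => u t p) hT φ fun p _ =>
    ⟨hu.cont p, hu.contDiff p, hu.integrable p⟩).congr (fun t ht => ?_) hT
  have h1 := h ⟨u t, hu.mem t ht⟩
  rw [LinearMap.comp_apply, innerₗ_apply_apply, inner_femToLp] at h1
  exact h1

/-- The Fourier coefficients of a semidiscrete solution solve scalar relaxation equations. -/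
lemma IsSemidiscreteSolution.distrDeriv_l2Inner (hμ : ContinuousOn μ (Icc 0 1))
    (hμ0 : ∀ α ∈ Icc (0 : ℝ) 1, 0 ≤ μ α) {u : ℝ → Euc d → ℝ}
    (hu : IsSemidiscreteSolution Ω K μ T vh u) {hb : Bornology.IsBounded Ω}
    (hK : IsTriangulation Ω K) (he : Orthonormal ℝ fun i => femToLp hb K (e i))
    (hsum : ∀ χ : femSpace Ω K, ∑ i, l2Inner Ω (e i) χ • e i = χ)
    (heig : ∀ i (χ : femSpace Ω K), dirichletForm Ω χ (e i) = lam i * l2Inner Ω (e i) χ)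
    (i : Fin m) {t : ℝ} (ht : t ∈ Ioo 0 T) :
    distrDeriv μ (fun s => l2Inner Ω (e i) (u s)) t + lam i * l2Inner Ω (e i) (u t) = 0 := by
  have hT : 0 ≤ T := ht.1.le.trans ht.2.le
  have h1 := hu.eqn t ⟨ht.1, ht.2.le⟩ (e i) (e i).2
  -- For each x, u(s, x) = Σ e_k(x) c_k(s), so by linearity the derivative acts on the coefficients
  -- c_k; testing with e_i isolates one mode.
  have h2 : (fun x => distrDeriv μ (fun s => u s x) t) =
      fun x => ∑ k, (e k : Euc d → ℝ) x * distrDeriv μ (fun s => l2Inner Ω (e k) (u s)) t := by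
    ext x
    rw [distrDeriv_eq_of_eqOn (fun s hs => apply_eq_sum hsum (hu.mem s hs) x) ht,
      distrDeriv_sum hμ hμ0 (fun k => (e k : Euc d → ℝ) x)
        (fun k _ => hu.isRegular_l2Inner hb hK hT (e k)) ht]
  have h3 := heig i ⟨u t, hu.mem t ⟨ht.1.le, ht.2.le⟩⟩
  rw [h2, l2Inner_sum_mul he, h3] at h1
  exact h1

/-- The Fourier coefficients of a fully discrete solution solve scalar convolution quadrature
schemes. -/
lemma IsFullyDiscreteSolution.cqSum_l2Inner {U : ℕ → Euc d → ℝ}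
    (hU : IsFullyDiscreteSolution Ω K μ τ N vh U) (hvh : MemFEM Ω K vh)
    {hb : Bornology.IsBounded Ω} (he : Orthonormal ℝ fun i => femToLp hb K (e i))
    (hsum : ∀ χ : femSpace Ω K, ∑ i, l2Inner Ω (e i) χ • e i = χ)
    (heig : ∀ i (χ : femSpace Ω K), dirichletForm Ω χ (e i) = lam i * l2Inner Ω (e i) χ)
    (i : Fin m) {n : ℕ} (h1n : 1 ≤ n) (hn : n ≤ N) :
    cqSum μ τ n (fun j => l2Inner Ω (e i) (U j)) + lam i * l2Inner Ω (e i) (U n) =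
      cqSum μ τ n (fun _ => 1) * l2Inner Ω (e i) vh := by
  have h1 := hU.eqn n h1n hn (e i) (e i).2
  have h2 : (fun x => cqSum μ τ n fun j => U j x) =
      fun x => ∑ k, (e k : Euc d → ℝ) x * cqSum μ τ n fun j => l2Inner Ω (e k) (U j) := by
    ext x
    rw [cqSum_congr fun j hj => apply_eq_sum hsum (hU.mem j (hj.trans hn)) x, cqSum_finset_sum]
  have h3 : (fun x => cqSum μ τ n (fun _ => 1) * vh x) =
      fun x => ∑ k, (e k : Euc d → ℝ) x * (cqSum μ τ n (fun _ => 1) * l2Inner Ω (e k) vh) := by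
    ext x
    rw [apply_eq_sum hsum hvh x, Finset.mul_sum]
    exact Finset.sum_congr rfl fun k _ => by ring
  have h4 := heig i ⟨U n, hU.mem n hn⟩
  rw [h2, h3, l2Inner_sum_mul he, l2Inner_sum_mul he, h4] at h1
  exact h1

/-- Bessel's inequality. -/
lemma sum_l2Inner_sq_le {hb : Bornology.IsBounded Ω}
    (he : Orthonormal ℝ fun i => femToLp hb K (e i)) {w : Euc d → ℝ}
    (hw : MemLp w 2 (volume.restrict Ω)) :
    ∑ i, l2Inner Ω w (e i) ^ 2 ≤ l2Norm Ω w ^ 2 := by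
  have h := he.sum_inner_products_le (hw.toLp w) (s := Finset.univ)
  rw [norm_toLp_eq_l2Norm hw] at h
  refine le_of_eq_of_le (Finset.sum_congr rfl fun i _ => ?_) h
  rw [Real.norm_eq_abs, sq_abs, real_inner_comm]
  congr 1
  exact (inner_toLp hw (MemFEM.memLp hb (e i).2)).symm

/-- If the Fourier coefficients of a finite element function are dominated by those of `w`, then so
is its `L²(Ω)` norm. -/
lemma l2Norm_le_of_coeff_le {hb : Bornology.IsBounded Ω}
    (he : Orthonormal ℝ fun i => femToLp hb K (e i))
    (hsum : ∀ χ : femSpace Ω K, ∑ i, l2Inner Ω (e i) χ • e i = χ) {w : Euc d → ℝ}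
    (hw : MemLp w 2 (volume.restrict Ω)) {B : ℝ} (hB : 0 ≤ B) {χ : Euc d → ℝ}
    (hχ : MemFEM Ω K χ) (h : ∀ i, |l2Inner Ω (e i) χ| ≤ B * |l2Inner Ω w (e i)|) :
    l2Norm Ω χ ≤ B * l2Norm Ω w := by
  refine le_of_sq_le_sq ?_ (mul_nonneg hB ENNReal.toReal_nonneg)
  have hnorm : l2Norm Ω χ ^ 2 = ∑ i, l2Inner Ω (e i) χ ^ 2 := l2Norm_sq_eq_sum hb hsum ⟨χ, hχ⟩
  rw [hnorm, mul_pow]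
  refine le_trans ?_ (mul_le_mul_of_nonneg_left (sum_l2Inner_sq_le he hw) (sq_nonneg B))
  rw [Finset.mul_sum]
  refine Finset.sum_le_sum fun i _ => ?_
  rw [← mul_pow]
  refine sq_le_sq.2 ((h i).trans_eq ?_)
  rw [abs_mul, abs_of_nonneg hB]

end Modes
end DistrOrder

/-! ### Assembly of the modes into the L² error estimate. -/

theorem theorem5p2 (d : ℕ) (hd : 1 ≤ d) (hd' : d ≤ 3)
    (Ω : Set (DistrOrder.Euc d)) (hΩ : DistrOrder.IsConvexPolytopeDomain Ω)
    (μ : ℝ → ℝ) (hμ : ContinuousOn μ (Set.Icc 0 1)) (hμ0 : ∀ α ∈ Set.Icc (0 : ℝ) 1, 0 ≤ μ α)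
    (hμ01 : 0 < μ 0 * μ 1) :
    ∃ c : ℝ, 0 < c ∧
      ∀ (K : Geometry.SimplicialComplex ℝ (DistrOrder.Euc d)), DistrOrder.IsTriangulation Ω K →
      ∀ (v vh : DistrOrder.Euc d → ℝ), DistrOrder.MemDomA Ω v →
        DistrOrder.IsRitzProjection Ω K v vh →
      ∀ (T : ℝ), 0 < T → ∀ (N : ℕ), 1 ≤ N → ∀ (τ : ℝ), τ = T / N →
      ∀ (u : ℝ → DistrOrder.Euc d → ℝ), DistrOrder.IsSemidiscreteSolution Ω K μ T vh u →
      ∀ (U : ℕ → DistrOrder.Euc d → ℝ), DistrOrder.IsFullyDiscreteSolution Ω K μ τ N vh U →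
      ∀ (n : ℕ), 1 ≤ n → n ≤ N →
        DistrOrder.l2Norm Ω (fun x => u (n * τ) x - U n x) ≤
          c * τ * DistrOrder.logFactor (n * τ) * DistrOrder.l2Norm Ω (DistrOrder.opA Ω v) := by
  have hμ1 : 0 < μ 1 := pos_of_mul_pos_right hμ01 (hμ0 0 (by simp))
  obtain ⟨C, hC, hmain⟩ := DistrOrder.exists_scalar_error_bound hμ hμ0 hμ1
  refine ⟨C, hC, fun K hK v vh hv hvh T hT N hN τ hτ u hu U hU n h1n hn => ?_⟩
  have hΩo := hΩ.isOpen
  have hb := hΩ.isBounded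
  obtain ⟨m, e, lam, he, hlam, hsum, heig⟩ := DistrOrder.exists_fem_eigenbasis hd hΩo hb hK
  have hN0 : (0 : ℝ) < N := by exact_mod_cast hN
  have hτ0 : 0 < τ := hτ ▸ div_pos hT hN0
  have htn : (n : ℝ) * τ ∈ Set.Icc 0 T := by
    refine ⟨by positivity, ?_⟩
    have hTN : T = N * τ := by rw [hτ]; field_simp
    rw [hTN]
    exact mul_le_mul_of_nonneg_right (by exact_mod_cast hn) hτ0.le
  set B := C * τ * DistrOrder.logFactor (n * τ) with hB
  have hB0 : 0 ≤ B := mul_nonneg (by positivity) (DistrOrder.logFactor_nonneg _)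
  have hmode : ∀ i, |DistrOrder.l2Inner Ω (e i) (u (n * τ)) - DistrOrder.l2Inner Ω (e i) (U n)| ≤
      B * |DistrOrder.l2Inner Ω (DistrOrder.opA Ω v) (e i)| := by
    intro i
    have h1 := hmain (lam i) (hlam i) T hT N hN τ hτ (fun t => DistrOrder.l2Inner Ω (e i) (u t))
      (hu.isRegular_l2Inner hb hK hT.le (e i))
      (fun t ht => hu.distrDeriv_l2Inner hμ hμ0 hK he hsum heig i ht)
      (fun k => DistrOrder.l2Inner Ω (e i) (U k))
      (fun k h1k hk => by
        simp only [hu.init]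
        exact hU.cqSum_l2Inner hvh.1 he hsum heig i h1k hk) n h1n hn
    -- The Ritz projection and Green's formula absorb the eigenvalue, λ_i (e_i, v_h) = (Av, e_i), so
    -- the scalar bounds sum to ‖Av‖ by Bessel.
    have h2 : lam i * DistrOrder.l2Inner Ω (e i) vh =
        DistrOrder.l2Inner Ω (DistrOrder.opA Ω v) (e i) := by
      rw [← DistrOrder.dirichletForm_eq_l2Inner_opA hΩo hb hK hv (e i).2,
        ← hvh.2 (e i) (e i).2]
      exact (heig i ⟨vh, hvh.1⟩).symm
    simp only [hu.init] at h1
    rwa [← abs_of_pos (hlam i), ← abs_mul, h2] at h1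
  have hmem : DistrOrder.MemFEM Ω K (u (n * τ)) := hu.mem _ htn
  have hdiff : DistrOrder.MemFEM Ω K (fun x => u (n * τ) x - U n x) :=
    hmem.sub (hU.mem n hn)
  refine DistrOrder.l2Norm_le_of_coeff_le he hsum (DistrOrder.memLp_opA hv) hB0 hdiff fun i => ?_
  rw [DistrOrder.l2Inner_sub_right hb (e i).2 hmem (hU.mem n hn)]
  exact hmode i
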